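/- Let $D\subset\mathbb R^2$ be a bounded domain with Lipschitz boundary, with coordinates $(x^1,x^2)=(z,r)$ and $r\ge r_0>0$ on $D$; let $\varepsilon>0$ and $\Omega=D\times(-1,1)$ with coordinates $(x^1,x^2,x^3)$, $x^3=\xi$. Write $\partial D=\gamma_0\cup\gamma_1$ with $\gamma_0,\gamma_1$ closed and meeting in at most finitely many points, let $\widetilde\Gamma_0=(\gamma_0\times[-1,1])\cup(\overline D\times\{-1,1\})$ and $V(\Omega)=\{w\in H^1(\Omega)^3:\ w|_{\widetilde\Gamma_0}=0\}$ (in the sense of traces). Greek indices run over $\{1,2\}$, Latin ones over $\{1,2,3\}$, and repeated indices are summed. For $\Theta\in C^2(D)$ with $\Theta_\alpha=\partial\Theta/\partial x^\alpha$ let $(g_{ij})$ be the metric $g_{\alpha\beta}=\delta_{\alpha\beta}+r^2\Theta_\alpha\Theta_\beta$, $g_{3\beta}=g_{\beta3}=\varepsilon r^2\Theta_\beta$, $g_{33}=\varepsilon^2r^2$, with inverse $(g^{ij})$, $g=\det(g_{ij})=\varepsilon^2r^2$ and covariant derivative $\nabla$. For a viscosity $\mu>0$ put $e_{ij}(w)=\frac12(\nabla_iw_j+\nabla_jw_i)$,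 $A^{ijkm}=\mu(g^{ik}g^{jm}+g^{im}g^{jk})$ and $$a(w,v)=\int_\Omega A^{ijkm}e_{ij}(w)e_{km}(v)\sqrt g\,dx\,d\xi .$$ Let $\varphi_{\alpha\beta}(w)=\frac12(\partial_\beta w^\alpha+\partial_\alpha w^\beta)$, $\varphi_{3\alpha}(w)=\frac12(\partial_\xi w^\alpha+\varepsilon^2r^2\partial_\alpha w^3)$, $\varphi_{33}(w)=\varepsilon^2r^2(\partial_\xi w^3+w^2/r)$ (where $w^2$ is the second component of $w$), and $$\|w\|_\Omega^2=\int_\Omega\big[\varphi_{\alpha\beta}(w)\varphi_{\alpha\beta}(w)+2(r\varepsilon)^{-2}\varphi_{3\alpha}(w)\varphi_{3\alpha}(w)+(r\varepsilon)^{-4}\varphi_{33}(w)^2\big]\,r\varepsilon\,dx\,d\xi ,$$ and let $\|w\|_{1,\Omega}$ be the norm of $H^1(\Omega)^3$. Then there are constants $\beta_0(\Omega)>0$ and $C_1(\Omega)>0$, depending only on $D$ and $\varepsilon$, such that: whenever $K_0\le 1/\sqrt{2\beta_0(\Omega)}$ and $\Theta\in C^2(D)$ satisfies $|\partial_\lambda\Theta|\le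 K_0$ and $|\partial_\lambda\partial_\sigma\Theta|\le K_0$ on $D$ for all $\lambda,\sigma$, then for every $\mu>0$ $$a(w,w)\ \ge\ \frac\mu4\|w\|_\Omega^2\ \ge\ \frac\mu4\,C_1(\Omega)\,\|w\|_{1,\Omega}^2\qquad\text{for all } w\in V(\Omega).$$ In particular the constants do not depend on $\Theta$. -/

import Mathlib

open MeasureTheory
open scoped ContDiff

namespace Impeller

/-- The `(x¹, x²) = (z, r)` plane (indices `0`, `1`). -/
abbrev E2 : Type := EuclideanSpace ℝ (Fin 2)

/-- The space of the coordinates `(x¹, x², ξ)` (indices `0`, `1`, `2`). -/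
abbrev E3 : Type := EuclideanSpace ℝ (Fin 3)

/-- The classical partial derivative `∂f/∂xⁱ` at `x`. -/
noncomputable def partialD {n : ℕ} (i : Fin n) (f : EuclideanSpace ℝ (Fin n) → ℝ)
    (x : EuclideanSpace ℝ (Fin n)) : ℝ :=
  fderiv ℝ f x (EuclideanSpace.single i 1)

/-! ### Domains -/

/-- A plane set with Lipschitz boundary: near each of its boundary points, and in suitable
orthonormal coordinates centred there, it is the strict epigraph of a Lipschitz function. -/
def HasLipschitzBoundary (D : Set E2) : Prop :=
  ∀ p ∈ frontier D, ∃ (L : E2 ≃ₗᵢ[ℝ] E2) (K : NNReal) (g : ℝ → ℝ) (δ : ℝ),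
    LipschitzWith K g ∧ 0 < δ ∧
      ∀ y ∈ Metric.ball p δ, y ∈ D ↔ g (L (y - p) 0) < L (y - p) 1

/-- The projection `(x¹, x², ξ) ↦ (x¹, x²)`. -/
noncomputable def proj (x : E3) : E2 := !₂[x 0, x 1]

/-- The fixed flow domain `Ω = D × (-1, 1)`. -/
def channel (D : Set E2) : Set E3 := {x | proj x ∈ D ∧ -1 < x 2 ∧ x 2 < 1}

/-- The solid part of `∂Ω`: the lateral walls `γ₀ × [-1, 1]` and the two blade faces
`ξ = 1` and `ξ = -1`. -/
def solidWall (D γ₀ : Set E2) : Set E3 :=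
  {x | proj x ∈ γ₀ ∧ -1 ≤ x 2 ∧ x 2 ≤ 1} ∪ {x | proj x ∈ closure D ∧ (x 2 = 1 ∨ x 2 = -1)}

/-! ### Sobolev fields -/

/-- An element `w = (w¹, w², w³)` of `H¹(Ω)³`, together with its weak derivatives
`deriv i j = ∂wʲ/∂xⁱ`, which `w` determines almost everywhere. -/
structure H1Field (Ω : Set E3) where
  /-- the components `wʲ` -/
  val : Fin 3 → E3 → ℝ
  /-- the weak derivatives `∂wʲ/∂xⁱ` (derivative index first) -/
  deriv : Fin 3 → Fin 3 → E3 → ℝ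
  memLp_val : ∀ j, MemLp (val j) 2 (volume.restrict Ω)
  memLp_deriv : ∀ i j, MemLp (deriv i j) 2 (volume.restrict Ω)
  weak : ∀ i j, ∀ η : E3 → ℝ, ContDiff ℝ ∞ η → HasCompactSupport η → tsupport η ⊆ Ω →
    ∫ x in Ω, val j x * partialD i η x = - ∫ x in Ω, deriv i j x * η x

/-- `w = 0` on the part `Γ` of `∂Ω`, in the sense of traces. In a Lipschitz domain Green's formula
says that `∫_Ω wʲ ∂ᵢη + ∫_Ω ∂ᵢwʲ η = ∫_∂Ω (tr wʲ) η nᵢ`; so the trace vanishes on `Γ` exactly if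
the left-hand side is zero for all `i`, `j` and all test functions `η` on the whole space whose
support meets `∂Ω` only in `Γ`. -/
def H1Field.VanishesOn {Ω : Set E3} (w : H1Field Ω) (Γ : Set E3) : Prop :=
  ∀ i j, ∀ η : E3 → ℝ, ContDiff ℝ ∞ η → HasCompactSupport η → tsupport η ∩ frontier Ω ⊆ Γ →
    ∫ x in Ω, w.val j x * partialD i η x = - ∫ x in Ω, w.deriv i j x * η x

/-- The square of the `H¹(Ω)³` norm. -/
noncomputable def H1Field.h1NormSq {Ω : Set E3} (w : H1Field Ω) : ℝ :=
  ∫ x in Ω, ((∑ j, w.val j x ^ 2) + ∑ i, ∑ j, w.deriv i j x ^ 2)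

/-! ### Blade surfaces and the metric of the coordinate system -/

/-- `Θ` is of class `C²` on `D`, and its first and second partial derivatives are bounded
by `K₀` on `D`. -/
def IsBlade (D : Set E2) (K₀ : ℝ) (Θ : E2 → ℝ) : Prop :=
  ContDiffOn ℝ 2 Θ D ∧
    (∀ x ∈ D, ∀ l, |partialD l Θ x| ≤ K₀) ∧
    (∀ x ∈ D, ∀ l s, |partialD l (partialD s Θ) x| ≤ K₀)

section Metric

variable (ε : ℝ) (Θ : E2 → ℝ)

/-- The covariant metric tensor: `g_{αβ} = δ_{αβ} + r²Θ_αΘ_β`, `g_{3β} = εr²Θ_β`,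
`g_{33} = ε²r²`, with `r = x²` and `Θ_α = ∂Θ/∂x^α`. It is the Euclidean metric in the coordinates
`(x¹, x², ξ)`, where `z = x¹`, `r = x²`, `θ = εξ + Θ(x¹, x²)` are cylindrical coordinates. -/
noncomputable def metric (x : E3) : Matrix (Fin 3) (Fin 3) ℝ :=
  let r := x 1
  let T₁ := partialD 0 Θ (proj x)
  let T₂ := partialD 1 Θ (proj x)
  !![1 + r ^ 2 * T₁ * T₁, r ^ 2 * T₁ * T₂,     ε * r ^ 2 * T₁;
     r ^ 2 * T₂ * T₁,     1 + r ^ 2 * T₂ * T₂, ε * r ^ 2 * T₂;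
     ε * r ^ 2 * T₁,      ε * r ^ 2 * T₂,      ε ^ 2 * r ^ 2]

/-- The contravariant metric tensor `g^{ij}`. -/
noncomputable def metricInv (x : E3) : Matrix (Fin 3) (Fin 3) ℝ := (metric ε Θ x)⁻¹

/-- The volume density `√g`, `g = det (g_{ij})`. -/
noncomputable def volDensity (x : E3) : ℝ := √(metric ε Θ x).det

/-- The derivative `∂g_{ij}/∂x^k`. -/
noncomputable def metricD (k i j : Fin 3) (x : E3) : ℝ :=
  partialD k (fun y => metric ε Θ y i j) x

/-- The Christoffel symbols `Γ^i_{jk} = ½ g^{il} (∂_j g_{kl} + ∂_k g_{jl} - ∂_l g_{jk})`. -/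
noncomputable def christoffel (i j k : Fin 3) (x : E3) : ℝ :=
  1 / 2 * ∑ l, metricInv ε Θ x i l *
    (metricD ε Θ j k l x + metricD ε Θ k j l x - metricD ε Θ l j k x)

/-- The covariant derivative `∇_i w^j = ∂w^j/∂x^i + Γ^j_{ik} w^k`. -/
noncomputable def covD {Ω : Set E3} (w : H1Field Ω) (i j : Fin 3) (x : E3) : ℝ :=
  w.deriv i j x + ∑ k, christoffel ε Θ j i k x * w.val k x

/-- The strain rate tensor `e_{ij}(w) = ½ (∇_i w_j + ∇_j w_i)`, with `∇_i w_j = g_{jk} ∇_i w^k`. -/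
noncomputable def strain {Ω : Set E3} (w : H1Field Ω) (i j : Fin 3) (x : E3) : ℝ :=
  1 / 2 * ((∑ k, metric ε Θ x j k * covD ε Θ w i k x) +
    ∑ k, metric ε Θ x i k * covD ε Θ w j k x)

/-- The viscosity tensor of an incompressible fluid,
`A^{ijkm} = μ (g^{ik} g^{jm} + g^{im} g^{jk})`. -/
noncomputable def viscosity (μ : ℝ) (i j k m : Fin 3) (x : E3) : ℝ :=
  μ * (metricInv ε Θ x i k * metricInv ε Θ x j m + metricInv ε Θ x i m * metricInv ε Θ x j k)

/-- The viscous bilinear form `a(w, v) = ∫_Ω A^{ijkm} e_{ij}(w) e_{km}(v) √g dx dξ`. -/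
noncomputable def viscousForm (μ : ℝ) {Ω : Set E3} (w v : H1Field Ω) : ℝ :=
  ∫ x in Ω, (∑ i, ∑ j, ∑ k, ∑ m,
    viscosity ε Θ μ i j k m x * strain ε Θ w i j x * strain ε Θ v k m x) * volDensity ε Θ x

end Metric

/-! ### The norm `‖·‖_Ω` -/

section Norm

variable (ε : ℝ) {Ω : Set E3} (w : H1Field Ω)

/-- `φ_{αβ}(w) = ½ (∂w^α/∂x^β + ∂w^β/∂x^α)`, for `α, β ∈ {1, 2}`. -/
noncomputable def phiTan (α β : Fin 2) (x : E3) : ℝ :=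
  1 / 2 * (w.deriv β.castSucc α.castSucc x + w.deriv α.castSucc β.castSucc x)

/-- `φ_{3α}(w) = ½ (∂w^α/∂ξ + ε²r² ∂w³/∂x^α)`, for `α ∈ {1, 2}`. -/
noncomputable def phiMix (α : Fin 2) (x : E3) : ℝ :=
  1 / 2 * (w.deriv 2 α.castSucc x + ε ^ 2 * x 1 ^ 2 * w.deriv α.castSucc 2 x)

/-- `φ_{33}(w) = ε²r² (∂w³/∂ξ + w²/r)`. -/
noncomputable def phiNormal (x : E3) : ℝ :=
  ε ^ 2 * x 1 ^ 2 * (w.deriv 2 2 x + w.val 1 x / x 1)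

/-- `‖w‖²_Ω = ∫_Ω [φ_{αβ}φ_{αβ} + 2(rε)⁻²φ_{3α}φ_{3α} + (rε)⁻⁴φ_{33}φ_{33}] rε dx dξ`. -/
noncomputable def omegaNormSq : ℝ :=
  ∫ x in Ω, ((∑ α, ∑ β, phiTan w α β x ^ 2)
    + 2 * ((x 1 * ε) ^ 2)⁻¹ * (∑ α, phiMix ε w α x ^ 2)
    + ((x 1 * ε) ^ 4)⁻¹ * phiNormal ε w x ^ 2) * (x 1 * ε)

end Norm

end Impeller

set_option linter.unusedSectionVars false

namespace Impeller

/-! ### Integration by parts and averages at a scale -/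

section Calculus

variable {E : Type*} [NormedAddCommGroup E] [NormedSpace ℝ E] [FiniteDimensional ℝ E]
  [MeasurableSpace E] [BorelSpace E] {μ : Measure E} [μ.IsAddHaarMeasure]

/-! The theorem combines a coercivity estimate `‖w‖²_{1,Ω} ≤ C‖w‖²_Ω`, in which `Θ` does not occur
(`exists_h1NormSq_le`), with a perturbation estimate that measures how far `a` is from its form at
`Θ = 0` (`viscousForm_ge`).

Perturbation. The metric has an explicit orthonormal frame, and in it the integrand of `a(w,w)` is
`2μ|φ + E|² rε`. Here `φ` collects the normalised `φ_{ij}(w)`, so that `|φ|² rε` is the integrand of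
`‖w‖²_Ω`, and `E` is linear in `w` and `∇w` with coefficients built from the first and second
derivatives of `Θ`. Hence `|E| ≤ cK₀(|w| + |∇w|)` for `K₀ ≤ 1`, and `2(φ + E)² ≥ φ² - 2E²` gives
`a(w,w) ≥ μ‖w‖²_Ω - μcK₀²‖w‖²_{1,Ω}` with another `c`. Coercivity absorbs the last term once `cCK₀²
≤ 1/2`, which dictates `β₀`.

Coercivity. The field `u = (w¹, w², ε²r²w³)`, extended by zero across the blade faces, has `e(u) = φ
+ O(|u|)` up to bounded factors. Two inequalities are needed: Korn's `∫|∇u|² ≤ C∫(|e(u)|² + |u|²)`,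
and a Poincaré inequality strong enough to absorb `O(|u|)`. The second replaces the usual
compactness argument. If `d` has `ξ`-component one, then `∂_d(d·u) = dᵀe(u)d` involves the
symmetrised gradient only. If moreover `d` points into `D`, a line in direction `d` leaves `Ω`
through `ξ = 1`, where `u = 0`, so no condition on the lateral wall is needed. The weight `e^{lξ}`
then yields `l²∫e^{lξ}|u|² ≤ C∫e^{lξ}|e(u)|²` with `C` independent of `l`
(`exists_poincare_constant`), and a large `l` absorbs every zeroth order term
(`exists_coercive_constant`).

Korn's inequality is local, so it suffices to treat compactly supported fields on a Lipschitz
supergraph `{ρ > 0}` (`exists_korn_constant`). Let `v(x)` be the average of `u` over a ball of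
radius `h(x)` proportional to `ρ(x)`. The difference `u - v` has vanishing gradient off `{ρ > 0}`,
and its symmetrised gradient is controlled by that of `u`, so Korn's first inequality on the whole
space applies to it. The gradient of `v` is, up to controlled terms, an average `W` of `∇u`. Second
derivatives of `u` are combinations of first derivatives of `e(u)`, so `|∂_νW|` is at most `h⁻¹`
times an average of `|e(u)|`, and Hardy's inequality bounds `W` itself. Mollification extends the
result to weakly differentiable fields. -/

lemma continuous_fderiv_dir {f : E → ℝ} (hf : ContDiff ℝ 1 f) (v : E) :
    Continuous fun x => fderiv ℝ f x v :=
  (hf.continuous_fderiv one_ne_zero).clm_apply continuous_const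

lemma contDiff_fderiv_dir {f : E → ℝ} (hf : ContDiff ℝ ∞ f) (v : E) :
    ContDiff ℝ ∞ fun x => fderiv ℝ f x v :=
  (hf.fderiv_right (m := ∞) le_rfl).clm_apply contDiff_const

lemma hasCompactSupport_fderiv_dir {f : E → ℝ} (hf : HasCompactSupport f) (v : E) :
    HasCompactSupport fun x => fderiv ℝ f x v :=
  hf.fderiv_apply ℝ v

/-- Integration by parts in a fixed direction, without boundary terms. -/
lemma integral_fderiv_dir_mul {f g : E → ℝ} (hf : ContDiff ℝ 1 f) (hg : ContDiff ℝ 1 g)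
    (hc : HasCompactSupport g) (v : E) :
    ∫ x, fderiv ℝ f x v * g x ∂μ = - ∫ x, f x * fderiv ℝ g x v ∂μ := by
  have h1 := continuous_fderiv_dir hf v
  have h2 := continuous_fderiv_dir hg v
  rw [integral_mul_fderiv_eq_neg_fderiv_mul_of_integrable, neg_neg]
  · exact (h1.mul hg.continuous).integrable_of_hasCompactSupport hc.mul_left
  · exact (hf.continuous.mul h2).integrable_of_hasCompactSupport
      (hasCompactSupport_fderiv_dir hc v).mul_left
  · exact (hf.continuous.mul hg.continuous).integrable_of_hasCompactSupport hc.mul_left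
  · exact fun x _ => hf.differentiable one_ne_zero x
  · exact fun x _ => hg.differentiable one_ne_zero x

lemma integral_fderiv_dir {f : E → ℝ} (hf : ContDiff ℝ 1 f) (hc : HasCompactSupport f) (v : E) :
    ∫ x, fderiv ℝ f x v ∂μ = 0 := by
  have := integral_fderiv_dir_mul (μ := μ) (f := fun _ => (1 : ℝ)) contDiff_const hf hc v
  simpa using this.symm

/-- The average `∫ f (x + hζ) k(ζ) dζ` of `f` at scale `h` about `x`. -/
noncomputable def scaleAvg (μ : Measure E) (k f : E → ℝ) (p : E × ℝ) : ℝ :=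
  ∫ ζ, f (p.1 + p.2 • ζ) * k ζ ∂μ

lemma contDiff_scaleAvg {k f : E → ℝ} (hk : ContDiff ℝ ∞ k) (hkc : HasCompactSupport k)
    (hf : ContDiff ℝ ∞ f) : ContDiff ℝ ∞ (scaleAvg μ k f) := by
  -- The average is the convolution of the constant 1 with a kernel depending on the parameter `p`,
  -- evaluated at the origin; joint smoothness in the centre and the scale, including scale 0, then
  -- comes from parametric convolution.
  have key := contDiffOn_convolution_right_with_param (μ := μ) (n := ⊤) (𝕜 := ℝ)
    (ContinuousLinearMap.mul ℝ ℝ) (f := fun _ : E => (1 : ℝ))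
    (g := fun (p : E × ℝ) (y : E) => f (p.1 - p.2 • y) * k (-y)) (s := Set.univ)
    (k := Neg.neg ⁻¹' tsupport k) isOpen_univ
    ((Homeomorph.neg E).isCompact_preimage.2 hkc)
    (fun p x _ hx => by
      rw [image_eq_zero_of_notMem_tsupport (f := k) hx, mul_zero])
    (locallyIntegrable_const 1) (by
      apply ContDiff.contDiffOn
      have : ContDiff ℝ ∞ fun q : (E × ℝ) × E => f (q.1.1 - q.1.2 • q.2) * k (-q.2) := by
        fun_prop
      exact this)
  rw [Set.univ_prod_univ, contDiffOn_univ] at key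
  have h2 := key.comp (contDiff_id.prodMk (contDiff_const (c := (0 : E))) :
    ContDiff ℝ ∞ fun p : E × ℝ => (p, (0 : E)))
  convert h2 using 1
  ext p
  simp [convolution, scaleAvg]

lemma fderiv_scaleAvg {k f : E → ℝ} (hk : ContDiff ℝ ∞ k) (hkc : HasCompactSupport k)
    (hf : ContDiff ℝ ∞ f) (p q : E × ℝ) :
    fderiv ℝ (scaleAvg μ k f) p q =
      ∫ ζ, fderiv ℝ f (p.1 + p.2 • ζ) (q.1 + q.2 • ζ) * k ζ ∂μ := by
  have hd : DifferentiableAt ℝ (scaleAvg μ k f) p :=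
    (contDiff_scaleAvg hk hkc hf).differentiable (by simp) p
  have h1 : HasDerivAt (fun t : ℝ => scaleAvg μ k f (p + t • q))
      (fderiv ℝ (scaleAvg μ k f) p q) 0 := hd.hasFDerivAt.hasLineDerivAt q
  refine h1.unique ?_
  have hf1 : Continuous (fderiv ℝ f) := hf.continuous_fderiv (by simp)
  have hcont : Continuous fun z : ℝ × E =>
      fderiv ℝ f ((p + z.1 • q).1 + (p + z.1 • q).2 • z.2) (q.1 + q.2 • z.2) * k z.2 := by
    have := hk.continuous
    fun_prop
  obtain ⟨M, hM⟩ := ((isCompact_closedBall (0 : ℝ) 1).prod hkc).exists_bound_of_continuousOn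
    hcont.continuousOn
  have hcz : ∀ t : ℝ, Continuous fun ζ : E => f ((p + t • q).1 + (p + t • q).2 • ζ) * k ζ := by
    intro t
    have := hk.continuous
    have := hf.continuous
    fun_prop
  have := hasDerivAt_integral_of_dominated_loc_of_deriv_le (μ := μ) (𝕜 := ℝ)
    (F := fun t ζ => f ((p + t • q).1 + (p + t • q).2 • ζ) * k ζ)
    (F' := fun t ζ =>
      fderiv ℝ f ((p + t • q).1 + (p + t • q).2 • ζ) (q.1 + q.2 • ζ) * k ζ)
    (x₀ := 0) (s := Metric.ball 0 1) (bound := (tsupport k).indicator fun _ => M)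
    (Metric.ball_mem_nhds 0 one_pos)
    (Filter.Eventually.of_forall fun t => (hcz t).aestronglyMeasurable)
    ((hcz 0).integrable_of_hasCompactSupport hkc.mul_left)
    (by
      have : Continuous fun ζ : E => fderiv ℝ f ((p + (0 : ℝ) • q).1 + (p + (0 : ℝ) • q).2 • ζ)
          (q.1 + q.2 • ζ) * k ζ := hcont.comp (continuous_const.prodMk continuous_id)
      exact this.aestronglyMeasurable)
    (Filter.Eventually.of_forall fun ζ t ht => by
      by_cases hζ : ζ ∈ tsupport k
      · rw [Set.indicator_of_mem hζ]
        exact hM (t, ζ) ⟨Metric.ball_subset_closedBall ht, hζ⟩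
      · rw [image_eq_zero_of_notMem_tsupport hζ]
        simp [hζ])
    ((integrable_indicator_iff hkc.isClosed.measurableSet).2
      (integrableOn_const (hkc.measure_lt_top.ne)))
    (Filter.Eventually.of_forall fun ζ t _ => by
      have hin : HasDerivAt (fun t : ℝ => (p + t • q).1 + (p + t • q).2 • ζ)
          (q.1 + q.2 • ζ) t := by
        have ha : HasDerivAt (fun t : ℝ => p.1 + t • q.1) q.1 t := by
          simpa using ((hasDerivAt_id t).smul_const q.1).const_add p.1
        have hb : HasDerivAt (fun t : ℝ => (p.2 + t * q.2) • ζ) (q.2 • ζ) t := by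
          simpa using (((hasDerivAt_id t).mul_const q.2).const_add p.2).smul_const ζ
        exact ha.add hb
      exact (((hf.differentiable (by simp) _).hasFDerivAt).comp_hasDerivAt t hin).mul_const _)
  simpa [scaleAvg] using this.2

/-- Integration by parts in an average at a positive scale. -/
lemma integral_fderiv_scale {k f : E → ℝ} (hk : ContDiff ℝ 1 k) (hkc : HasCompactSupport k)
    (hf : ContDiff ℝ 1 f) (x v : E) {h : ℝ} (hh : h ≠ 0) :
    ∫ ζ, fderiv ℝ f (x + h • ζ) v * k ζ ∂μ =
      - h⁻¹ * ∫ ζ, f (x + h • ζ) * fderiv ℝ k ζ v ∂μ := by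
  have hF : ContDiff ℝ 1 fun ζ : E => f (x + h • ζ) := by fun_prop
  have := integral_fderiv_dir_mul (μ := μ) hF hk hkc v
  have hd : ∀ ζ, fderiv ℝ (fun ζ : E => f (x + h • ζ)) ζ v = h * fderiv ℝ f (x + h • ζ) v := by
    intro ζ
    have hin : HasFDerivAt (fun ζ : E => x + h • ζ) (h • ContinuousLinearMap.id ℝ E) ζ :=
      ((hasFDerivAt_id ζ).const_smul h).const_add x
    have := ((hf.differentiable one_ne_zero (x + h • ζ)).hasFDerivAt).comp ζ hin
    have h3 : fderiv ℝ (fun ζ : E => f (x + h • ζ)) ζ = _ := this.fderiv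
    rw [h3]; simp
  simp only [hd, mul_assoc, integral_const_mul] at this
  rw [neg_mul, eq_neg_iff_add_eq_zero]
  field_simp
  linarith

end Calculus

/-- The weighted Cauchy-Schwarz inequality for an integral. -/
lemma sq_integral_mul_le {α : Type*} [MeasurableSpace α] {μ : Measure α} {g k : α → ℝ}
    (hk : 0 ≤ k) (hki : Integrable k μ) (hgk : Integrable (fun x => g x * k x) μ)
    (hggk : Integrable (fun x => g x ^ 2 * k x) μ) :
    (∫ x, g x * k x ∂μ) ^ 2 ≤ (∫ x, k x ∂μ) * ∫ x, g x ^ 2 * k x ∂μ := by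
  set b := ∫ x, k x ∂μ with hb
  set I := ∫ x, g x * k x ∂μ with hI
  have hb0 : 0 ≤ b := integral_nonneg hk
  rcases hb0.eq_or_lt with h0 | hpos
  · have hk0 : k =ᵐ[μ] 0 := (integral_eq_zero_iff_of_nonneg hk hki).1 h0.symm
    have : I = 0 := by
      rw [hI, integral_eq_zero_of_ae]
      filter_upwards [hk0] with x hx
      simp [hx]
    rw [this, ← h0]
    simp
  -- The variance of `g` under the weight `k`, scaled by `b` to avoid a division.
  · have h1 : 0 ≤ ∫ x, (b * g x - I) ^ 2 * k x ∂μ :=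
      integral_nonneg fun x => mul_nonneg (sq_nonneg _) (hk x)
    have h2 : ∫ x, (b * g x - I) ^ 2 * k x ∂μ =
        b ^ 2 * (∫ x, g x ^ 2 * k x ∂μ) - 2 * b * I * I + I ^ 2 * b := by
      have : ∀ x, (b * g x - I) ^ 2 * k x =
          (b ^ 2 * (g x ^ 2 * k x) - 2 * b * I * (g x * k x)) + I ^ 2 * k x := by
        intro x; ring
      simp_rw [this]
      have i12 : Integrable (fun x => b ^ 2 * (g x ^ 2 * k x) - 2 * b * I * (g x * k x)) μ :=
        (hggk.const_mul _).sub (hgk.const_mul _)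
      rw [integral_add i12 (hki.const_mul _), integral_sub (hggk.const_mul _) (hgk.const_mul _)]
      simp only [integral_const_mul, ← hb, ← hI]
    rw [h2] at h1
    have h3 : 0 ≤ b * (b * (∫ x, g x ^ 2 * k x ∂μ) - I ^ 2) := by nlinarith
    have := (mul_nonneg_iff_of_pos_left hpos).1 h3
    linarith

/-! ### Korn's first inequality on the whole space -/

section Korn

variable {n : ℕ}

lemma contDiff_partialD {f : EuclideanSpace ℝ (Fin n) → ℝ} (hf : ContDiff ℝ ∞ f) (i : Fin n) :
    ContDiff ℝ ∞ (partialD i f) := contDiff_fderiv_dir hf _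

lemma hasCompactSupport_partialD {f : EuclideanSpace ℝ (Fin n) → ℝ} (hf : HasCompactSupport f)
    (i : Fin n) : HasCompactSupport (partialD i f) := hasCompactSupport_fderiv_dir hf _

lemma partialD_comm {f : EuclideanSpace ℝ (Fin n) → ℝ} (hf : ContDiff ℝ ∞ f) (i j : Fin n)
    (x : EuclideanSpace ℝ (Fin n)) :
    partialD i (partialD j f) x = partialD j (partialD i f) x := by
  have hd : DifferentiableAt ℝ (fderiv ℝ f) x :=
    (hf.fderiv_right (m := ∞) le_rfl).differentiable (by simp) x
  have key : ∀ a b : Fin n, partialD a (partialD b f) x =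
      fderiv ℝ (fderiv ℝ f) x (EuclideanSpace.single a 1) (EuclideanSpace.single b 1) := by
    intro a b
    have := (hd.hasFDerivAt.clm_apply
      (hasFDerivAt_const (EuclideanSpace.single b (1 : ℝ)) x)).fderiv
    unfold partialD
    rw [this]
    simp
  rw [key, key]
  have h2 : ContDiff ℝ 2 f := contDiff_infty.1 hf 2
  exact (h2.contDiffAt.isSymmSndFDerivAt (by simp)) _ _

/-- The symmetrised gradient `½ (∂uʲ/∂xⁱ + ∂uⁱ/∂xʲ)`. -/
noncomputable def symGrad (u : Fin n → EuclideanSpace ℝ (Fin n) → ℝ) (i j : Fin n)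
    (x : EuclideanSpace ℝ (Fin n)) : ℝ :=
  (partialD i (u j) x + partialD j (u i) x) / 2

lemma contDiff_symGrad {u : Fin n → EuclideanSpace ℝ (Fin n) → ℝ} (hu : ∀ j, ContDiff ℝ ∞ (u j))
    (i j : Fin n) : ContDiff ℝ ∞ (symGrad u i j) :=
  ((contDiff_partialD (hu j) i).add (contDiff_partialD (hu i) j)).div_const 2

lemma hasCompactSupport_symGrad {u : Fin n → EuclideanSpace ℝ (Fin n) → ℝ}
    (hu : ∀ j, HasCompactSupport (u j)) (i j : Fin n) : HasCompactSupport (symGrad u i j) := by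
  have := (hasCompactSupport_partialD (hu j) i).add (hasCompactSupport_partialD (hu i) j)
  exact this.comp_left (g := fun t : ℝ => t / 2) (by simp)

/-- Korn's first inequality. -/
lemma korn_of_hasCompactSupport {z : Fin n → EuclideanSpace ℝ (Fin n) → ℝ}
    (hz : ∀ j, ContDiff ℝ ∞ (z j)) (hc : ∀ j, HasCompactSupport (z j)) :
    ∫ x, ∑ i, ∑ j, partialD i (z j) x ^ 2 ≤ 2 * ∫ x, ∑ i, ∑ j, symGrad z i j x ^ 2 := by
  have hD : ∀ i j, ContDiff ℝ ∞ (partialD i (z j)) := fun i j => contDiff_partialD (hz j) i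
  have hDc : ∀ i j, HasCompactSupport (partialD i (z j)) :=
    fun i j => hasCompactSupport_partialD (hc j) i
  have hint : ∀ i j k l, Integrable fun x => partialD i (z j) x * partialD k (z l) x :=
    fun i j k l => ((hD i j).continuous.mul (hD k l).continuous).integrable_of_hasCompactSupport
      (hDc k l).mul_left
  -- Two integrations by parts and the symmetry of second derivatives exchange the indices. Summed
  -- over `i` and `j`, the mixed term of `2|e(z)|²` becomes the integral of the squared divergence,
  -- hence is nonnegative.
  have hswap : ∀ i j, ∫ x, partialD i (z j) x * partialD j (z i) x =
      ∫ x, partialD i (z i) x * partialD j (z j) x := by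
    intro i j
    have h1 := integral_fderiv_dir_mul (μ := volume) ((hz j).of_le (by simp))
      ((hD j i).of_le (by simp)) (hDc j i) (EuclideanSpace.single i 1)
    have h2 := integral_fderiv_dir_mul (μ := volume) ((hz j).of_le (by simp))
      ((hD i i).of_le (by simp)) (hDc i i) (EuclideanSpace.single j 1)
    have h3 : ∀ x, fderiv ℝ (partialD j (z i)) x (EuclideanSpace.single i 1) =
        fderiv ℝ (partialD i (z i)) x (EuclideanSpace.single j 1) :=
      fun x => partialD_comm (hz i) i j x
    simp_rw [h3] at h1
    change ∫ x, fderiv ℝ (z j) x _ * partialD j (z i) x = _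
    rw [h1, ← h2]
    exact integral_congr_ae (Filter.Eventually.of_forall fun x => mul_comm _ _)
  have hpt : ∀ x, 2 * ∑ i, ∑ j, symGrad z i j x ^ 2 =
      (∑ i, ∑ j, partialD i (z j) x ^ 2) +
        ∑ i, ∑ j, partialD i (z j) x * partialD j (z i) x := by
    intro x
    have e : ∀ i j, 2 * symGrad z i j x ^ 2 = partialD i (z j) x ^ 2 / 2 +
        partialD j (z i) x ^ 2 / 2 + partialD i (z j) x * partialD j (z i) x := by
      intro i j; unfold symGrad; ring
    simp_rw [Finset.mul_sum, e, Finset.sum_add_distrib]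
    congr 1
    rw [Finset.sum_comm (f := fun i j => partialD j (z i) x ^ 2 / 2), ← Finset.sum_add_distrib]
    refine Finset.sum_congr rfl fun i _ => ?_
    rw [← Finset.sum_add_distrib]
    exact Finset.sum_congr rfl fun j _ => by ring
  have hdiv : 0 ≤ ∫ x, ∑ i, ∑ j, partialD i (z j) x * partialD j (z i) x := by
    have : ∫ x, ∑ i, ∑ j, partialD i (z j) x * partialD j (z i) x =
        ∫ x, (∑ i, partialD i (z i) x) ^ 2 := by
      simp_rw [sq, Finset.sum_mul_sum]
      rw [integral_finsetSum _ fun i _ => integrable_finsetSum _ fun j _ => hint _ _ _ _,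
        integral_finsetSum _ fun i _ => integrable_finsetSum _ fun j _ => hint _ _ _ _]
      refine Finset.sum_congr rfl fun i _ => ?_
      rw [integral_finsetSum _ fun j _ => hint _ _ _ _,
        integral_finsetSum _ fun j _ => hint _ _ _ _]
      exact Finset.sum_congr rfl fun j _ => hswap i j
    rw [this]
    exact integral_nonneg fun x => sq_nonneg _
  rw [← integral_const_mul]
  simp_rw [hpt]
  rw [integral_add]
  · linarith
  · refine integrable_finsetSum _ fun i _ => integrable_finsetSum _ fun j _ => ?_
    simpa [sq] using hint i j i j
  · exact integrable_finsetSum _ fun i _ => integrable_finsetSum _ fun j _ => hint _ _ _ _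

end Korn

/-! ### Hardy's inequality -/

section Hardy

variable {E : Type*} [NormedAddCommGroup E] [NormedSpace ℝ E] [FiniteDimensional ℝ E]
  [MeasurableSpace E] [BorelSpace E] {μ : Measure E} [μ.IsAddHaarMeasure]

/-- Hardy's inequality in the direction in which `ρ` grows at unit speed. -/
lemma hardy_inequality {F ρ : E → ℝ} {χ : ℝ → ℝ} (hF : ContDiff ℝ 1 F) (hFc : HasCompactSupport F)
    (hρ : ContDiff ℝ 1 ρ) (hχ : ContDiff ℝ 1 χ) (hχm : Monotone χ) (hχ0 : ∀ s, s ≤ 0 → χ s = 0)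
    {ν : E} (hν : ∀ x, fderiv ℝ ρ x ν = 1) :
    ∫ x, χ (ρ x) * F x ^ 2 ∂μ ≤ 4 * ∫ x, χ (ρ x) * (ρ x * fderiv ℝ F x ν) ^ 2 ∂μ := by
  have hχnn : ∀ s, 0 ≤ χ s := by
    intro s
    rcases le_total s 0 with h | h
    · rw [hχ0 s h]
    · rw [← hχ0 0 le_rfl]; exact hχm h
  have hdF := continuous_fderiv_dir hF ν
  have hdχ : Continuous (deriv χ) := hχ.continuous_deriv le_rfl
  have cF := hF.continuous
  have cρ := hρ.continuous
  have cχ := hχ.continuous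
  -- The derivative of this product along `ν` integrates to zero. Its term with `χ'` is nonnegative
  -- and is dropped; the cross term is split by Young's inequality so that half of the left-hand
  -- side is absorbed.
  have hG : ContDiff ℝ 1 fun x => χ (ρ x) * ρ x * F x ^ 2 := by
    have := hχ.comp hρ
    exact (this.mul hρ).mul (hF.pow 2)
  have hF2c : HasCompactSupport fun x => F x ^ 2 :=
    hFc.comp_left (g := fun t : ℝ => t ^ 2) (by simp)
  have h0 := integral_fderiv_dir (μ := μ) hG hF2c.mul_left ν
  have hder : ∀ x, fderiv ℝ (fun x => χ (ρ x) * ρ x * F x ^ 2) x ν =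
      deriv χ (ρ x) * ρ x * F x ^ 2 + χ (ρ x) * F x ^ 2 +
        2 * (χ (ρ x) * (ρ x * fderiv ℝ F x ν) * F x) := by
    intro x
    have h1 := (hF.differentiable one_ne_zero x).hasFDerivAt
    have h2 := (hρ.differentiable one_ne_zero x).hasFDerivAt
    have h3 := (hχ.differentiable one_ne_zero (ρ x)).hasDerivAt.comp_hasFDerivAt x h2
    have h4 : HasFDerivAt (fun x => χ (ρ x) * ρ x * F x ^ 2) _ x := (h3.mul h2).mul (h1.pow 2)
    rw [h4.fderiv]
    simp [hν]
    ring
  simp_rw [hder] at h0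
  have i1 : Integrable (fun x => deriv χ (ρ x) * ρ x * F x ^ 2) μ :=
    Continuous.integrable_of_hasCompactSupport (by fun_prop) hF2c.mul_left
  have i2 : Integrable (fun x => χ (ρ x) * F x ^ 2) μ :=
    Continuous.integrable_of_hasCompactSupport (by fun_prop) hF2c.mul_left
  have i3 : Integrable (fun x => χ (ρ x) * (ρ x * fderiv ℝ F x ν) * F x) μ :=
    Continuous.integrable_of_hasCompactSupport (by fun_prop) hFc.mul_left
  have i4 : Integrable (fun x => χ (ρ x) * (ρ x * fderiv ℝ F x ν) ^ 2) μ := by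
    refine Continuous.integrable_of_hasCompactSupport (by fun_prop) ?_
    have := (hasCompactSupport_fderiv_dir hFc ν).mul_left (f := ρ)
    exact (this.comp_left (g := fun t : ℝ => t ^ 2) (by simp)).mul_left
  have i12 : Integrable (fun x => deriv χ (ρ x) * ρ x * F x ^ 2 + χ (ρ x) * F x ^ 2) μ := i1.add i2
  rw [integral_add i12 (i3.const_mul 2), integral_add i1 i2, integral_const_mul] at h0
  have hpos : 0 ≤ ∫ x, deriv χ (ρ x) * ρ x * F x ^ 2 ∂μ := by
    refine integral_nonneg fun x => mul_nonneg ?_ (sq_nonneg _)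
    rcases lt_or_ge (ρ x) 0 with h | h
    · have : deriv χ (ρ x) = 0 := by
        have : χ =ᶠ[nhds (ρ x)] fun _ => 0 := by
          filter_upwards [Iio_mem_nhds h] with s hs using hχ0 s (le_of_lt hs)
        rw [this.deriv_eq]; simp
      rw [this]; simp
    · exact mul_nonneg hχm.deriv_nonneg h
  have hpt : ∫ x, -(2 * (χ (ρ x) * (ρ x * fderiv ℝ F x ν) * F x)) ∂μ ≤
      ∫ x, (1 / 2 * (χ (ρ x) * F x ^ 2) + 2 * (χ (ρ x) * (ρ x * fderiv ℝ F x ν) ^ 2)) ∂μ := by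
    refine integral_mono (i3.const_mul 2).neg ((i2.const_mul _).add (i4.const_mul _)) fun x => ?_
    have := mul_nonneg (hχnn (ρ x)) (sq_nonneg (F x + 2 * (ρ x * fderiv ℝ F x ν)))
    simp only
    nlinarith
  rw [integral_neg, integral_const_mul, integral_add (i2.const_mul _) (i4.const_mul _),
    integral_const_mul, integral_const_mul] at hpt
  linarith

end Hardy

/-! ### Square integral bounds for averages of variable radius -/

section Averages

variable {E : Type*} [NormedAddCommGroup E] [NormedSpace ℝ E] [FiniteDimensional ℝ E]
  [MeasurableSpace E] [BorelSpace E] {μ : Measure E} [μ.IsAddHaarMeasure]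

lemma abs_sub_le_of_norm_fderiv_le {h : E → ℝ} {K : ℝ} (hh : ContDiff ℝ 1 h)
    (hK : ∀ x, ‖fderiv ℝ h x‖ ≤ K) (x y : E) : |h x - h y| ≤ K * ‖x - y‖ := by
  simpa using Convex.norm_image_sub_le_of_norm_fderiv_le (𝕜 := ℝ) (f := h) (s := Set.univ)
    (fun x _ => hh.differentiable one_ne_zero x) (fun x _ => hK x) convex_univ
    (Set.mem_univ y) (Set.mem_univ x)

/-- The maps `x ↦ x + h(x) ζ` with slowly varying `h` distort integrals by a factor of at
most two. -/
lemma lintegral_comp_add_smul_le {h : E → ℝ} (hh : ContDiff ℝ 1 h)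
    (hK : ∀ x, ‖fderiv ℝ h x‖ ≤ 1 / 2) {S : Set E} (hS : MeasurableSet S) {ζ : E} (hζ : ‖ζ‖ ≤ 1)
    (hmaps : ∀ x ∈ S, x + h x • ζ ∈ S) (f : E → ENNReal) :
    ∫⁻ x in S, f (x + h x • ζ) ∂μ ≤ 2 * ∫⁻ x in S, f x ∂μ := by
  have hder : ∀ x ∈ S, HasFDerivWithinAt (fun x => x + h x • ζ)
      (ContinuousLinearMap.id ℝ E + (fderiv ℝ h x).smulRight ζ) S x := fun x _ =>
    ((hasFDerivAt_id x).add
      ((hh.differentiable one_ne_zero x).hasFDerivAt.smul_const ζ)).hasFDerivWithinAt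
  have hinj : Set.InjOn (fun x => x + h x • ζ) S := by
    intro x _ y _ hxy
    have h1 : x - y = (h y - h x) • ζ := by
      have : x + h x • ζ = y + h y • ζ := hxy
      rw [sub_smul, sub_eq_sub_iff_add_eq_add, this, add_comm]
    have h2 : ‖x - y‖ ≤ 1 / 2 * ‖x - y‖ := by
      calc ‖x - y‖ = |h y - h x| * ‖ζ‖ := by rw [h1, norm_smul, Real.norm_eq_abs]
        _ ≤ |h y - h x| := mul_le_of_le_one_right (abs_nonneg _) hζ
        _ ≤ 1 / 2 * ‖x - y‖ := by
          rw [norm_sub_rev]; exact abs_sub_le_of_norm_fderiv_le hh hK y x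
    have h3 : ‖x - y‖ = 0 := by linarith [norm_nonneg (x - y)]
    exact sub_eq_zero.1 (norm_eq_zero.1 h3)
  have hcv := lintegral_image_eq_lintegral_abs_det_fderiv_mul μ hS hder hinj f
  -- The derivative is a rank one perturbation of the identity, with determinant `1 + ∂_ζh`, and
  -- `|∂_ζh| ≤ 1/2`.
  have hdet : ∀ x, (1 / 2 : ℝ) ≤
      |(ContinuousLinearMap.id ℝ E + (fderiv ℝ h x).smulRight ζ).det| := by
    intro x
    have e : (ContinuousLinearMap.id ℝ E + (fderiv ℝ h x).smulRight ζ).det =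
        1 + fderiv ℝ h x ζ := by
      have := LinearMap.transvection.det (fderiv ℝ h x : E →ₗ[ℝ] ℝ) ζ
      rw [ContinuousLinearMap.coe_coe] at this
      rw [← this]
      rfl
    have hle : |fderiv ℝ h x ζ| ≤ 1 / 2 := by
      calc |fderiv ℝ h x ζ| ≤ ‖fderiv ℝ h x‖ * ‖ζ‖ := (fderiv ℝ h x).le_opNorm ζ
        _ ≤ 1 / 2 * 1 := mul_le_mul (hK x) hζ (norm_nonneg _) (by norm_num)
        _ = 1 / 2 := by ring
    rw [e]
    have := (abs_le.1 hle).1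
    exact le_trans (by linarith) (le_abs_self _)
  have hsub : (fun x => x + h x • ζ) '' S ⊆ S := by
    rintro _ ⟨x, hx, rfl⟩; exact hmaps x hx
  calc ∫⁻ x in S, f (x + h x • ζ) ∂μ
      ≤ ∫⁻ x in S, 2 * (ENNReal.ofReal
          |(ContinuousLinearMap.id ℝ E + (fderiv ℝ h x).smulRight ζ).det|
            * f (x + h x • ζ)) ∂μ := by
        refine lintegral_mono fun x => ?_
        rw [← mul_assoc]
        refine le_mul_of_one_le_left zero_le ?_
        calc (1 : ENNReal) = 2 * ENNReal.ofReal (1 / 2) := by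
              rw [← ENNReal.ofReal_ofNat, ← ENNReal.ofReal_mul (by norm_num)]; norm_num
          _ ≤ _ := by gcongr; exact hdet x
    _ = 2 * ∫⁻ x in (fun x => x + h x • ζ) '' S, f x ∂μ := by
        rw [hcv, lintegral_const_mul' _ _ (by norm_num)]
    _ ≤ 2 * ∫⁻ x in S, f x ∂μ := by
        gcongr

/-- Averages over balls of slowly varying radius are bounded in `L²`. -/
lemma lintegral_sq_ball_average_le {h N : E → ℝ} (hh : ContDiff ℝ 1 h)
    (hK : ∀ x, ‖fderiv ℝ h x‖ ≤ 1 / 2) {S : Set E} (hS : MeasurableSet S)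
    (hmaps : ∀ x ∈ S, ∀ ζ : E, ‖ζ‖ ≤ 1 → x + h x • ζ ∈ S) (hN : Continuous N) :
    ∫⁻ x in S, ENNReal.ofReal ((∫ ζ in Metric.closedBall 0 1, N (x + h x • ζ) ∂μ) ^ 2) ∂μ ≤
      2 * μ (Metric.closedBall (0 : E) 1) ^ 2 * ∫⁻ x in S, ENNReal.ofReal (N x ^ 2) ∂μ := by
  set B := Metric.closedBall (0 : E) 1 with hB
  have hBc : IsCompact B := isCompact_closedBall 0 1
  have hBfin : μ B ≠ ⊤ := hBc.measure_lt_top.ne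
  have ch := hh.continuous
  -- Cauchy-Schwarz on the ball. After Tonelli the change of variables is applied for each fixed
  -- `ζ`, which gives the factor two.
  have hstep : ∀ x, ENNReal.ofReal ((∫ ζ in B, N (x + h x • ζ) ∂μ) ^ 2) ≤
      μ B * ∫⁻ ζ in B, ENNReal.ofReal (N (x + h x • ζ) ^ 2) ∂μ := by
    intro x
    have c1 : Continuous fun ζ : E => N (x + h x • ζ) := by fun_prop
    have i1 : IntegrableOn (fun ζ : E => N (x + h x • ζ)) B μ :=
      c1.continuousOn.integrableOn_compact hBc
    have i2 : IntegrableOn (fun ζ : E => N (x + h x • ζ) ^ 2) B μ :=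
      (c1.pow 2).continuousOn.integrableOn_compact hBc
    have := sq_integral_mul_le (μ := μ.restrict B) (g := fun ζ : E => N (x + h x • ζ))
      (k := fun _ => 1) (fun _ => zero_le_one) (integrableOn_const hBfin)
      (by simpa using i1.integrable) (by simpa using i2.integrable)
    simp only [mul_one] at this
    refine (ENNReal.ofReal_le_ofReal this).trans ?_
    rw [ENNReal.ofReal_mul (integral_nonneg fun _ => zero_le_one)]
    rw [← ofReal_integral_eq_lintegral_ofReal i2 (Filter.Eventually.of_forall fun _ => sq_nonneg _)]
    gcongr
    simp [Measure.real, ENNReal.ofReal_toReal hBfin]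
  calc _ ≤ ∫⁻ x in S, μ B * ∫⁻ ζ in B, ENNReal.ofReal (N (x + h x • ζ) ^ 2) ∂μ ∂μ :=
        lintegral_mono fun x => hstep x
    _ = μ B * ∫⁻ x in S, ∫⁻ ζ in B, ENNReal.ofReal (N (x + h x • ζ) ^ 2) ∂μ ∂μ :=
        lintegral_const_mul' _ _ hBfin
    _ = μ B * ∫⁻ ζ in B, ∫⁻ x in S, ENNReal.ofReal (N (x + h x • ζ) ^ 2) ∂μ ∂μ := by
        rw [lintegral_lintegral_swap]
        refine Measurable.aemeasurable (Continuous.measurable ?_)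
        have : Continuous fun p : E × E => N (p.1 + h p.1 • p.2) ^ 2 := by fun_prop
        exact ENNReal.continuous_ofReal.comp this
    _ ≤ μ B * ∫⁻ ζ in B, 2 * ∫⁻ x in S, ENNReal.ofReal (N x ^ 2) ∂μ ∂μ := by
        refine mul_le_mul_right ?_ _
        refine setLIntegral_mono' measurableSet_closedBall fun ζ hζ => ?_
        have hζ1 : ‖ζ‖ ≤ 1 := by simpa [hB] using hζ
        exact lintegral_comp_add_smul_le hh hK hS hζ1 (fun x hx => hmaps x hx ζ hζ1)
          fun x => ENNReal.ofReal (N x ^ 2)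
    _ = _ := by
        rw [setLIntegral_const]; ring

end Averages

/-! ### A radial kernel with a potential -/

section Kernel

lemma deriv_smoothTransition_nonneg (s : ℝ) : 0 ≤ deriv Real.smoothTransition s :=
  Real.smoothTransition.monotone.deriv_nonneg

lemma deriv_smoothTransition_of_nonpos {s : ℝ} (hs : s ≤ 0) :
    deriv Real.smoothTransition s = 0 := by
  apply IsLocalMin.deriv_eq_zero
  refine Filter.Eventually.of_forall fun t => ?_
  rw [Real.smoothTransition.zero_of_nonpos hs]
  exact Real.smoothTransition.nonneg t

lemma contDiff_deriv_smoothTransition : ContDiff ℝ ∞ (deriv Real.smoothTransition) := by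
  have : ContDiff ℝ (∞ + 1) Real.smoothTransition := Real.smoothTransition.contDiff (n := ⊤)
  exact (contDiff_succ_iff_deriv.1 this).2.2

/-- A normalised smooth kernel on the unit ball whose first moments are a gradient. -/
lemma exists_radial_kernel (n : ℕ) [NeZero n] : ∃ φ ψ : EuclideanSpace ℝ (Fin n) → ℝ,
    ContDiff ℝ ∞ φ ∧ ContDiff ℝ ∞ ψ ∧ (∀ ζ, 1 ≤ ‖ζ‖ → φ ζ = 0) ∧ (∀ ζ, 1 ≤ ‖ζ‖ → ψ ζ = 0) ∧
    ∫ ζ, φ ζ = 1 ∧ ∀ i ζ, partialD i ψ ζ = ζ i * φ ζ := by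
  set T := Real.smoothTransition with hT
  have hTs : ContDiff ℝ ∞ T := Real.smoothTransition.contDiff (n := ⊤)
  have hnsq : ContDiff ℝ ∞ fun ζ : EuclideanSpace ℝ (Fin n) => 1 - ‖ζ‖ ^ 2 :=
    contDiff_const.sub (contDiff_norm_sq ℝ)
  -- The potential `ψ₀` below has gradient `2T'(1 - |ζ|²)ζ = φ₀(ζ)ζ`, and both vanish outside the
  -- unit ball because `T` is zero on `(-∞, 0]`.
  set φ₀ : EuclideanSpace ℝ (Fin n) → ℝ := fun ζ => 2 * deriv T (1 - ‖ζ‖ ^ 2) with hφ₀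
  set ψ₀ : EuclideanSpace ℝ (Fin n) → ℝ := fun ζ => - T (1 - ‖ζ‖ ^ 2) with hψ₀
  have hφs : ContDiff ℝ ∞ φ₀ := contDiff_const.mul (contDiff_deriv_smoothTransition.comp hnsq)
  have hψs : ContDiff ℝ ∞ ψ₀ := (hTs.comp hnsq).neg
  have hle : ∀ ζ : EuclideanSpace ℝ (Fin n), 1 ≤ ‖ζ‖ → 1 - ‖ζ‖ ^ 2 ≤ 0 := fun ζ hζ => by nlinarith
  have hφz : ∀ ζ, 1 ≤ ‖ζ‖ → φ₀ ζ = 0 := fun ζ hζ => by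
    simp [hφ₀, hT, deriv_smoothTransition_of_nonpos (hle ζ hζ)]
  have hψz : ∀ ζ, 1 ≤ ‖ζ‖ → ψ₀ ζ = 0 := fun ζ hζ => by
    simp [hψ₀, hT, Real.smoothTransition.zero_of_nonpos (hle ζ hζ)]
  have hgrad : ∀ i ζ, partialD i ψ₀ ζ = ζ i * φ₀ ζ := by
    intro i ζ
    have h1 := ((hasFDerivAt_id ζ).norm_sq).const_sub 1
    have h2 := ((hTs.differentiable (by simp) (1 - ‖ζ‖ ^ 2)).hasDerivAt.comp_hasFDerivAt ζ h1).neg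
    have h3 : fderiv ℝ ψ₀ ζ = _ := h2.fderiv
    rw [partialD, h3]
    simp [hφ₀, EuclideanSpace.inner_single_right]
    ring
  have hφc : HasCompactSupport φ₀ := by
    refine HasCompactSupport.of_support_subset_isCompact (isCompact_closedBall 0 1) fun ζ hζ => ?_
    by_contra h
    exact hζ (hφz ζ (by simpa using (not_le.1 fun h' => h (by simpa using h')).le))
  have hpos : 0 < ∫ ζ, φ₀ ζ := by
    -- The mean value theorem supplies a point with `T' = 1`, so `φ₀` is not identically zero and
    -- can be normalised.
    obtain ⟨s, ⟨hs0, hs1⟩, hs⟩ := exists_deriv_eq_slope T (a := 0) (b := 1) zero_lt_one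
      hTs.continuous.continuousOn (hTs.differentiable (by simp)).differentiableOn
    have hs' : deriv T s = 1 := by
      rw [hs, hT, Real.smoothTransition.one, Real.smoothTransition.zero]; norm_num
    refine hφs.continuous.integral_pos_of_hasCompactSupport_nonneg_nonzero hφc
      (fun ζ => mul_nonneg zero_le_two (deriv_smoothTransition_nonneg _))
      (x := EuclideanSpace.single 0 √(1 - s)) ?_
    have : ‖EuclideanSpace.single (0 : Fin n) √(1 - s)‖ ^ 2 = 1 - s := by
      rw [PiLp.norm_single, Real.norm_eq_abs, sq_abs, Real.sq_sqrt (by linarith)]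
    simp only [hφ₀, this, sub_sub_cancel, hs']
    norm_num
  refine ⟨fun ζ => (∫ ζ, φ₀ ζ)⁻¹ * φ₀ ζ, fun ζ => (∫ ζ, φ₀ ζ)⁻¹ * ψ₀ ζ, contDiff_const.mul hφs,
    contDiff_const.mul hψs, fun ζ hζ => mul_eq_zero_of_right _ (hφz ζ hζ),
    fun ζ hζ => mul_eq_zero_of_right _ (hψz ζ hζ), ?_, fun i ζ => ?_⟩
  · rw [integral_const_mul, inv_mul_cancel₀ hpos.ne']
  · have h1 := ((hψs.differentiable (by simp) ζ).hasFDerivAt.const_mul (∫ ζ, φ₀ ζ)⁻¹).fderiv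
    rw [partialD, h1]
    have := hgrad i ζ
    rw [partialD] at this
    simp only [_root_.smul_apply, this, smul_eq_mul]
    ring

variable {E : Type*} [NormedAddCommGroup E] [NormedSpace ℝ E] [FiniteDimensional ℝ E]

lemma hasCompactSupport_of_ball {k : E → ℝ} (hk : ∀ ζ, 1 ≤ ‖ζ‖ → k ζ = 0) :
    HasCompactSupport k := by
  refine HasCompactSupport.of_support_subset_isCompact (isCompact_closedBall 0 1) fun ζ hζ => ?_
  by_contra h
  exact hζ (hk ζ (by simpa using (not_le.1 fun h' => h (by simpa using h')).le))

lemma fderiv_eq_zero_of_ball {k : E → ℝ} (hk : ∀ ζ, 1 ≤ ‖ζ‖ → k ζ = 0) (v ζ : E)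
    (hζ : 1 < ‖ζ‖) : fderiv ℝ k ζ v = 0 := by
  have : k =ᶠ[nhds ζ] fun _ => 0 := by
    filter_upwards [(isOpen_lt continuous_const continuous_norm).mem_nhds hζ] with y hy
    exact hk y hy.le
  rw [this.fderiv_eq]; simp

variable [MeasurableSpace E] [BorelSpace E] {μ : Measure E} [μ.IsAddHaarMeasure]

lemma abs_integral_mul_kernel_le {f k N : E → ℝ} {C : ℝ}
    (hkz : ∀ ζ, 1 < ‖ζ‖ → k ζ = 0) (hC : ∀ ζ, |k ζ| ≤ C) (hN : Continuous N)
    (hfN : ∀ ζ, |f ζ| ≤ N ζ) :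
    |∫ ζ, f ζ * k ζ ∂μ| ≤ C * ∫ ζ in Metric.closedBall 0 1, N ζ ∂μ := by
  have hNi : IntegrableOn N (Metric.closedBall 0 1) μ :=
    hN.continuousOn.integrableOn_compact (isCompact_closedBall 0 1)
  rw [← integral_const_mul, ← integral_indicator measurableSet_closedBall, ← Real.norm_eq_abs]
  refine norm_integral_le_of_norm_le
    ((integrable_indicator_iff measurableSet_closedBall).2 (hNi.const_mul C))
    (Filter.Eventually.of_forall fun ζ => ?_)
  by_cases hζ : ζ ∈ Metric.closedBall (0 : E) 1
  · rw [Set.indicator_of_mem hζ, Real.norm_eq_abs, abs_mul, mul_comm]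
    exact mul_le_mul (hC ζ) (hfN ζ) (abs_nonneg _) ((abs_nonneg _).trans (hC ζ))
  · rw [Set.indicator_of_notMem hζ, hkz ζ (by simpa using hζ)]
    simp

end Kernel

/-! ### Averages at a variable scale -/

section VariableAverage

variable {n : ℕ}

/-- The average of `f` at the variable scale `h`. -/
noncomputable def varAvg (k h f : EuclideanSpace ℝ (Fin n) → ℝ) (x : EuclideanSpace ℝ (Fin n)) :
    ℝ := scaleAvg volume k f (x, h x)

variable {k h f : EuclideanSpace ℝ (Fin n) → ℝ}

lemma contDiff_varAvg (hk : ContDiff ℝ ∞ k) (hkc : HasCompactSupport k) (hh : ContDiff ℝ ∞ h)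
    (hf : ContDiff ℝ ∞ f) : ContDiff ℝ ∞ (varAvg k h f) :=
  (contDiff_scaleAvg hk hkc hf).comp (contDiff_id.prodMk hh)

lemma fderiv_varAvg (hk : ContDiff ℝ ∞ k) (hkc : HasCompactSupport k) (hh : ContDiff ℝ ∞ h)
    (hf : ContDiff ℝ ∞ f) (x v : EuclideanSpace ℝ (Fin n)) :
    fderiv ℝ (varAvg k h f) x v =
      ∫ ζ, fderiv ℝ f (x + h x • ζ) (v + fderiv ℝ h x v • ζ) * k ζ := by
  have h1 := ((contDiff_scaleAvg (μ := volume) hk hkc hf).differentiable (by simp)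
    (x, h x)).hasFDerivAt
  have h2 : HasFDerivAt (fun x => (x, h x)) ((ContinuousLinearMap.id ℝ _).prod (fderiv ℝ h x)) x :=
    (hasFDerivAt_id x).prodMk (hh.differentiable (by simp) x).hasFDerivAt
  have h3 : fderiv ℝ (varAvg k h f) x = _ := (h1.comp x h2).fderiv
  rw [h3]
  simp only [ContinuousLinearMap.comp_apply, ContinuousLinearMap.prod_apply,
    ContinuousLinearMap.id_apply]
  rw [fderiv_scaleAvg hk hkc hf]

lemma hasCompactSupport_varAvg (hkz : ∀ ζ, 1 ≤ ‖ζ‖ → k ζ = 0) (hh : ContDiff ℝ 1 h)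
    (hK : ∀ x, ‖fderiv ℝ h x‖ ≤ 1 / 2) (hfc : HasCompactSupport f) :
    HasCompactSupport (varAvg k h f) := by
  obtain ⟨R, hR⟩ := hfc.isCompact.isBounded.subset_closedBall 0
  refine HasCompactSupport.of_support_subset_isCompact
    (isCompact_closedBall 0 (2 * (R + |h 0|))) fun x hx => ?_
  by_contra hcon
  refine hx ?_
  have hxn : 2 * (R + |h 0|) < ‖x‖ := by simpa using hcon
  refine integral_eq_zero_of_ae (Filter.Eventually.of_forall fun ζ => ?_)
  rcases le_or_gt 1 ‖ζ‖ with hζ | hζ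
  · simp [hkz ζ hζ]
  · have hh1 := abs_sub_le_of_norm_fderiv_le hh hK x 0
    rw [sub_zero] at hh1
    -- The radius grows at most half as fast as `|x|`, so balls about distant centres miss the
    -- support of `f`.
    have hh2 : |h x| ≤ 1 / 2 * ‖x‖ + |h 0| := by
      have := abs_add_le (h x - h 0) (h 0)
      rw [sub_add_cancel] at this
      linarith
    have h3 : ‖h x • ζ‖ ≤ |h x| := by
      rw [norm_smul, Real.norm_eq_abs]
      exact mul_le_of_le_one_right (abs_nonneg _) hζ.le
    have h4 : ‖x‖ ≤ ‖x + h x • ζ‖ + ‖h x • ζ‖ := by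
      simpa using norm_sub_le (x + h x • ζ) (h x • ζ)
    have h5 : x + h x • ζ ∉ tsupport f := fun hmem => by
      have := hR hmem
      rw [mem_closedBall_zero_iff] at this
      linarith
    simp [image_eq_zero_of_notMem_tsupport h5]

lemma fderiv_eq_sum_partialD (f : EuclideanSpace ℝ (Fin n) → ℝ) (x v : EuclideanSpace ℝ (Fin n)) :
    fderiv ℝ f x v = ∑ l, v l * partialD l f x := by
  have hv : v = ∑ l, v l • EuclideanSpace.single l (1 : ℝ) := by
    ext i
    simp [Finset.sum_apply, Pi.single_apply]
  conv_lhs => rw [hv]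
  simp [partialD, map_sum]

end VariableAverage

/-! ### Averages expressed through the symmetrised gradient -/

section Identities

variable {n : ℕ} {u : Fin n → EuclideanSpace ℝ (Fin n) → ℝ} {φ ψ k : EuclideanSpace ℝ (Fin n) → ℝ}

lemma integrable_comp_mul {f k : EuclideanSpace ℝ (Fin n) → ℝ} (hf : Continuous f)
    (hk : Continuous k) (hkc : HasCompactSupport k) (x : EuclideanSpace ℝ (Fin n)) (h : ℝ) :
    Integrable fun ζ => f (x + h • ζ) * k ζ :=
  Continuous.integrable_of_hasCompactSupport (by fun_prop) hkc.mul_left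

/-- The scale derivative of a radial average depends on the symmetrised gradient only. -/
lemma integral_radial_deriv (hu : ∀ j, ContDiff ℝ ∞ (u j)) (hψ : ContDiff ℝ ∞ ψ)
    (hψc : HasCompactSupport ψ) (hφψ : ∀ i ζ, partialD i ψ ζ = ζ i * φ ζ) (i : Fin n)
    (x : EuclideanSpace ℝ (Fin n)) {h : ℝ} (hh : h ≠ 0) :
    ∫ ζ, fderiv ℝ (u i) (x + h • ζ) ζ * φ ζ =
      ∑ l, (2 * (∫ ζ, symGrad u i l (x + h • ζ) * partialD l ψ ζ) -
        ∫ ζ, symGrad u l l (x + h • ζ) * partialD i ψ ζ) := by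
  have hψd : ∀ l, ContDiff ℝ ∞ (partialD l ψ) := fun l => contDiff_partialD hψ l
  have hψdc : ∀ l, HasCompactSupport (partialD l ψ) := fun l => hasCompactSupport_partialD hψc l
  have h1 : ∀ ζ, fderiv ℝ (u i) (x + h • ζ) ζ * φ ζ =
      ∑ l, partialD l (u i) (x + h • ζ) * partialD l ψ ζ := by
    intro ζ
    rw [fderiv_eq_sum_partialD, Finset.sum_mul]
    exact Finset.sum_congr rfl fun l _ => by rw [hφψ]; ring
  have hint : ∀ a b c, Integrable fun ζ => partialD a (u b) (x + h • ζ) * partialD c ψ ζ :=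
    fun a b c => integrable_comp_mul (contDiff_partialD (hu b) a).continuous
      (hψd c).continuous (hψdc c) x h
  have hints : ∀ a b c, Integrable fun ζ => symGrad u a b (x + h • ζ) * partialD c ψ ζ :=
    fun a b c => integrable_comp_mul (contDiff_symGrad hu a b).continuous
      (hψd c).continuous (hψdc c) x h
  simp_rw [h1]
  rw [integral_finsetSum _ fun l _ => hint _ _ _]
  refine Finset.sum_congr rfl fun l _ => ?_
  -- Moving both derivatives onto `ψ` and back shows `∫ ∂_iu_l ∂_lψ = ∫ ∂_lu_l ∂_iψ`, since `ψ` has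
  -- a symmetric Hessian. The antisymmetric part of the gradient is thereby replaced by diagonal
  -- entries of `e(u)`.
  have e1 := integral_fderiv_scale (μ := volume) ((hψd l).of_le (by simp)) (hψdc l)
    ((hu l).of_le (by simp)) x (EuclideanSpace.single i 1) hh
  have e2 := integral_fderiv_scale (μ := volume) ((hψd i).of_le (by simp)) (hψdc i)
    ((hu l).of_le (by simp)) x (EuclideanSpace.single l 1) hh
  have e3 : ∀ ζ, fderiv ℝ (partialD l ψ) ζ (EuclideanSpace.single i 1) =
      fderiv ℝ (partialD i ψ) ζ (EuclideanSpace.single l 1) := fun ζ => partialD_comm hψ i l ζ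
  simp_rw [e3] at e1
  rw [← e2] at e1
  have e4 : ∀ ζ, partialD l (u i) (x + h • ζ) * partialD l ψ ζ =
      2 * (symGrad u i l (x + h • ζ) * partialD l ψ ζ) -
        partialD i (u l) (x + h • ζ) * partialD l ψ ζ := by
    intro ζ; unfold symGrad; ring
  simp_rw [e4]
  rw [integral_sub ((hints _ _ _).const_mul 2) (hint _ _ _), integral_const_mul]
  congr 1
  rw [show (fun ζ => partialD i (u l) (x + h • ζ) * partialD l ψ ζ) = fun ζ =>
    fderiv ℝ (u l) (x + h • ζ) (EuclideanSpace.single i 1) * partialD l ψ ζ from rfl, e1]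
  congr 1
  ext ζ
  simp only [symGrad, partialD]
  ring

/-- Averages of second derivatives in terms of the symmetrised gradient. -/
lemma integral_second_deriv (hu : ∀ j, ContDiff ℝ ∞ (u j)) (hk : ContDiff ℝ ∞ k)
    (hkc : HasCompactSupport k) (a b c : Fin n) (x : EuclideanSpace ℝ (Fin n)) {h : ℝ}
    (hh : h ≠ 0) :
    ∫ ζ, partialD a (partialD b (u c)) (x + h • ζ) * k ζ =
      - h⁻¹ * ((∫ ζ, symGrad u b c (x + h • ζ) * partialD a k ζ) +
        (∫ ζ, symGrad u a c (x + h • ζ) * partialD b k ζ) -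
        ∫ ζ, symGrad u a b (x + h • ζ) * partialD c k ζ) := by
  have hs : ∀ i j, ContDiff ℝ ∞ (symGrad u i j) := contDiff_symGrad hu
  -- The classical identity `∂_a∂_bu_c = ∂_ae_{bc} + ∂_be_{ac} - ∂_ce_{ab}`; the outer derivative is
  -- then moved to the kernel at the cost of `h⁻¹`.
  have hpt : ∀ y, partialD a (partialD b (u c)) y = partialD a (symGrad u b c) y +
      partialD b (symGrad u a c) y - partialD c (symGrad u a b) y := by
    intro y
    have hd : ∀ i j l, partialD l (symGrad u i j) y =
        (partialD l (partialD i (u j)) y + partialD l (partialD j (u i)) y) / 2 := by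
      intro i j l
      have h1 := ((contDiff_partialD (hu j) i).differentiable (by simp) y).hasFDerivAt
      have h2 := ((contDiff_partialD (hu i) j).differentiable (by simp) y).hasFDerivAt
      have h3 : HasFDerivAt (fun x => (partialD i (u j) x + partialD j (u i) x) * (2⁻¹ : ℝ)) _ y :=
        (h1.add h2).mul_const 2⁻¹
      have h4 : fderiv ℝ (symGrad u i j) y = _ := h3.fderiv
      unfold partialD at *
      rw [h4]
      simp
      ring
    rw [hd, hd, hd, partialD_comm (hu c) b a, partialD_comm (hu b) c a, partialD_comm (hu a) c b]
    ring
  have hint : ∀ i j l, Integrable fun ζ => partialD l (symGrad u i j) (x + h • ζ) * k ζ :=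
    fun i j l => integrable_comp_mul (contDiff_partialD (hs i j) l).continuous
      hk.continuous hkc x h
  have e : ∀ i j l, ∫ ζ, partialD l (symGrad u i j) (x + h • ζ) * k ζ =
      - h⁻¹ * ∫ ζ, symGrad u i j (x + h • ζ) * partialD l k ζ := fun i j l =>
    integral_fderiv_scale (hk.of_le (by simp)) hkc ((hs i j).of_le (by simp)) x _ hh
  simp_rw [hpt, sub_mul, add_mul]
  have i12 : Integrable fun ζ => partialD a (symGrad u b c) (x + h • ζ) * k ζ +
      partialD b (symGrad u a c) (x + h • ζ) * k ζ := (hint _ _ _).add (hint _ _ _)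
  rw [integral_sub i12 (hint _ _ _), integral_add (hint _ _ _) (hint _ _ _), e, e, e]
  ring

end Identities

/-! ### Pointwise estimates for the variable average -/

section Core

variable {n : ℕ}

/-- A radial smoothing kernel `φ` on the unit ball with potential `ψ`, and a bound for the two
and their derivatives. -/
structure IsRadialKernel (φ ψ : EuclideanSpace ℝ (Fin n) → ℝ) (C : ℝ) : Prop where
  smooth : ContDiff ℝ ∞ φ
  smooth_pot : ContDiff ℝ ∞ ψ
  zero : ∀ ζ, 1 ≤ ‖ζ‖ → φ ζ = 0
  zero_pot : ∀ ζ, 1 ≤ ‖ζ‖ → ψ ζ = 0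
  integral_eq_one : ∫ ζ, φ ζ = 1
  grad : ∀ i ζ, partialD i ψ ζ = ζ i * φ ζ
  bound : ∀ ζ, |φ ζ| ≤ C
  bound_deriv : ∀ i ζ, |partialD i φ ζ| ≤ C
  bound_grad : ∀ i ζ, |partialD i ψ ζ| ≤ C
  bound_hess : ∀ i j ζ, |partialD i (partialD j ψ) ζ| ≤ C

lemma exists_abs_le_of_hasCompactSupport {ι X : Type*} [Finite ι] [TopologicalSpace X]
    {f : ι → X → ℝ} (hf : ∀ i, Continuous (f i)) (hc : ∀ i, HasCompactSupport (f i)) :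
    ∃ C, 0 ≤ C ∧ ∀ i x, |f i x| ≤ C := by
  have := Fintype.ofFinite ι
  choose C hC using fun i => (hf i).bounded_above_of_compact_support (hc i)
  refine ⟨∑ i, |C i|, Finset.sum_nonneg fun _ _ => abs_nonneg _, fun i x => ?_⟩
  exact ((hC i x).trans (le_abs_self _)).trans
    (Finset.single_le_sum (f := fun i => |C i|) (fun _ _ => abs_nonneg _) (Finset.mem_univ i))

lemma exists_isRadialKernel (n : ℕ) [NeZero n] :
    ∃ (φ ψ : EuclideanSpace ℝ (Fin n) → ℝ) (C : ℝ), 0 ≤ C ∧ IsRadialKernel φ ψ C := by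
  obtain ⟨φ, ψ, h1, h2, h3, h4, h5, h6⟩ := exists_radial_kernel n
  have hφc := hasCompactSupport_of_ball h3
  have hψc := hasCompactSupport_of_ball h4
  obtain ⟨C₁, hC₁, b₁⟩ := exists_abs_le_of_hasCompactSupport (ι := Unit) (f := fun _ => φ)
    (fun _ => h1.continuous) (fun _ => hφc)
  obtain ⟨C₂, hC₂, b₂⟩ := exists_abs_le_of_hasCompactSupport (f := fun i => partialD i φ)
    (fun i => (contDiff_partialD h1 i).continuous) (fun i => hasCompactSupport_partialD hφc i)
  obtain ⟨C₃, hC₃, b₃⟩ := exists_abs_le_of_hasCompactSupport (f := fun i => partialD i ψ)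
    (fun i => (contDiff_partialD h2 i).continuous) (fun i => hasCompactSupport_partialD hψc i)
  obtain ⟨C₄, hC₄, b₄⟩ := exists_abs_le_of_hasCompactSupport
    (f := fun p : Fin n × Fin n => partialD p.1 (partialD p.2 ψ))
    (fun p => (contDiff_partialD (contDiff_partialD h2 p.2) p.1).continuous)
    (fun p => hasCompactSupport_partialD (hasCompactSupport_partialD hψc p.2) p.1)
  refine ⟨φ, ψ, C₁ + C₂ + C₃ + C₄, by positivity, h1, h2, h3, h4, h5, h6, fun ζ => ?_,
    fun i ζ => ?_, fun i ζ => ?_, fun i j ζ => ?_⟩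
  · linarith [b₁ () ζ]
  · linarith [b₂ i ζ]
  · linarith [b₃ i ζ]
  · linarith [b₄ (i, j) ζ]

/-- The sum of the absolute values of the symmetrised gradient. -/
noncomputable def symSum (u : Fin n → EuclideanSpace ℝ (Fin n) → ℝ)
    (x : EuclideanSpace ℝ (Fin n)) : ℝ := ∑ i, ∑ j, |symGrad u i j x|

/-- The integral of `symSum` over the ball of radius `h(x)` about `x`, rescaled. -/
noncomputable def ballAvg (h : EuclideanSpace ℝ (Fin n) → ℝ)
    (u : Fin n → EuclideanSpace ℝ (Fin n) → ℝ) (x : EuclideanSpace ℝ (Fin n)) : ℝ :=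
  ∫ ζ in Metric.closedBall 0 1, symSum u (x + h x • ζ)

variable {u : Fin n → EuclideanSpace ℝ (Fin n) → ℝ} {h : EuclideanSpace ℝ (Fin n) → ℝ}
  {φ ψ : EuclideanSpace ℝ (Fin n) → ℝ} {C : ℝ}

lemma symSum_nonneg (u : Fin n → EuclideanSpace ℝ (Fin n) → ℝ) (x : EuclideanSpace ℝ (Fin n)) :
    0 ≤ symSum u x :=
  Finset.sum_nonneg fun _ _ => Finset.sum_nonneg fun _ _ => abs_nonneg _

lemma abs_symGrad_le (u : Fin n → EuclideanSpace ℝ (Fin n) → ℝ) (i j : Fin n)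
    (x : EuclideanSpace ℝ (Fin n)) : |symGrad u i j x| ≤ symSum u x :=
  (Finset.single_le_sum (f := fun j => |symGrad u i j x|) (fun _ _ => abs_nonneg _)
    (Finset.mem_univ j)).trans
  (Finset.single_le_sum (f := fun i => ∑ j, |symGrad u i j x|)
    (fun _ _ => Finset.sum_nonneg fun _ _ => abs_nonneg _) (Finset.mem_univ i))

lemma continuous_symSum (hu : ∀ j, ContDiff ℝ ∞ (u j)) : Continuous (symSum u) :=
  continuous_finsetSum _ fun i _ => continuous_finsetSum _ fun j _ =>
    (contDiff_symGrad hu i j).continuous.abs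

lemma ballAvg_nonneg (h : EuclideanSpace ℝ (Fin n) → ℝ)
    (u : Fin n → EuclideanSpace ℝ (Fin n) → ℝ) (x : EuclideanSpace ℝ (Fin n)) :
    0 ≤ ballAvg h u x := integral_nonneg fun _ => symSum_nonneg _ _

lemma symSum_sq_le (u : Fin n → EuclideanSpace ℝ (Fin n) → ℝ) (x : EuclideanSpace ℝ (Fin n)) :
    symSum u x ^ 2 ≤ n ^ 2 * ∑ i, ∑ j, symGrad u i j x ^ 2 := by
  have h1 := sq_sum_le_card_mul_sum_sq (s := Finset.univ)
    (f := fun i => ∑ j, |symGrad u i j x|)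
  have h2 : ∀ i, (∑ j, |symGrad u i j x|) ^ 2 ≤ n * ∑ j, symGrad u i j x ^ 2 := by
    intro i
    simpa using sq_sum_le_card_mul_sum_sq (s := Finset.univ) (f := fun j => |symGrad u i j x|)
  rw [Finset.card_univ, Fintype.card_fin] at h1
  calc symSum u x ^ 2 ≤ n * ∑ i, (∑ j, |symGrad u i j x|) ^ 2 := h1
    _ ≤ n * ∑ i, (n * ∑ j, symGrad u i j x ^ 2) := by gcongr with i _; exact h2 i
    _ = _ := by rw [← Finset.mul_sum]; ring

lemma abs_integral_symGrad_mul_le {k : EuclideanSpace ℝ (Fin n) → ℝ}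
    (hu : ∀ j, ContDiff ℝ ∞ (u j)) (hkz : ∀ ζ, 1 < ‖ζ‖ → k ζ = 0) (hC : ∀ ζ, |k ζ| ≤ C)
    (i j : Fin n) (x : EuclideanSpace ℝ (Fin n)) :
    |∫ ζ, symGrad u i j (x + h x • ζ) * k ζ| ≤ C * ballAvg h u x := by
  have := continuous_symSum hu
  exact abs_integral_mul_kernel_le hkz hC (N := fun ζ => symSum u (x + h x • ζ)) (by fun_prop)
    fun ζ => abs_symGrad_le u i j _

lemma IsRadialKernel.hasCompactSupport (hk : IsRadialKernel φ ψ C) : HasCompactSupport φ :=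
  hasCompactSupport_of_ball hk.zero

lemma IsRadialKernel.hasCompactSupport_pot (hk : IsRadialKernel φ ψ C) : HasCompactSupport ψ :=
  hasCompactSupport_of_ball hk.zero_pot

lemma IsRadialKernel.grad_zero (hk : IsRadialKernel φ ψ C) (i : Fin n) :
    ∀ ζ, 1 ≤ ‖ζ‖ → partialD i ψ ζ = 0 := fun ζ hζ => by rw [hk.grad, hk.zero ζ hζ, mul_zero]

lemma abs_integral_radial_le (hk : IsRadialKernel φ ψ C) (hu : ∀ j, ContDiff ℝ ∞ (u j))
    (i : Fin n) {x : EuclideanSpace ℝ (Fin n)} (hx : h x ≠ 0) :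
    |∫ ζ, fderiv ℝ (u i) (x + h x • ζ) ζ * φ ζ| ≤ n * (3 * C * ballAvg h u x) := by
  rw [integral_radial_deriv hu hk.smooth_pot hk.hasCompactSupport_pot hk.grad i x hx]
  refine (Finset.abs_sum_le_sum_abs _ _).trans ?_
  refine (Finset.sum_le_card_nsmul _ _ (3 * C * ballAvg h u x) fun l _ => ?_).trans (by simp)
  have h1 := abs_integral_symGrad_mul_le (h := h) hu (fun ζ hζ => hk.grad_zero l ζ hζ.le)
    (hk.bound_grad l) i l x
  have h2 := abs_integral_symGrad_mul_le (h := h) hu (fun ζ hζ => hk.grad_zero i ζ hζ.le)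
    (hk.bound_grad i) l l x
  refine (abs_sub _ _).trans ?_
  rw [abs_mul, abs_two]
  linarith

/-- An average of second derivatives loses one power of the radius, not two, because only one
derivative has to be moved off `e(u)`. This single factor is what the weight in Hardy's inequality
compensates. -/
lemma abs_integral_second_deriv_le {k : EuclideanSpace ℝ (Fin n) → ℝ}
    (hu : ∀ j, ContDiff ℝ ∞ (u j)) (hks : ContDiff ℝ ∞ k)
    (hkz : ∀ ζ, 1 ≤ ‖ζ‖ → k ζ = 0) (hC : ∀ i ζ, |partialD i k ζ| ≤ C)
    (a b c : Fin n) {x : EuclideanSpace ℝ (Fin n)} (hx : 0 < h x) :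
    |∫ ζ, partialD a (partialD b (u c)) (x + h x • ζ) * k ζ| ≤
      (h x)⁻¹ * (3 * C * ballAvg h u x) := by
  have hz : ∀ i ζ, 1 < ‖ζ‖ → partialD i k ζ = 0 := fun i ζ hζ => fderiv_eq_zero_of_ball hkz _ ζ hζ
  rw [integral_second_deriv hu hks (hasCompactSupport_of_ball hkz) a b c x hx.ne', abs_mul,
    abs_neg, abs_of_pos (inv_pos.2 hx)]
  gcongr
  have h1 := abs_integral_symGrad_mul_le (h := h) hu (hz a) (hC a) b c x
  have h2 := abs_integral_symGrad_mul_le (h := h) hu (hz b) (hC b) a c x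
  have h3 := abs_integral_symGrad_mul_le (h := h) hu (hz c) (hC c) a b x
  refine (abs_sub _ _).trans ?_
  have := abs_add_le (∫ ζ, symGrad u b c (x + h x • ζ) * partialD a k ζ)
    (∫ ζ, symGrad u a c (x + h x • ζ) * partialD b k ζ)
  linarith

/-- The second term is due to the variation of the radius. It is the radial derivative in
`integral_radial_deriv`, so it too sees the symmetrised gradient only. -/
lemma partialD_varAvg (hk : IsRadialKernel φ ψ C) (hu : ∀ j, ContDiff ℝ ∞ (u j))
    (hh : ContDiff ℝ ∞ h) (i j : Fin n) (x : EuclideanSpace ℝ (Fin n)) :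
    partialD i (varAvg φ h (u j)) x = varAvg φ h (partialD i (u j)) x +
      partialD i h x * ∫ ζ, fderiv ℝ (u j) (x + h x • ζ) ζ * φ ζ := by
  have cd : Continuous (fderiv ℝ (u j)) := (hu j).continuous_fderiv (by simp)
  have cφ := hk.smooth.continuous
  have hpt : ∀ ζ, fderiv ℝ (u j) (x + h x • ζ)
      (EuclideanSpace.single i 1 + fderiv ℝ h x (EuclideanSpace.single i 1) • ζ) * φ ζ =
      partialD i (u j) (x + h x • ζ) * φ ζ +
        partialD i h x * (fderiv ℝ (u j) (x + h x • ζ) ζ * φ ζ) := by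
    intro ζ
    simp only [partialD, map_add, map_smul, smul_eq_mul]
    ring
  rw [partialD, fderiv_varAvg hk.smooth hk.hasCompactSupport hh (hu j)]
  simp_rw [hpt]
  rw [integral_add, integral_const_mul]
  · rfl
  · exact integrable_comp_mul (contDiff_partialD (hu j) i).continuous cφ hk.hasCompactSupport x _
  · exact (Continuous.integrable_of_hasCompactSupport (by fun_prop)
      hk.hasCompactSupport.mul_left).const_mul _

lemma abs_partialD_le (hK : ∀ x, ‖fderiv ℝ h x‖ ≤ 1 / 2) (i : Fin n)
    (x : EuclideanSpace ℝ (Fin n)) : |partialD i h x| ≤ 1 / 2 := by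
  have := (fderiv ℝ h x).le_opNorm (EuclideanSpace.single i 1)
  rw [PiLp.norm_single, norm_one, mul_one] at this
  exact this.trans (hK x)

lemma abs_partialD_varAvg_sub_le (hk : IsRadialKernel φ ψ C) (hu : ∀ j, ContDiff ℝ ∞ (u j))
    (hh : ContDiff ℝ ∞ h) (hK : ∀ x, ‖fderiv ℝ h x‖ ≤ 1 / 2) (i j : Fin n)
    {x : EuclideanSpace ℝ (Fin n)} (hx : h x ≠ 0) :
    |partialD i (varAvg φ h (u j)) x - varAvg φ h (partialD i (u j)) x| ≤
      1 / 2 * (n * (3 * C * ballAvg h u x)) := by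
  rw [partialD_varAvg hk hu hh, add_sub_cancel_left, abs_mul]
  exact mul_le_mul (abs_partialD_le hK i x) (abs_integral_radial_le hk hu j hx) (abs_nonneg _)
    (by norm_num)

lemma abs_fderiv_varAvg_partialD_le (hC0 : 0 ≤ C) (hk : IsRadialKernel φ ψ C)
    (hu : ∀ j, ContDiff ℝ ∞ (u j)) (hh : ContDiff ℝ ∞ h) (hK : ∀ x, ‖fderiv ℝ h x‖ ≤ 1 / 2)
    (i j : Fin n) {ν : EuclideanSpace ℝ (Fin n)} (hν : ‖ν‖ ≤ 1) {x : EuclideanSpace ℝ (Fin n)}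
    (hx : 0 < h x) :
    |fderiv ℝ (varAvg φ h (partialD i (u j))) x ν| ≤
      (h x)⁻¹ * (n * (6 * C * ballAvg h u x)) := by
  have hD := contDiff_partialD (hu j) i
  -- In the term with `∂_νh` the factor `ζ_lφ` equals `∂_lψ`; both terms are therefore averages of
  -- second derivatives against kernels that vanish outside the unit ball.
  have hpt : ∀ ζ, fderiv ℝ (partialD i (u j)) (x + h x • ζ) (ν + fderiv ℝ h x ν • ζ) * φ ζ =
      ∑ l, (ν l * (partialD l (partialD i (u j)) (x + h x • ζ) * φ ζ) +
        fderiv ℝ h x ν * (partialD l (partialD i (u j)) (x + h x • ζ) * partialD l ψ ζ)) := by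
    intro ζ
    rw [fderiv_eq_sum_partialD, Finset.sum_mul]
    refine Finset.sum_congr rfl fun l _ => ?_
    rw [hk.grad]
    simp only [PiLp.add_apply, PiLp.smul_apply, smul_eq_mul]
    ring
  have hi1 : ∀ l, Integrable fun ζ => partialD l (partialD i (u j)) (x + h x • ζ) * φ ζ :=
    fun l => integrable_comp_mul (contDiff_partialD hD l).continuous hk.smooth.continuous
      hk.hasCompactSupport x _
  have hi2 : ∀ l, Integrable fun ζ =>
      partialD l (partialD i (u j)) (x + h x • ζ) * partialD l ψ ζ :=
    fun l => integrable_comp_mul (contDiff_partialD hD l).continuous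
      (contDiff_partialD hk.smooth_pot l).continuous
      (hasCompactSupport_partialD hk.hasCompactSupport_pot l) x _
  rw [fderiv_varAvg hk.smooth hk.hasCompactSupport hh hD]
  simp_rw [hpt]
  have hi12 : ∀ l, Integrable fun ζ => ν l * (partialD l (partialD i (u j)) (x + h x • ζ) * φ ζ) +
      fderiv ℝ h x ν * (partialD l (partialD i (u j)) (x + h x • ζ) * partialD l ψ ζ) :=
    fun l => ((hi1 l).const_mul _).add ((hi2 l).const_mul _)
  rw [integral_finsetSum _ fun l _ => hi12 l]
  refine (Finset.abs_sum_le_sum_abs _ _).trans ?_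
  have hterm : ∀ l ∈ Finset.univ, |∫ ζ, (ν l * (partialD l (partialD i (u j)) (x + h x • ζ) * φ ζ) +
        fderiv ℝ h x ν * (partialD l (partialD i (u j)) (x + h x • ζ) * partialD l ψ ζ))| ≤
      (h x)⁻¹ * (6 * C * ballAvg h u x) := by
    intro l _
    rw [integral_add ((hi1 l).const_mul _) ((hi2 l).const_mul _), integral_const_mul,
      integral_const_mul]
    refine (abs_add_le _ _).trans ?_
    rw [abs_mul, abs_mul]
    have b1 := abs_integral_second_deriv_le hu hk.smooth hk.zero hk.bound_deriv l i j hx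
    have b2 := abs_integral_second_deriv_le hu (contDiff_partialD hk.smooth_pot l)
      (hk.grad_zero l) (fun a => hk.bound_hess a l) l i j hx
    have hB : 0 ≤ (h x)⁻¹ * (3 * C * ballAvg h u x) := by
      have := ballAvg_nonneg h u x
      positivity
    have n1 : |ν l| ≤ 1 := (PiLp.norm_apply_le ν l).trans hν
    have n2 : |fderiv ℝ h x ν| ≤ 1 := by
      refine ((fderiv ℝ h x).le_opNorm ν).trans ?_
      have := mul_le_mul (hK x) hν (norm_nonneg _) (by norm_num)
      linarith
    have m1 := mul_le_mul n1 b1 (abs_nonneg _) zero_le_one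
    have m2 := mul_le_mul n2 b2 (abs_nonneg _) zero_le_one
    linarith
  refine (Finset.sum_le_card_nsmul _ _ _ hterm).trans (le_of_eq ?_)
  simp
  ring

lemma partialD_sub_apply {f g : EuclideanSpace ℝ (Fin n) → ℝ} (hf : ContDiff ℝ ∞ f)
    (hg : ContDiff ℝ ∞ g) (i : Fin n) (x : EuclideanSpace ℝ (Fin n)) :
    partialD i (fun y => f y - g y) x = partialD i f x - partialD i g x := by
  have := ((hf.differentiable (by simp) x).hasFDerivAt.sub
    (hg.differentiable (by simp) x).hasFDerivAt).fderiv
  have h2 : fderiv ℝ (fun y => f y - g y) x = _ := this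
  rw [partialD, h2]
  rfl

/-- The symmetrised gradient of the difference of a field and its variable average. -/
lemma abs_symGrad_sub_varAvg_le (hC0 : 0 ≤ C) (hk : IsRadialKernel φ ψ C)
    (hu : ∀ j, ContDiff ℝ ∞ (u j)) (hh : ContDiff ℝ ∞ h) (hK : ∀ x, ‖fderiv ℝ h x‖ ≤ 1 / 2)
    (i j : Fin n) {x : EuclideanSpace ℝ (Fin n)} (hx : h x ≠ 0) :
    |symGrad (fun j y => u j y - varAvg φ h (u j) y) i j x| ≤
      symSum u x + (1 + 3 * n) * C * ballAvg h u x := by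
  have hv : ∀ j, ContDiff ℝ ∞ (varAvg φ h (u j)) :=
    fun j => contDiff_varAvg hk.smooth hk.hasCompactSupport hh (hu j)
  have e1 := abs_partialD_varAvg_sub_le hk hu hh hK i j hx
  have e2 := abs_partialD_varAvg_sub_le hk hu hh hK j i hx
  have e3 : (varAvg φ h (partialD i (u j)) x + varAvg φ h (partialD j (u i)) x) / 2 =
      ∫ ζ, symGrad u i j (x + h x • ζ) * φ ζ := by
    have i1 : ∀ i j, Integrable fun ζ => partialD i (u j) (x + h x • ζ) * φ ζ := fun i j =>
      integrable_comp_mul (contDiff_partialD (hu j) i).continuous hk.smooth.continuous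
        hk.hasCompactSupport x _
    change ((∫ ζ, partialD i (u j) (x + h x • ζ) * φ ζ) +
      ∫ ζ, partialD j (u i) (x + h x • ζ) * φ ζ) / 2 = _
    rw [← integral_add (i1 i j) (i1 j i), ← integral_div]
    congr 1
    ext ζ
    unfold symGrad
    ring
  have e4 := abs_integral_symGrad_mul_le (h := h) hu (fun ζ hζ => hk.zero ζ hζ.le) hk.bound i j x
  rw [← e3] at e4
  have e5 := abs_symGrad_le u i j x
  -- The average of `e(u)` is separated from the two commutators of differentiation with averaging;
  -- each piece is bounded by `ballAvg`.
  have e6 : symGrad (fun j y => u j y - varAvg φ h (u j) y) i j x = symGrad u i j x -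
      (varAvg φ h (partialD i (u j)) x + varAvg φ h (partialD j (u i)) x) / 2 -
      ((partialD i (varAvg φ h (u j)) x - varAvg φ h (partialD i (u j)) x) +
      (partialD j (varAvg φ h (u i)) x - varAvg φ h (partialD j (u i)) x)) / 2 := by
    unfold symGrad
    rw [partialD_sub_apply (hu j) (hv j), partialD_sub_apply (hu i) (hv i)]
    ring
  rw [e6]
  have hA := ballAvg_nonneg h u x
  have hnA : 0 ≤ (n : ℝ) * (C * ballAvg h u x) := by positivity
  rw [abs_le] at *
  constructor <;> nlinarith

/-- A zero of `h` is a minimum, so `∇h` vanishes there, and an average at scale zero is a point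
value. Hence no gradient of the difference is left outside `{h > 0}`, and Korn's inequality on the
whole space needs information on `{h > 0}` only. -/
lemma partialD_sub_varAvg_eq_zero (hk : IsRadialKernel φ ψ C) (hu : ∀ j, ContDiff ℝ ∞ (u j))
    (hh : ContDiff ℝ ∞ h) (h0 : ∀ x, 0 ≤ h x) (i j : Fin n) {x : EuclideanSpace ℝ (Fin n)}
    (hx : h x = 0) : partialD i (fun y => u j y - varAvg φ h (u j) y) x = 0 := by
  have hmin : fderiv ℝ h x = 0 := by
    apply IsLocalMin.fderiv_eq_zero
    exact Filter.Eventually.of_forall fun y => by rw [hx]; exact h0 y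
  rw [partialD_sub_apply (hu j) (contDiff_varAvg hk.smooth hk.hasCompactSupport hh (hu j)),
    partialD_varAvg hk hu hh]
  have : varAvg φ h (partialD i (u j)) x = partialD i (u j) x := by
    simp only [varAvg, scaleAvg, hx, zero_smul, add_zero, integral_const_mul, hk.integral_eq_one,
      mul_one]
  have h1 : partialD i h x = 0 := by rw [partialD, hmin]; rfl
  rw [this, h1]
  simp

end Core

/-- A smooth version of the positive part, which is the identity on `[1, ∞)`. -/
lemma exists_bound_deriv_mul_smoothTransition :
    ∃ L : ℝ, 1 ≤ L ∧ ∀ s, |deriv (fun t => t * Real.smoothTransition t) s| ≤ L := by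
  set f : ℝ → ℝ := fun t => t * Real.smoothTransition t with hf
  have hfs : ContDiff ℝ 1 f := contDiff_id.mul (Real.smoothTransition.contDiff (n := 1))
  obtain ⟨L, hL⟩ := (isCompact_Icc (a := (0 : ℝ)) (b := 1)).exists_bound_of_continuousOn
    (hfs.continuous_deriv le_rfl).continuousOn
  refine ⟨max L 1, le_max_right _ _, fun s => ?_⟩
  rcases lt_or_ge s 0 with h | h
  · have : f =ᶠ[nhds s] fun _ => 0 := by
      filter_upwards [Iio_mem_nhds h] with t ht
      simp [hf, Real.smoothTransition.zero_of_nonpos (le_of_lt ht)]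
    rw [this.deriv_eq]
    simp
  rcases lt_or_ge 1 s with h1 | h1
  · have : f =ᶠ[nhds s] fun t => t := by
      filter_upwards [Ioi_mem_nhds h1] with t ht
      simp [hf, Real.smoothTransition.one_of_one_le (le_of_lt ht)]
    rw [this.deriv_eq]
    simp
  · exact (hL s ⟨h, h1⟩).trans (le_max_left _ _)

/-! ### Korn's inequality for smooth fields on a supergraph -/

section SmoothKorn

variable {n : ℕ}

lemma lintegral_ofReal_eq {X : Type*} [MeasurableSpace X] [TopologicalSpace X] [BorelSpace X] [R1Space X]
    {μ : Measure X} [IsFiniteMeasureOnCompacts μ] {f : X → ℝ} (hf : Continuous f)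
    (hc : HasCompactSupport f) (h0 : ∀ x, 0 ≤ f x) :
    ∫⁻ x, ENNReal.ofReal (f x) ∂μ = ENNReal.ofReal (∫ x, f x ∂μ) :=
  (ofReal_integral_eq_lintegral_ofReal (hf.integrable_of_hasCompactSupport hc)
    (Filter.Eventually.of_forall h0)).symm

lemma hasCompactSupport_sum_sq {ι : Type*} [Fintype ι] {X : Type*} [TopologicalSpace X] [R1Space X]
    {f : ι → ι → X → ℝ} (hc : ∀ i j, HasCompactSupport (f i j)) :
    HasCompactSupport fun x => ∑ i, ∑ j, f i j x ^ 2 := by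
  have h2 : IsCompact (⋃ i, ⋃ j, tsupport (f i j)) :=
    isCompact_iUnion fun i => isCompact_iUnion fun j => hc i j
  refine HasCompactSupport.of_support_subset_isCompact h2 fun x hx => ?_
  by_contra hcon
  simp only [Set.mem_iUnion, not_exists] at hcon
  exact hx (Finset.sum_eq_zero fun i _ => Finset.sum_eq_zero fun j _ => by
    rw [image_eq_zero_of_notMem_tsupport (hcon i j)]; ring)

lemma setLIntegral_ofReal_const_mul {X : Type*} [MeasurableSpace X] {μ : Measure X} {a : ℝ}
    (ha : 0 ≤ a) (f : X → ℝ) (S : Set X) :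
    ∫⁻ x in S, ENNReal.ofReal (a * f x) ∂μ = ENNReal.ofReal a * ∫⁻ x in S, ENNReal.ofReal (f x) ∂μ := by
  simp_rw [ENNReal.ofReal_mul ha]
  exact lintegral_const_mul' _ _ ENNReal.ofReal_ne_top

variable {φ ψ : EuclideanSpace ℝ (Fin n) → ℝ} {C : ℝ}
  {u : Fin n → EuclideanSpace ℝ (Fin n) → ℝ} {h ρ : EuclideanSpace ℝ (Fin n) → ℝ}

lemma continuous_ballAvg (hu : ∀ j, ContDiff ℝ ∞ (u j)) (hh : Continuous h) :
    Continuous (ballAvg h u) := by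
  have := continuous_symSum hu
  exact continuous_parametric_integral_of_continuous
    (f := fun x ζ => symSum u (x + h x • ζ)) (by fun_prop) (isCompact_closedBall 0 1)

/-- The field minus its variable average, estimated by Korn's first inequality. -/
lemma lintegral_gradient_sub_varAvg_le (hC0 : 0 ≤ C) (hk : IsRadialKernel φ ψ C)
    (hu : ∀ j, ContDiff ℝ ∞ (u j)) (huc : ∀ j, HasCompactSupport (u j)) (hh : ContDiff ℝ ∞ h)
    (hK : ∀ x, ‖fderiv ℝ h x‖ ≤ 1 / 2) (h0 : ∀ x, 0 ≤ h x) :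
    ∫⁻ x, ENNReal.ofReal (∑ i, ∑ j, partialD i (fun y => u j y - varAvg φ h (u j) y) x ^ 2) ≤
      ENNReal.ofReal (4 * n ^ 2) * (∫⁻ x in {x | 0 < h x}, ENNReal.ofReal (symSum u x ^ 2)) +
      ENNReal.ofReal (4 * n ^ 2 * ((1 + 3 * n) * C) ^ 2) *
        ∫⁻ x in {x | 0 < h x}, ENNReal.ofReal (ballAvg h u x ^ 2) := by
  have hSm : MeasurableSet {x | 0 < h x} := (isOpen_lt continuous_const hh.continuous).measurableSet
  set z : Fin n → EuclideanSpace ℝ (Fin n) → ℝ := fun j y => u j y - varAvg φ h (u j) y with hz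
  have hzs : ∀ j, ContDiff ℝ ∞ (z j) := fun j =>
    (hu j).sub (contDiff_varAvg hk.smooth hk.hasCompactSupport hh (hu j))
  have hzc : ∀ j, HasCompactSupport (z j) := fun j =>
    (huc j).sub (hasCompactSupport_varAvg hk.zero (hh.of_le (by simp)) hK (huc j))
  have hkorn := korn_of_hasCompactSupport hzs hzc
  have hc1 : Continuous fun x => ∑ i, ∑ j, partialD i (z j) x ^ 2 :=
    continuous_finsetSum _ fun i _ => continuous_finsetSum _ fun j _ =>
      (contDiff_partialD (hzs j) i).continuous.pow 2
  have hc2 : Continuous fun x => ∑ i, ∑ j, symGrad z i j x ^ 2 :=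
    continuous_finsetSum _ fun i _ => continuous_finsetSum _ fun j _ =>
      (contDiff_symGrad hzs i j).continuous.pow 2
  have hnn : ∀ f : Fin n → Fin n → ℝ, 0 ≤ ∑ i, ∑ j, f i j ^ 2 := fun f =>
    Finset.sum_nonneg fun _ _ => Finset.sum_nonneg fun _ _ => sq_nonneg _
  have cA := continuous_ballAvg hu hh.continuous
  have cN := continuous_symSum hu
  calc ∫⁻ x, ENNReal.ofReal (∑ i, ∑ j, partialD i (z j) x ^ 2)
      = ENNReal.ofReal (∫ x, ∑ i, ∑ j, partialD i (z j) x ^ 2) :=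
        lintegral_ofReal_eq hc1
          (hasCompactSupport_sum_sq fun i j => hasCompactSupport_partialD (hzc j) i)
          fun x => hnn _
    _ ≤ ENNReal.ofReal (2 * ∫ x, ∑ i, ∑ j, symGrad z i j x ^ 2) := ENNReal.ofReal_le_ofReal hkorn
    _ = ENNReal.ofReal 2 * ∫⁻ x, ENNReal.ofReal (∑ i, ∑ j, symGrad z i j x ^ 2) := by
        rw [ENNReal.ofReal_mul zero_le_two, lintegral_ofReal_eq hc2
          (hasCompactSupport_sum_sq fun i j => hasCompactSupport_symGrad hzc i j) fun x => hnn _]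
    _ = ENNReal.ofReal 2 *
        ∫⁻ x in {x | 0 < h x}, ENNReal.ofReal (∑ i, ∑ j, symGrad z i j x ^ 2) := by
        congr 1
        rw [← lintegral_indicator hSm]
        refine lintegral_congr fun x => ?_
        by_cases hx : 0 < h x
        · rw [Set.indicator_of_mem (by exact hx)]
        · rw [Set.indicator_of_notMem (by exact hx)]
          have hx0 : h x = 0 := le_antisymm (not_lt.1 hx) (h0 x)
          have : ∀ i j, symGrad z i j x = 0 := fun i j => by
            unfold symGrad
            rw [partialD_sub_varAvg_eq_zero hk hu hh h0 i j hx0,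
              partialD_sub_varAvg_eq_zero hk hu hh h0 j i hx0]
            simp
          simp [this]
    _ ≤ ENNReal.ofReal 2 * ∫⁻ x in {x | 0 < h x}, (ENNReal.ofReal (2 * n ^ 2 * symSum u x ^ 2) +
          ENNReal.ofReal (2 * n ^ 2 * ((1 + 3 * n) * C) ^ 2 * ballAvg h u x ^ 2)) := by
        refine mul_le_mul_right (setLIntegral_mono' hSm fun x hx => ?_) _
        rw [← ENNReal.ofReal_add (by positivity) (by positivity)]
        refine ENNReal.ofReal_le_ofReal ?_
        -- The bound does not depend on `i, j`; the double sum contributes the factor `n²` and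
        -- Korn's inequality a further 2, which makes `4n²`.
        have hb : ∀ i j, symGrad z i j x ^ 2 ≤
            2 * symSum u x ^ 2 + 2 * ((1 + 3 * n) * C * ballAvg h u x) ^ 2 := by
          intro i j
          have h1 := abs_symGrad_sub_varAvg_le hC0 hk hu hh hK i j (ne_of_gt hx)
          have h2 : symGrad z i j x ^ 2 ≤ (symSum u x + (1 + 3 * n) * C * ballAvg h u x) ^ 2 := by
            rw [← sq_abs]
            exact pow_le_pow_left₀ (abs_nonneg _) h1 2
          nlinarith [sq_nonneg (symSum u x - (1 + 3 * n) * C * ballAvg h u x)]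
        calc ∑ i, ∑ j, symGrad z i j x ^ 2 ≤ ∑ i : Fin n, ∑ j : Fin n,
              (2 * symSum u x ^ 2 + 2 * ((1 + 3 * n) * C * ballAvg h u x) ^ 2) :=
              Finset.sum_le_sum fun i _ => Finset.sum_le_sum fun j _ => hb i j
          _ = _ := by
            simp only [Finset.sum_const, Finset.card_univ, Fintype.card_fin, nsmul_eq_mul]
            ring
    _ = _ := by
        rw [lintegral_add_left (by fun_prop), setLIntegral_ofReal_const_mul (by positivity),
          setLIntegral_ofReal_const_mul (by positivity), mul_add, ← mul_assoc, ← mul_assoc,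
          ← ENNReal.ofReal_mul zero_le_two, ← ENNReal.ofReal_mul zero_le_two]
        congr 3 <;> ring

/-- Averages of derivatives at the scale `h` are controlled by Hardy's inequality. -/
lemma lintegral_varAvg_partialD_le (hC0 : 0 ≤ C) (hk : IsRadialKernel φ ψ C) {c : ℝ} (hc : 0 < c)
    (hu : ∀ j, ContDiff ℝ ∞ (u j)) (huc : ∀ j, HasCompactSupport (u j)) (hh : ContDiff ℝ ∞ h)
    (hK : ∀ x, ‖fderiv ℝ h x‖ ≤ 1 / 2) (hρ : ContDiff ℝ ∞ ρ) {ν : EuclideanSpace ℝ (Fin n)}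
    (hν : ‖ν‖ ≤ 1) (hρν : ∀ x, fderiv ℝ ρ x ν = 1) {τ : ℝ} (hτ : 0 < τ)
    (hlin : ∀ x, τ ≤ ρ x → h x = c * ρ x) (i j : Fin n) :
    ∫⁻ x in {x | 2 * τ ≤ ρ x}, ENNReal.ofReal (varAvg φ h (partialD i (u j)) x ^ 2) ≤
      ENNReal.ofReal (4 * (n * (6 * C) / c) ^ 2) *
        ∫⁻ x in {x | 0 < h x}, ENNReal.ofReal (ballAvg h u x ^ 2) := by
  have hSm : MeasurableSet {x | 0 < h x} := (isOpen_lt continuous_const hh.continuous).measurableSet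
  have hTm : MeasurableSet {x | 2 * τ ≤ ρ x} :=
    (isClosed_le continuous_const hρ.continuous).measurableSet
  set W := varAvg φ h (partialD i (u j)) with hW
  have hD := contDiff_partialD (hu j) i
  have hWs : ContDiff ℝ ∞ W := contDiff_varAvg hk.smooth hk.hasCompactSupport hh hD
  have hWc : HasCompactSupport W := hasCompactSupport_varAvg hk.zero (hh.of_le (by simp)) hK
    (hasCompactSupport_partialD (huc j) i)
  -- This cutoff is 0 for `s ≤ τ` and 1 for `s ≥ 2τ`. It confines Hardy's inequality to the region
  -- where `h = cρ`, so that the weight `ρ` cancels the factor `h⁻¹` in the bound for `∂_νW` up to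
  -- `1/c`.
  set χ : ℝ → ℝ := fun s => Real.smoothTransition (s / τ - 1) with hχ
  have hχs : ContDiff ℝ 1 χ :=
    (Real.smoothTransition.contDiff (n := 1)).comp ((contDiff_id.div_const τ).sub contDiff_const)
  have hχm : Monotone χ := fun s t hst => Real.smoothTransition.monotone (by gcongr)
  have hχ1 : ∀ s, s ≤ τ → χ s = 0 := fun s hs => Real.smoothTransition.zero_of_nonpos (by
    rw [sub_nonpos, div_le_one hτ]; exact hs)
  have hχ2 : ∀ s, 2 * τ ≤ s → χ s = 1 := fun s hs => Real.smoothTransition.one_of_one_le (by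
    rw [le_sub_iff_add_le, le_div_iff₀ hτ]; linarith)
  have hχnn : ∀ s, 0 ≤ χ s := fun s => Real.smoothTransition.nonneg _
  have hχle : ∀ s, χ s ≤ 1 := fun s => Real.smoothTransition.le_one _
  have hardy := hardy_inequality (μ := volume) (hWs.of_le (by simp)) hWc (hρ.of_le (by simp)) hχs
    hχm (fun s hs => hχ1 s (hs.trans hτ.le)) hρν
  have cW := hWs.continuous
  have cρ := hρ.continuous
  have cχ := hχs.continuous
  have cdW := (contDiff_fderiv_dir hWs ν).continuous
  have s1 : HasCompactSupport fun x => χ (ρ x) * W x ^ 2 :=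
    (hWc.comp_left (g := fun t : ℝ => t ^ 2) (by simp)).mul_left
  have s2 : HasCompactSupport fun x => χ (ρ x) * (ρ x * fderiv ℝ W x ν) ^ 2 := by
    have := (hasCompactSupport_fderiv_dir hWc ν).mul_left (f := ρ)
    exact (this.comp_left (g := fun t : ℝ => t ^ 2) (by simp)).mul_left
  calc ∫⁻ x in {x | 2 * τ ≤ ρ x}, ENNReal.ofReal (W x ^ 2)
      ≤ ∫⁻ x in {x | 2 * τ ≤ ρ x}, ENNReal.ofReal (χ (ρ x) * W x ^ 2) :=
        setLIntegral_mono' hTm fun x hx => by rw [hχ2 _ hx, one_mul]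
    _ ≤ ∫⁻ x, ENNReal.ofReal (χ (ρ x) * W x ^ 2) := setLIntegral_le_lintegral _ _
    _ = ENNReal.ofReal (∫ x, χ (ρ x) * W x ^ 2) :=
        lintegral_ofReal_eq (by fun_prop) s1 fun x => mul_nonneg (hχnn _) (sq_nonneg _)
    _ ≤ ENNReal.ofReal (4 * ∫ x, χ (ρ x) * (ρ x * fderiv ℝ W x ν) ^ 2) :=
        ENNReal.ofReal_le_ofReal hardy
    _ = ENNReal.ofReal 4 * ∫⁻ x, ENNReal.ofReal (χ (ρ x) * (ρ x * fderiv ℝ W x ν) ^ 2) := by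
        rw [ENNReal.ofReal_mul (by norm_num), lintegral_ofReal_eq (by fun_prop) s2
          fun x => mul_nonneg (hχnn _) (sq_nonneg _)]
    _ ≤ ENNReal.ofReal 4 * ∫⁻ x in {x | 0 < h x},
          ENNReal.ofReal ((n * (6 * C) / c) ^ 2 * ballAvg h u x ^ 2) := by
        refine mul_le_mul_right ?_ _
        rw [← lintegral_indicator hSm]
        refine lintegral_mono fun x => ?_
        rcases le_or_gt (ρ x) τ with hx | hx
        · simp [hχ1 _ hx]
        · have hhx : h x = c * ρ x := hlin x hx.le
          have hρx : 0 < ρ x := hτ.trans hx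
          have hhpos : 0 < h x := by rw [hhx]; positivity
          rw [Set.indicator_of_mem (by exact hhpos)]
          refine ENNReal.ofReal_le_ofReal ?_
          have hb := abs_fderiv_varAvg_partialD_le hC0 hk hu hh hK i j hν hhpos
          have hb2 : |ρ x * fderiv ℝ W x ν| ≤ n * (6 * C) / c * ballAvg h u x := by
            rw [abs_mul, abs_of_pos hρx]
            refine (mul_le_mul_of_nonneg_left hb hρx.le).trans (le_of_eq ?_)
            rw [hhx]
            field_simp
          have hb3 := pow_le_pow_left₀ (abs_nonneg _) hb2 2
          rw [sq_abs] at hb3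
          exact (mul_le_of_le_one_left (sq_nonneg _) (hχle _)).trans (hb3.trans_eq (mul_pow _ _ _))
    _ = _ := by
        rw [setLIntegral_ofReal_const_mul (by positivity), ← mul_assoc,
          ← ENNReal.ofReal_mul (by norm_num)]

/-- Korn's inequality on the set `{ρ ≥ 2τ}`, by comparison with averages at the scale `h`, where
`h` vanishes for `ρ ≤ 0` and `h = cρ` for `ρ ≥ τ`. -/
lemma lintegral_gradient_le_of_scale (hC0 : 0 ≤ C)
    (hk : IsRadialKernel φ ψ C) {c : ℝ} (hc : 0 < c) (hu : ∀ j, ContDiff ℝ ∞ (u j))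
    (huc : ∀ j, HasCompactSupport (u j)) 
    (hh : ContDiff ℝ ∞ h) (hK : ∀ x, ‖fderiv ℝ h x‖ ≤ 1 / 2) (h0 : ∀ x, 0 ≤ h x)
    (hρ : ContDiff ℝ ∞ ρ) {ν : EuclideanSpace ℝ (Fin n)} (hν : ‖ν‖ ≤ 1)
    (hρν : ∀ x, fderiv ℝ ρ x ν = 1) (hpos : ∀ x, 0 < h x ↔ 0 < ρ x) {τ : ℝ} (hτ : 0 < τ)
    (hlin : ∀ x, τ ≤ ρ x → h x = c * ρ x) :
    ∫⁻ x in {x | 2 * τ ≤ ρ x}, ENNReal.ofReal (∑ i, ∑ j, partialD i (u j) x ^ 2) ≤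
      (3 * ENNReal.ofReal (4 * n ^ 2) + (3 * ENNReal.ofReal (4 * n ^ 2 * ((1 + 3 * n) * C) ^ 2) +
        3 * (n * (n * ENNReal.ofReal (4 * (n * (6 * C) / c) ^ 2))) +
        ENNReal.ofReal (3 * n ^ 2 * (n * (3 * C)) ^ 2)) *
        (2 * volume (Metric.closedBall (0 : EuclideanSpace ℝ (Fin n)) 1) ^ 2)) *
          ENNReal.ofReal (n ^ 2) *
      ∫⁻ x in {x | 0 < ρ x}, ENNReal.ofReal (∑ i, ∑ j, symGrad u i j x ^ 2) := by
  have hSeq : {x | 0 < ρ x} = {x | 0 < h x} := Set.ext fun x => (hpos x).symm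
  rw [hSeq]
  have hSm : MeasurableSet {x | 0 < h x} := (isOpen_lt continuous_const hh.continuous).measurableSet
  have hTm : MeasurableSet {x | 2 * τ ≤ ρ x} :=
    (isClosed_le continuous_const hρ.continuous).measurableSet
  have hTS : {x | 2 * τ ≤ ρ x} ⊆ {x | 0 < h x} := fun x hx =>
    (hpos x).2 (lt_of_lt_of_le (by linarith) (show 2 * τ ≤ ρ x from hx))
  have L1 := lintegral_gradient_sub_varAvg_le hC0 hk hu huc hh hK h0
  have L2 := lintegral_varAvg_partialD_le hC0 hk hc hu huc hh hK hρ hν hρν hτ hlin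
  -- With `|∇h| ≤ 1/2` the radius at any point of the averaging ball is at least `h(x)/2`, so the
  -- average never leaves `{h > 0}`.
  have hmaps : ∀ x ∈ {x | 0 < h x}, ∀ ζ : EuclideanSpace ℝ (Fin n), ‖ζ‖ ≤ 1 →
      x + h x • ζ ∈ {x | 0 < h x} := by
    intro x hx ζ hζ
    have hx' : 0 < h x := hx
    have h1 := abs_sub_le_of_norm_fderiv_le (hh.of_le (by simp)) hK x (x + h x • ζ)
    have h2 : ‖x - (x + h x • ζ)‖ ≤ h x := by
      rw [sub_add_cancel_left, norm_neg, norm_smul, Real.norm_eq_abs, abs_of_pos hx']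
      exact mul_le_of_le_one_right hx'.le hζ
    have h3 := (abs_le.1 h1).2
    change 0 < h (x + h x • ζ)
    linarith
  have L3 := lintegral_sq_ball_average_le (μ := volume) (hh.of_le (by simp)) hK hSm hmaps
    (continuous_symSum hu)
  have L4 : ∫⁻ x in {x | 0 < h x}, ENNReal.ofReal (symSum u x ^ 2) ≤ ENNReal.ofReal (n ^ 2) *
      ∫⁻ x in {x | 0 < h x}, ENNReal.ofReal (∑ i, ∑ j, symGrad u i j x ^ 2) := by
    rw [← setLIntegral_ofReal_const_mul (by positivity)]
    exact lintegral_mono fun x => ENNReal.ofReal_le_ofReal (symSum_sq_le u x)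
  change ∫⁻ x in {x | 0 < h x}, ENNReal.ofReal (ballAvg h u x ^ 2) ≤ _ at L3
  set G := ∫⁻ x in {x | 0 < h x}, ENNReal.ofReal (∑ i, ∑ j, symGrad u i j x ^ 2)
  set N2 := ∫⁻ x in {x | 0 < h x}, ENNReal.ofReal (symSum u x ^ 2)
  set A2 := ∫⁻ x in {x | 0 < h x}, ENNReal.ofReal (ballAvg h u x ^ 2)
  set z : Fin n → EuclideanSpace ℝ (Fin n) → ℝ := fun j y => u j y - varAvg φ h (u j) y with hz
  have hvs : ∀ j, ContDiff ℝ ∞ (varAvg φ h (u j)) := fun j =>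
    contDiff_varAvg hk.smooth hk.hasCompactSupport hh (hu j)
  have hzs : ∀ j, ContDiff ℝ ∞ (z j) := fun j => (hu j).sub (hvs j)
  have hpt : ∀ x ∈ {x | 2 * τ ≤ ρ x}, ENNReal.ofReal (∑ i, ∑ j, partialD i (u j) x ^ 2) ≤
      3 * ENNReal.ofReal (∑ i, ∑ j, partialD i (z j) x ^ 2) +
      3 * (∑ i, ∑ j, ENNReal.ofReal (varAvg φ h (partialD i (u j)) x ^ 2)) +
      ENNReal.ofReal (3 * n ^ 2 * (n * (3 * C)) ^ 2 * ballAvg h u x ^ 2) := by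
    intro x hx
    have hhx : 0 < h x := hTS hx
    have hsum : ∑ i, ∑ j, ENNReal.ofReal (varAvg φ h (partialD i (u j)) x ^ 2) =
        ENNReal.ofReal (∑ i, ∑ j, varAvg φ h (partialD i (u j)) x ^ 2) := by
      rw [ENNReal.ofReal_sum_of_nonneg fun i _ => Finset.sum_nonneg fun j _ => sq_nonneg _]
      refine Finset.sum_congr rfl fun i _ => ?_
      rw [ENNReal.ofReal_sum_of_nonneg fun j _ => sq_nonneg _]
    have hn1 : 0 ≤ ∑ i, ∑ j, partialD i (z j) x ^ 2 :=
      Finset.sum_nonneg fun _ _ => Finset.sum_nonneg fun _ _ => sq_nonneg _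
    have hn2 : 0 ≤ ∑ i, ∑ j, varAvg φ h (partialD i (u j)) x ^ 2 :=
      Finset.sum_nonneg fun _ _ => Finset.sum_nonneg fun _ _ => sq_nonneg _
    rw [hsum, show (3 : ENNReal) = ENNReal.ofReal 3 by simp, ← ENNReal.ofReal_mul (by norm_num),
      ← ENNReal.ofReal_mul (by norm_num), ← ENNReal.ofReal_add (by positivity) (by positivity),
      ← ENNReal.ofReal_add (by positivity) (by positivity)]
    refine ENNReal.ofReal_le_ofReal ?_
    -- The gradient of `u` is the gradient of `z`, plus the averaged gradient, plus the commutator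
    -- of differentiation and averaging. The three parts are bounded by Korn's first inequality, by
    -- Hardy's inequality and pointwise, respectively.
    have hb : ∀ i j, partialD i (u j) x ^ 2 ≤ 3 * partialD i (z j) x ^ 2 +
        3 * varAvg φ h (partialD i (u j)) x ^ 2 + 3 * (n * (3 * C) * ballAvg h u x) ^ 2 := by
      intro i j
      have h1 := abs_partialD_varAvg_sub_le hk hu hh hK i j hhx.ne'
      have h2 : partialD i (z j) x = _ := partialD_sub_apply (hu j) (hvs j) i x
      have hA : 0 ≤ n * (3 * C) * ballAvg h u x := by
        have := ballAvg_nonneg h u x; positivity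
      have h3 : |partialD i (varAvg φ h (u j)) x - varAvg φ h (partialD i (u j)) x| ≤
          n * (3 * C) * ballAvg h u x := by linarith
      have h4 := pow_le_pow_left₀ (abs_nonneg _) h3 2
      rw [sq_abs] at h4
      set a := partialD i (z j) x
      set b := varAvg φ h (partialD i (u j)) x
      set d := partialD i (varAvg φ h (u j)) x - b with hd
      have h5 : partialD i (u j) x = a + b + d := by rw [h2]; ring
      rw [h5]
      nlinarith [sq_nonneg (a - b), sq_nonneg (b - d), sq_nonneg (a - d)]
    calc ∑ i, ∑ j, partialD i (u j) x ^ 2 ≤ ∑ i, ∑ j, (3 * partialD i (z j) x ^ 2 +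
          3 * varAvg φ h (partialD i (u j)) x ^ 2 + 3 * (n * (3 * C) * ballAvg h u x) ^ 2) :=
          Finset.sum_le_sum fun i _ => Finset.sum_le_sum fun j _ => hb i j
      _ = _ := by
        simp only [Finset.sum_add_distrib, ← Finset.mul_sum, Finset.sum_const, Finset.card_univ,
          Fintype.card_fin, nsmul_eq_mul]
        ring
  have hm1 : Measurable fun x => ENNReal.ofReal (∑ i, ∑ j, partialD i (z j) x ^ 2) := by
    refine (ENNReal.continuous_ofReal.comp ?_).measurable
    exact continuous_finsetSum _ fun i _ => continuous_finsetSum _ fun j _ =>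
      (contDiff_partialD (hzs j) i).continuous.pow 2
  have hm2 : ∀ i j, Measurable fun x => ENNReal.ofReal (varAvg φ h (partialD i (u j)) x ^ 2) :=
    fun i j => (ENNReal.continuous_ofReal.comp ((contDiff_varAvg hk.smooth hk.hasCompactSupport hh
      (contDiff_partialD (hu j) i)).continuous.pow 2)).measurable
  have hm3 : Measurable fun x =>
      ∑ i, ∑ j, ENNReal.ofReal (varAvg φ h (partialD i (u j)) x ^ 2) :=
    Finset.measurable_fun_sum _ fun i _ => Finset.measurable_fun_sum _ fun j _ => hm2 i j
  calc ∫⁻ x in {x | 2 * τ ≤ ρ x}, ENNReal.ofReal (∑ i, ∑ j, partialD i (u j) x ^ 2)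
      ≤ ∫⁻ x in {x | 2 * τ ≤ ρ x}, (3 * ENNReal.ofReal (∑ i, ∑ j, partialD i (z j) x ^ 2) +
      3 * (∑ i, ∑ j, ENNReal.ofReal (varAvg φ h (partialD i (u j)) x ^ 2)) +
      ENNReal.ofReal (3 * n ^ 2 * (n * (3 * C)) ^ 2 * ballAvg h u x ^ 2)) :=
        setLIntegral_mono' hTm hpt
    _ = 3 * (∫⁻ x in {x | 2 * τ ≤ ρ x}, ENNReal.ofReal (∑ i, ∑ j, partialD i (z j) x ^ 2)) +
        3 * (∑ i, ∑ j, ∫⁻ x in {x | 2 * τ ≤ ρ x},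
          ENNReal.ofReal (varAvg φ h (partialD i (u j)) x ^ 2)) +
        ENNReal.ofReal (3 * n ^ 2 * (n * (3 * C)) ^ 2) *
          ∫⁻ x in {x | 2 * τ ≤ ρ x}, ENNReal.ofReal (ballAvg h u x ^ 2) := by
        have hm13 : Measurable fun x => 3 * ENNReal.ofReal (∑ i, ∑ j, partialD i (z j) x ^ 2) +
            3 * (∑ i, ∑ j, ENNReal.ofReal (varAvg φ h (partialD i (u j)) x ^ 2)) :=
          (hm1.const_mul 3).add (hm3.const_mul 3)
        rw [lintegral_add_left hm13,
          lintegral_add_left (hm1.const_mul 3), lintegral_const_mul _ hm1,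
          lintegral_const_mul _ hm3, setLIntegral_ofReal_const_mul (by positivity),
          lintegral_finsetSum _ fun i _ => Finset.measurable_fun_sum _ fun j _ => hm2 i j]
        simp_rw [lintegral_finsetSum Finset.univ fun j _ => hm2 _ j]
    _ ≤ 3 * (ENNReal.ofReal (4 * n ^ 2) * N2 +
          ENNReal.ofReal (4 * n ^ 2 * ((1 + 3 * n) * C) ^ 2) * A2) +
        3 * (∑ _i : Fin n, ∑ _j : Fin n, ENNReal.ofReal (4 * (n * (6 * C) / c) ^ 2) * A2) +
        ENNReal.ofReal (3 * n ^ 2 * (n * (3 * C)) ^ 2) * A2 := by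
        gcongr with i _ j _
        · exact (setLIntegral_le_lintegral _ _).trans L1
        · exact L2 i j
        · exact lintegral_mono_set hTS
    _ = 3 * ENNReal.ofReal (4 * n ^ 2) * N2 +
        (3 * ENNReal.ofReal (4 * n ^ 2 * ((1 + 3 * n) * C) ^ 2) +
        3 * (n * (n * ENNReal.ofReal (4 * (n * (6 * C) / c) ^ 2))) +
        ENNReal.ofReal (3 * n ^ 2 * (n * (3 * C)) ^ 2)) * A2 := by
        simp only [Finset.sum_const, Finset.card_univ, Fintype.card_fin, nsmul_eq_mul]
        ring
    _ ≤ 3 * ENNReal.ofReal (4 * n ^ 2) * (ENNReal.ofReal (n ^ 2) * G) +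
        (3 * ENNReal.ofReal (4 * n ^ 2 * ((1 + 3 * n) * C) ^ 2) +
        3 * (n * (n * ENNReal.ofReal (4 * (n * (6 * C) / c) ^ 2))) +
        ENNReal.ofReal (3 * n ^ 2 * (n * (3 * C)) ^ 2)) *
        (2 * volume (Metric.closedBall (0 : EuclideanSpace ℝ (Fin n)) 1) ^ 2 *
          (ENNReal.ofReal (n ^ 2) * G)) := by
        gcongr
        exact L3.trans (by gcongr)
    _ = _ := by ring

/-- Korn's inequality for smooth fields on a supergraph `{ρ > 0}`, with a constant that depends
on the Lipschitz constant of `ρ` only. -/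
theorem exists_korn_constant (n : ℕ) [NeZero n] {M : ℝ} (hM : 1 ≤ M) : ∃ K : ENNReal, K ≠ ⊤ ∧
    ∀ (u : Fin n → EuclideanSpace ℝ (Fin n) → ℝ) (ρ : EuclideanSpace ℝ (Fin n) → ℝ)
      (ν : EuclideanSpace ℝ (Fin n)), (∀ j, ContDiff ℝ ∞ (u j)) → (∀ j, HasCompactSupport (u j)) →
      ContDiff ℝ ∞ ρ → (∀ x, ‖fderiv ℝ ρ x‖ ≤ M) → ‖ν‖ ≤ 1 → (∀ x, fderiv ℝ ρ x ν = 1) →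
      ∫⁻ x in {x | 0 < ρ x}, ENNReal.ofReal (∑ i, ∑ j, partialD i (u j) x ^ 2) ≤
        K * ∫⁻ x in {x | 0 < ρ x}, ENNReal.ofReal (∑ i, ∑ j, symGrad u i j x ^ 2) := by
  obtain ⟨φ, ψ, C, hC0, hk⟩ := exists_isRadialKernel n
  obtain ⟨L, hL1, hL⟩ := exists_bound_deriv_mul_smoothTransition
  -- Chosen so that `|∇h| ≤ cLM = 1/2` for the scale used below, whatever `τ` is.
  set c : ℝ := 1 / (2 * L * M) with hc
  have hLpos : 0 < L := by linarith
  have hMpos : 0 < M := by linarith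
  have hcpos : 0 < c := by positivity
  refine ⟨(3 * ENNReal.ofReal (4 * n ^ 2) +
      (3 * ENNReal.ofReal (4 * n ^ 2 * ((1 + 3 * n) * C) ^ 2) +
        3 * (n * (n * ENNReal.ofReal (4 * (n * (6 * C) / c) ^ 2))) +
        ENNReal.ofReal (3 * n ^ 2 * (n * (3 * C)) ^ 2)) *
        (2 * volume (Metric.closedBall (0 : EuclideanSpace ℝ (Fin n)) 1) ^ 2)) *
          ENNReal.ofReal (n ^ 2), ?_, fun u ρ ν hu huc hρ hρM hν hρν => ?_⟩
  rotate_left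
  -- The scale is `cτf(ρ/τ)` with `f(t) = t · smoothTransition t`: smooth, zero for `ρ ≤ 0` and
  -- equal to `cρ` for `ρ ≥ τ`. The constant obtained does not involve `τ`, so `τ → 0` exhausts `{ρ
  -- > 0}` by monotone convergence.
  · have key := fun (τ : ℝ) (hτ : 0 < τ) => lintegral_gradient_le_of_scale hC0 hk hcpos hu huc
      (h := fun x => c * (τ * (ρ x / τ * Real.smoothTransition (ρ x / τ)))) (ρ := ρ) (τ := τ)
      (by
        have : ContDiff ℝ ∞ Real.smoothTransition := Real.smoothTransition.contDiff (n := ⊤)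
        fun_prop)
      (fun x => by
        have h1 := (hρ.differentiable (by simp) x).hasFDerivAt
        have h2 : HasFDerivAt (fun x => ρ x / τ) (τ⁻¹ • fderiv ℝ ρ x) x := by
          simpa [div_eq_mul_inv] using h1.mul_const τ⁻¹
        have h3 : DifferentiableAt ℝ (fun t => t * Real.smoothTransition t) (ρ x / τ) := by
          have : ContDiff ℝ 1 fun t => t * Real.smoothTransition t :=
            contDiff_id.mul (Real.smoothTransition.contDiff (n := 1))
          exact this.differentiable one_ne_zero _
        have h4 := ((h3.hasDerivAt.comp_hasFDerivAt x h2).const_mul τ).const_mul c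
        have h5 : fderiv ℝ (fun x => c * (τ * (ρ x / τ * Real.smoothTransition (ρ x / τ)))) x = _ :=
          h4.fderiv
        rw [h5, smul_smul, smul_smul, smul_smul, norm_smul]
        have h6 : c * (τ * deriv (fun t => t * Real.smoothTransition t) (ρ x / τ) * τ⁻¹) =
            c * deriv (fun t => t * Real.smoothTransition t) (ρ x / τ) := by
          field_simp
        rw [show c * τ * deriv (fun t => t * Real.smoothTransition t) (ρ x / τ) * τ⁻¹ =
          c * deriv (fun t => t * Real.smoothTransition t) (ρ x / τ) by field_simp,
          Real.norm_eq_abs, abs_mul, abs_of_pos hcpos]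
        calc c * |deriv (fun t => t * Real.smoothTransition t) (ρ x / τ)| * ‖fderiv ℝ ρ x‖
            ≤ c * L * M := by gcongr; exacts [hL _, hρM x]
          _ = 1 / 2 := by rw [hc]; field_simp)
      (fun x => by
        rcases le_total (ρ x) 0 with h | h
        · simp [Real.smoothTransition.zero_of_nonpos (div_nonpos_of_nonpos_of_nonneg h hτ.le)]
        · have := Real.smoothTransition.nonneg (ρ x / τ)
          positivity)
      hρ hν hρν
      (fun x => by
        rcases le_or_gt (ρ x) 0 with h | h
        · simp [Real.smoothTransition.zero_of_nonpos (div_nonpos_of_nonpos_of_nonneg h hτ.le),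
            not_lt.2 h]
        · have := Real.smoothTransition.pos_of_pos (div_pos h hτ)
          exact ⟨fun _ => h, fun _ => by positivity⟩)
      hτ
      (fun x hx => by
        rw [Real.smoothTransition.one_of_one_le ((one_le_div hτ).2 hx)]
        field_simp)
    have hun : {x | 0 < ρ x} = ⋃ m : ℕ, {x | 2 * (1 / ((m : ℝ) + 1)) ≤ ρ x} := by
      ext x
      simp only [Set.mem_ofPred_eq, Set.mem_iUnion]
      constructor
      · intro hx
        obtain ⟨m, hm⟩ := exists_nat_one_div_lt (show 0 < ρ x / 2 by linarith)
        exact ⟨m, by linarith⟩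
      · rintro ⟨m, hm⟩
        have : (0 : ℝ) < 1 / ((m : ℝ) + 1) := by positivity
        linarith
    rw [hun]
    rw [setLIntegral_iUnion_of_directed]
    · rw [← hun]
      exact iSup_le fun m => key (1 / ((m : ℝ) + 1)) (by positivity)
    · refine Monotone.directed_le fun a b hab x hx => ?_
      have hx' : 2 * (1 / ((a : ℝ) + 1)) ≤ ρ x := hx
      have : 1 / ((b : ℝ) + 1) ≤ 1 / ((a : ℝ) + 1) := by gcongr
      change 2 * (1 / ((b : ℝ) + 1)) ≤ ρ x
      linarith
  · have : volume (Metric.closedBall (0 : EuclideanSpace ℝ (Fin n)) 1) ≠ ⊤ :=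
      (isCompact_closedBall 0 1).measure_lt_top.ne
    finiteness

end SmoothKorn

/-! ### Mollification -/

section Mollify

variable {E : Type*} [NormedAddCommGroup E] [NormedSpace ℝ E] [FiniteDimensional ℝ E]
  [MeasurableSpace E] [BorelSpace E] {μ : Measure E} [μ.IsAddHaarMeasure] [HasContDiffBump E]

/-- `g` is the weak derivative of `f` in the direction `v` on the open set `O`. -/
def HasWeakDeriv (μ : Measure E) (O : Set E) (v : E) (f g : E → ℝ) : Prop :=
  ∀ η : E → ℝ, ContDiff ℝ ∞ η → HasCompactSupport η → tsupport η ⊆ O →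
    ∫ x, f x * fderiv ℝ η x v ∂μ = - ∫ x, g x * η x ∂μ

/-- The convolution of `f` with a normalised bump function. -/
noncomputable def mollify (μ : Measure E) (φ : ContDiffBump (0 : E)) (f : E → ℝ) (x : E) : ℝ :=
  ∫ y, φ.normed μ (x - y) * f y ∂μ

lemma mollify_eq_convolution (φ : ContDiffBump (0 : E)) (f : E → ℝ) :
    mollify μ φ f = convolution (φ.normed μ) f (ContinuousLinearMap.lsmul ℝ ℝ) μ := by
  ext x
  rw [convolution_lsmul_swap]
  rfl

lemma mollify_eq_convolution' (φ : ContDiffBump (0 : E)) (f : E → ℝ) :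
    mollify μ φ f = convolution f (φ.normed μ) (ContinuousLinearMap.mul ℝ ℝ) μ := by
  ext x
  simp [mollify, convolution, mul_comm]

variable {φ : ContDiffBump (0 : E)} {f g : E → ℝ}

lemma contDiff_mollify (hf : LocallyIntegrable f μ) : ContDiff ℝ ∞ (mollify μ φ f) := by
  rw [mollify_eq_convolution]
  exact φ.hasCompactSupport_normed.contDiff_convolution_left _ (n := ⊤) φ.contDiff_normed hf

lemma hasCompactSupport_mollify (hf : HasCompactSupport f) :
    HasCompactSupport (mollify μ φ f) := by
  rw [mollify_eq_convolution]
  exact φ.hasCompactSupport_normed.convolution _ hf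

lemma normed_eq_zero {x : E} (hx : φ.rOut ≤ ‖x‖) : φ.normed μ x = 0 := by
  have : x ∉ Function.support (φ.normed μ) := by
    rw [φ.support_normed_eq]; simpa using hx
  simpa using this

lemma integrable_normed_mul (hf : LocallyIntegrable f μ) (x : E) :
    Integrable (fun y => φ.normed μ (x - y) * f y) μ := by
  have hc : HasCompactSupport fun y => φ.normed μ (x - y) :=
    φ.hasCompactSupport_normed.comp_homeomorph (Homeomorph.subLeft x)
  have hcont : Continuous fun y => φ.normed μ (x - y) :=
    φ.continuous_normed.comp (continuous_const.sub continuous_id)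
  exact hf.integrable_smul_left_of_hasCompactSupport hcont hc

lemma integral_normed_sub (x : E) : ∫ y, φ.normed μ (x - y) ∂μ = 1 := by
  rw [integral_sub_left_eq_self (fun y => φ.normed μ y) μ x, φ.integral_normed]

/-- A mollified function has the mollified weak derivative, away from the boundary. -/
lemma fderiv_mollify {O : Set E} {v : E} (hf : LocallyIntegrable f μ)
    (hw : HasWeakDeriv μ O v f g) {x : E} (hx : Metric.closedBall x φ.rOut ⊆ O) :
    fderiv ℝ (mollify μ φ f) x v = mollify μ φ g x := by
  have hns : ContDiff ℝ ∞ (φ.normed μ) := φ.contDiff_normed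
  have h1 := φ.hasCompactSupport_normed.hasFDerivAt_convolution_right
    (ContinuousLinearMap.mul ℝ ℝ) hf (hns.of_le (by simp)) x
  rw [mollify_eq_convolution', h1.fderiv, convolution_precompR_apply _ hf
    (φ.hasCompactSupport_normed.fderiv ℝ) (hns.continuous_fderiv (by simp))]
  have hη : ContDiff ℝ ∞ fun y => φ.normed μ (x - y) := hns.comp (contDiff_const.sub contDiff_id)
  have hηc : HasCompactSupport fun y => φ.normed μ (x - y) :=
    φ.hasCompactSupport_normed.comp_homeomorph (Homeomorph.subLeft x)
  have hsub : tsupport (fun y => φ.normed μ (x - y)) ⊆ O := by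
    refine (closure_minimal (fun y hy => ?_) Metric.isClosed_closedBall).trans hx
    by_contra hcon
    refine hy (normed_eq_zero ?_)
    rw [Metric.mem_closedBall, dist_comm, dist_eq_norm] at hcon
    exact (not_le.1 hcon).le
  have hd : ∀ y, fderiv ℝ (fun y => φ.normed μ (x - y)) y v = - fderiv ℝ (φ.normed μ) (x - y) v := by
    intro y
    have h2 := (hns.differentiable (by simp) (x - y)).hasFDerivAt.comp y
      ((hasFDerivAt_id y).const_sub x)
    have h3 : fderiv ℝ (fun y => φ.normed μ (x - y)) y = _ := h2.fderiv
    rw [h3]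
    simp
  have key := hw _ hη hηc hsub
  simp only [hd, mul_neg, integral_neg, neg_inj] at key
  simp only [convolution, ContinuousLinearMap.mul_apply']
  rw [key]
  simp [mollify, mul_comm]

/-- Jensen's inequality for mollification, with a slowly varying weight. -/
lemma lintegral_mul_sq_mollify_le (hg : MemLp g 2 μ) {wt : E → ENNReal} (hwt : Measurable wt)
    {Λ : ENNReal} (hΛ : ∀ x y, ‖x - y‖ ≤ φ.rOut → wt x ≤ Λ * wt y) :
    ∫⁻ x, wt x * ENNReal.ofReal (mollify μ φ g x ^ 2) ∂μ ≤
      Λ * ∫⁻ x, wt x * ENNReal.ofReal (g x ^ 2) ∂μ := by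
  have hgl : LocallyIntegrable g μ := hg.locallyIntegrable (by norm_num)
  have hg2 : LocallyIntegrable (fun y => g y ^ 2) μ := hg.integrable_sq.locallyIntegrable
  have hpt : ∀ x, ENNReal.ofReal (mollify μ φ g x ^ 2) ≤
      ∫⁻ y, ENNReal.ofReal (φ.normed μ (x - y)) * ENNReal.ofReal (g y ^ 2) ∂μ := by
    intro x
    have hki : Integrable (fun y => φ.normed μ (x - y)) μ :=
      (φ.integrable_normed (μ := μ)).comp_sub_left x
    have h1 := sq_integral_mul_le (μ := μ) (g := g) (k := fun y => φ.normed μ (x - y))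
      (fun y => φ.nonneg_normed _) hki
      (by simpa only [mul_comm] using integrable_normed_mul hgl x)
      (by simpa only [mul_comm] using integrable_normed_mul hg2 x)
    rw [integral_normed_sub, one_mul] at h1
    have h2 : mollify μ φ g x = ∫ y, g y * φ.normed μ (x - y) ∂μ := by
      simp only [mollify, mul_comm]
    rw [h2]
    refine (ENNReal.ofReal_le_ofReal h1).trans ?_
    rw [ofReal_integral_eq_lintegral_ofReal
      (by simpa only [mul_comm] using integrable_normed_mul hg2 x)
      (Filter.Eventually.of_forall fun y => mul_nonneg (sq_nonneg _) (φ.nonneg_normed _))]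
    refine lintegral_mono fun y => le_of_eq ?_
    rw [ENNReal.ofReal_mul (sq_nonneg _), mul_comm]
  have hkm : Measurable fun p : E × E => ENNReal.ofReal (φ.normed μ (p.1 - p.2)) :=
    (ENNReal.continuous_ofReal.comp (φ.continuous_normed.comp
      (continuous_fst.sub continuous_snd))).measurable
  have hgm : AEMeasurable (fun y => ENNReal.ofReal (g y ^ 2)) μ :=
    (hg.aestronglyMeasurable.aemeasurable.pow_const 2).ennreal_ofReal
  have hkx : ∀ y, Measurable fun x => ENNReal.ofReal (φ.normed μ (x - y)) := fun y =>
    (ENNReal.continuous_ofReal.comp (φ.continuous_normed.comp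
      (continuous_id.sub continuous_const))).measurable
  have hk1 : ∀ y, ∫⁻ x, ENNReal.ofReal (φ.normed μ (x - y)) ∂μ = 1 := by
    intro y
    rw [lintegral_sub_right_eq_self (fun x => ENNReal.ofReal (φ.normed μ x)) y,
      ← ofReal_integral_eq_lintegral_ofReal φ.integrable_normed
        (Filter.Eventually.of_forall φ.nonneg_normed), φ.integral_normed, ENNReal.ofReal_one]
  calc ∫⁻ x, wt x * ENNReal.ofReal (mollify μ φ g x ^ 2) ∂μ
      ≤ ∫⁻ x, wt x * ∫⁻ y, ENNReal.ofReal (φ.normed μ (x - y)) * ENNReal.ofReal (g y ^ 2) ∂μ ∂μ :=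
        lintegral_mono fun x => mul_le_mul_right (hpt x) _
    _ ≤ ∫⁻ x, ∫⁻ y, ENNReal.ofReal (φ.normed μ (x - y)) *
          (Λ * (wt y * ENNReal.ofReal (g y ^ 2))) ∂μ ∂μ := by
        refine lintegral_mono fun x => ?_
        have hm : AEMeasurable
            (fun y => ENNReal.ofReal (φ.normed μ (x - y)) * ENNReal.ofReal (g y ^ 2)) μ :=
          (hkm.comp (measurable_const.prodMk measurable_id)).aemeasurable.mul hgm
        rw [← lintegral_const_mul'' _ hm]
        refine lintegral_mono fun y => ?_
        rcases le_or_gt φ.rOut ‖x - y‖ with h | h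
        · simp [normed_eq_zero h]
        · calc wt x * (ENNReal.ofReal (φ.normed μ (x - y)) * ENNReal.ofReal (g y ^ 2))
              ≤ (Λ * wt y) * (ENNReal.ofReal (φ.normed μ (x - y)) * ENNReal.ofReal (g y ^ 2)) :=
                mul_le_mul_left (hΛ x y h.le) _
            _ = _ := by ring
    _ = ∫⁻ y, ∫⁻ x, ENNReal.ofReal (φ.normed μ (x - y)) *
          (Λ * (wt y * ENNReal.ofReal (g y ^ 2))) ∂μ ∂μ := by
        rw [lintegral_lintegral_swap]
        refine hkm.aemeasurable.mul ?_
        exact ((hwt.aemeasurable.mul hgm).const_mul Λ).comp_snd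
    _ = ∫⁻ y, Λ * (wt y * ENNReal.ofReal (g y ^ 2)) ∂μ := by
        refine lintegral_congr fun y => ?_
        rw [lintegral_mul_const _ (hkx y), hk1, one_mul]
    _ = _ := lintegral_const_mul'' _ (hwt.aemeasurable.mul hgm)

lemma lintegral_sq_mollify_le (hg : MemLp g 2 μ) :
    ∫⁻ x, ENNReal.ofReal (mollify μ φ g x ^ 2) ∂μ ≤ ∫⁻ x, ENNReal.ofReal (g x ^ 2) ∂μ := by
  simpa using lintegral_mul_sq_mollify_le (φ := φ) hg (wt := fun _ => 1) measurable_const (Λ := 1)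
    (fun _ _ _ => by simp)

lemma abs_mollify_sub_le {M : ℝ} (hM : 0 ≤ M) (hf : ∀ x y, |f x - f y| ≤ M * ‖x - y‖)
    (hfc : Continuous f) (x : E) : |mollify μ φ f x - f x| ≤ M * φ.rOut := by
  rw [mollify_eq_convolution, ← Real.dist_eq]
  refine φ.dist_normed_convolution_le hfc.aestronglyMeasurable fun y hy => ?_
  rw [Real.dist_eq]
  refine (hf y x).trans ?_
  have : ‖y - x‖ < φ.rOut := by simpa [dist_eq_norm] using hy
  gcongr

lemma mollify_shift (x : E) : mollify μ φ f x = ∫ y, φ.normed μ y * f (x - y) ∂μ := by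
  rw [mollify, ← integral_sub_left_eq_self (fun y => φ.normed μ y * f (x - y)) μ x]
  simp

lemma integrable_normed_mul_shift (hf : Continuous f) (x : E) :
    Integrable (fun y => φ.normed μ y * f (x - y)) μ :=
  Continuous.integrable_of_hasCompactSupport
    (φ.continuous_normed.mul (hf.comp (continuous_const.sub continuous_id)))
    φ.hasCompactSupport_normed.mul_right

/-- An averaged inequality between `f` and its translate. Suitable choices of `a` and `v` show that
mollification keeps Lipschitz constants, monotonicity along a direction, and unit speed along `ν`.
-/
lemma mollify_add_const_le {a : ℝ} (hf : Continuous f) {v : E} (h : ∀ x, f x + a ≤ f (x + v))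
    (x : E) : mollify μ φ f x + a ≤ mollify μ φ f (x + v) := by
  rw [mollify_shift, mollify_shift]
  have : a = ∫ y, φ.normed μ y * a ∂μ := by rw [integral_mul_const, φ.integral_normed, one_mul]
  conv_lhs => rw [this]
  rw [← integral_add (integrable_normed_mul_shift hf x) (φ.integrable_normed.mul_const a)]
  refine integral_mono ((integrable_normed_mul_shift hf x).add (φ.integrable_normed.mul_const a))
    (integrable_normed_mul_shift hf _) fun y => ?_
  simp only
  rw [← mul_add, add_sub_right_comm]
  exact mul_le_mul_of_nonneg_left (h _) (φ.nonneg_normed y)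

lemma mollify_lipschitz {M : ℝ} (hf : ∀ x y, |f x - f y| ≤ M * ‖x - y‖) (hfc : Continuous f)
    (x y : E) : |mollify μ φ f x - mollify μ φ f y| ≤ M * ‖x - y‖ := by
  have h1 : ∀ z, f z + -(M * ‖x - y‖) ≤ f (z + (y - x)) := fun z => by
    have := (abs_le.1 (hf z (z + (y - x)))).2
    rw [sub_add_cancel_left, norm_neg, norm_sub_rev y x] at this
    linarith
  have h2 : ∀ z, f z + -(M * ‖x - y‖) ≤ f (z + (x - y)) := fun z => by
    have := (abs_le.1 (hf z (z + (x - y)))).2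
    rw [sub_add_cancel_left, norm_neg] at this
    linarith
  have h3 := mollify_add_const_le (μ := μ) (φ := φ) hfc h1 x
  have h4 := mollify_add_const_le (μ := μ) (φ := φ) hfc h2 y
  rw [add_sub_cancel] at h3 h4
  rw [abs_le]
  constructor <;> linarith

lemma continuous_of_abs_sub_le {M : ℝ} (hf : ∀ x y, |f x - f y| ≤ M * ‖x - y‖) : Continuous f := by
  refine (LipschitzWith.of_dist_le_mul (K := M.toNNReal) fun x y => ?_).continuous
  rw [Real.dist_eq, dist_eq_norm]
  exact (hf x y).trans (mul_le_mul_of_nonneg_right (Real.le_coe_toNNReal M) (norm_nonneg _))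

lemma norm_fderiv_mollify_le {M : ℝ} (hM : 0 ≤ M) (hf : ∀ x y, |f x - f y| ≤ M * ‖x - y‖) (x : E) :
    ‖fderiv ℝ (mollify μ φ f) x‖ ≤ M := by
  have := norm_fderiv_le_of_lipschitz ℝ (f := mollify μ φ f) (x₀ := x) (C := ⟨M, hM⟩)
    (LipschitzWith.of_dist_le_mul fun x y => by
      rw [Real.dist_eq, dist_eq_norm]
      exact mollify_lipschitz hf (continuous_of_abs_sub_le hf) x y)
  exact this

lemma fderiv_mollify_nonneg {d : E} (hf : Continuous f) (h : ∀ x, ∀ t : ℝ, 0 ≤ t → f x ≤ f (x + t • d))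
    (x : E) : 0 ≤ fderiv ℝ (mollify μ φ f) x d := by
  have hd : DifferentiableAt ℝ (mollify μ φ f) x :=
    (contDiff_mollify hf.locallyIntegrable).differentiable (by simp) x
  have h1 : HasDerivAt (fun t : ℝ => mollify μ φ f (x + t • d)) (fderiv ℝ (mollify μ φ f) x d) 0 :=
    hd.hasFDerivAt.hasLineDerivAt d
  have hm : Monotone fun t : ℝ => mollify μ φ f (x + t • d) := by
    intro s t hst
    have := mollify_add_const_le (μ := μ) (φ := φ) (a := 0) (v := (t - s) • d) hf
      (fun z => by simpa using h z (t - s) (sub_nonneg.2 hst)) (x + s • d)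
    rwa [add_zero, add_assoc, ← add_smul, add_sub_cancel] at this
  rw [← h1.deriv]
  exact hm.deriv_nonneg

lemma fderiv_mollify_eq_one {ν : E} (hf : Continuous f) (h : ∀ x, ∀ t : ℝ, f (x + t • ν) = f x + t)
    (x : E) : fderiv ℝ (mollify μ φ f) x ν = 1 := by
  have hd : DifferentiableAt ℝ (mollify μ φ f) x :=
    (contDiff_mollify hf.locallyIntegrable).differentiable (by simp) x
  have h1 : HasDerivAt (fun t : ℝ => mollify μ φ f (x + t • ν)) (fderiv ℝ (mollify μ φ f) x ν) 0 :=
    hd.hasFDerivAt.hasLineDerivAt ν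
  have h2 : (fun t : ℝ => mollify μ φ f (x + t • ν)) = fun t => mollify μ φ f x + t := by
    ext t
    apply le_antisymm
    · have := mollify_add_const_le (μ := μ) (φ := φ) (a := -t) (v := -(t • ν)) hf
        (fun z => by
          have := h z (-t)
          rw [neg_smul] at this
          exact this.ge) (x + t • ν)
      rw [add_neg_cancel_right] at this
      linarith
    · exact mollify_add_const_le hf (fun z => (h z t).ge) x
  rw [h2] at h1
  exact h1.unique ((hasDerivAt_id (0 : ℝ)).const_add _)

/-- Bump functions shrinking to the origin. -/
noncomputable def shrinkingBump (E : Type*) [NormedAddCommGroup E] (m : ℕ) :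
    ContDiffBump (0 : E) where
  rIn := 1 / ((m : ℝ) + 1)
  rOut := 2 * (1 / ((m : ℝ) + 1))
  rIn_pos := by positivity
  rIn_lt_rOut := by
    have : (0 : ℝ) < 1 / ((m : ℝ) + 1) := by positivity
    linarith

lemma tendsto_rOut_shrinkingBump :
    Filter.Tendsto (fun m => (shrinkingBump E m).rOut) Filter.atTop (nhds 0) := by
  have := (tendsto_one_div_add_atTop_nhds_zero_nat (𝕜 := ℝ)).const_mul 2
  rwa [mul_zero] at this

lemma ae_tendsto_mollify (hf : LocallyIntegrable f μ) :
    ∀ᵐ x ∂μ, Filter.Tendsto (fun m => mollify μ (shrinkingBump E m) f x) Filter.atTop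
      (nhds (f x)) := by
  simp_rw [mollify_eq_convolution]
  exact ContDiffBump.ae_convolution_tendsto_right_of_locallyIntegrable tendsto_rOut_shrinkingBump
    (Filter.Eventually.of_forall fun m => le_refl (2 * (shrinkingBump E m).rIn)) hf

/-- Fatou's lemma, in the form that transfers uniform bounds for mollified quantities to their
limit. -/
lemma setLIntegral_le_of_tendsto {a : ℕ → E → ENNReal} {b : E → ENNReal} {S : Set E}
    (hS : MeasurableSet S) {B : ENNReal} (ha : ∀ m, Measurable (a m))
    (hlim : ∀ᵐ x ∂μ, x ∈ S → Filter.Tendsto (fun m => a m x) Filter.atTop (nhds (b x)))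
    (hB : ∀ᶠ m in Filter.atTop, ∫⁻ x, a m x ∂μ ≤ B) : ∫⁻ x in S, b x ∂μ ≤ B := by
  calc ∫⁻ x in S, b x ∂μ
      ≤ ∫⁻ x, Filter.liminf (fun m => a m x) Filter.atTop ∂μ := by
        rw [← lintegral_indicator hS]
        refine lintegral_mono_ae ?_
        filter_upwards [hlim] with x hx
        by_cases h : x ∈ S
        · rw [Set.indicator_of_mem h, (hx h).liminf_eq]
        · rw [Set.indicator_of_notMem h]; exact zero_le
    _ ≤ Filter.liminf (fun m => ∫⁻ x, a m x ∂μ) Filter.atTop := lintegral_liminf_le ha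
    _ ≤ B := Filter.liminf_le_of_frequently_le' hB.frequently

end Mollify

/-! ### The weighted Poincaré inequality and Korn's inequality for weak derivatives -/

section WeakInequalities

lemma hasCompactSupport_of_forall_norm {E : Type*} [NormedAddCommGroup E] [NormedSpace ℝ E]
    [FiniteDimensional ℝ E] {f : E → ℝ} {R : ℝ} (h : ∀ x, R < ‖x‖ → f x = 0) :
    HasCompactSupport f := by
  refine HasCompactSupport.of_support_subset_isCompact (isCompact_closedBall 0 R) fun x hx => ?_
  by_contra hcon
  exact hx (h x (by simpa using hcon))

variable {E : Type*} [NormedAddCommGroup E] [NormedSpace ℝ E] [FiniteDimensional ℝ E]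
  [MeasurableSpace E] [BorelSpace E] {μ : Measure E} [μ.IsAddHaarMeasure] [HasContDiffBump E]

/-- Smooth minorants of a Lipschitz function. -/
noncomputable def smoothMinorant (μ : Measure E) (M : ℝ) (ρ : E → ℝ) (m : ℕ) (x : E) : ℝ :=
  mollify μ (shrinkingBump E m) ρ x - 2 * (M * (shrinkingBump E m).rOut)

variable {M : ℝ} {ρ : E → ℝ}

lemma contDiff_smoothMinorant (hρ : ∀ x y, |ρ x - ρ y| ≤ M * ‖x - y‖) (m : ℕ) :
    ContDiff ℝ ∞ (smoothMinorant μ M ρ m) :=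
  (contDiff_mollify (continuous_of_abs_sub_le hρ).locallyIntegrable).sub contDiff_const

lemma fderiv_smoothMinorant (m : ℕ) (x : E) :
    fderiv ℝ (smoothMinorant μ M ρ m) x = fderiv ℝ (mollify μ (shrinkingBump E m) ρ) x := by
  unfold smoothMinorant
  rw [fderiv_sub_const]

/-- Of the amount `2M·rOut` subtracted in `smoothMinorant`, one half pays for the error of
mollification and the other for the variation of `ρ` over the ball. On the set where the minorant is
positive, mollified fields thus use the weak derivative inside `{ρ > 0}` only. -/
lemma closedBall_subset_of_smoothMinorant_pos (hM : 0 ≤ M)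
    (hρ : ∀ x y, |ρ x - ρ y| ≤ M * ‖x - y‖) {m : ℕ} {x : E} (hx : 0 < smoothMinorant μ M ρ m x) :
    Metric.closedBall x (shrinkingBump E m).rOut ⊆ {x | 0 < ρ x} := by
  intro y hy
  have h1 := (abs_le.1 (abs_mollify_sub_le (μ := μ) (φ := shrinkingBump E m) hM hρ
    (continuous_of_abs_sub_le hρ) x)).2
  have h2 := (abs_le.1 (hρ x y)).2
  have h3 : ‖x - y‖ ≤ (shrinkingBump E m).rOut := by
    rwa [Metric.mem_closedBall, dist_comm, dist_eq_norm] at hy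
  have h4 := mul_le_mul_of_nonneg_left h3 hM
  unfold smoothMinorant at hx
  change 0 < ρ y
  linarith

lemma tendsto_smoothMinorant (hM : 0 ≤ M) (hρ : ∀ x y, |ρ x - ρ y| ≤ M * ‖x - y‖) (x : E) :
    Filter.Tendsto (fun m => smoothMinorant μ M ρ m x) Filter.atTop (nhds (ρ x)) := by
  have h0 : Filter.Tendsto (fun m => 3 * (M * (shrinkingBump E m).rOut)) Filter.atTop (nhds 0) := by
    simpa using ((tendsto_rOut_shrinkingBump (E := E)).const_mul M).const_mul 3
  rw [tendsto_iff_dist_tendsto_zero]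
  refine squeeze_zero (fun _ => dist_nonneg) (fun m => ?_) h0
  have h1 := abs_le.1 (abs_mollify_sub_le (μ := μ) (φ := shrinkingBump E m) hM hρ
    (continuous_of_abs_sub_le hρ) x)
  have h2 : 0 ≤ M * (shrinkingBump E m).rOut := mul_nonneg hM (shrinkingBump E m).rOut_pos.le
  rw [Real.dist_eq, abs_le]
  unfold smoothMinorant
  constructor <;> linarith [h1.1, h1.2]

/-- A weighted Poincaré inequality for smooth functions; the weight `χ` does not decrease in the
direction `d`, and the exponential weight grows in this direction. -/
lemma smooth_poincare {F χ : E → ℝ} (hF : ContDiff ℝ 1 F) (hFc : HasCompactSupport F)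
    (hχ : ContDiff ℝ 1 χ) (hχ0 : ∀ x, 0 ≤ χ x) {d : E} (hχd : ∀ x, 0 ≤ fderiv ℝ χ x d)
    {ℓ : E →L[ℝ] ℝ} (hℓ : ℓ d = 1) {l : ℝ} (hl : 0 < l) :
    l ^ 2 * ∫ x, χ x * (Real.exp (l * ℓ x) * F x ^ 2) ∂μ ≤
      4 * ∫ x, χ x * (Real.exp (l * ℓ x) * fderiv ℝ F x d ^ 2) ∂μ := by
  have hdF := continuous_fderiv_dir hF d
  have hdχ := continuous_fderiv_dir hχ d
  have cF := hF.continuous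
  have cχ := hχ.continuous
  have hexp : ContDiff ℝ 1 fun x => Real.exp (l * ℓ x) := by fun_prop
  -- Its derivative along `d` has integral zero. Differentiating the exponential yields the good
  -- term with the factor `l`, and the term with `∂_dχ ≥ 0`, which represents the lateral boundary,
  -- may be dropped.
  have hG : ContDiff ℝ 1 fun x => χ x * (Real.exp (l * ℓ x) * F x ^ 2) :=
    hχ.mul (hexp.mul (hF.pow 2))
  have hF2c : HasCompactSupport fun x => F x ^ 2 :=
    hFc.comp_left (g := fun t : ℝ => t ^ 2) (by simp)
  have hdF2c : HasCompactSupport fun x => fderiv ℝ F x d ^ 2 :=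
    (hasCompactSupport_fderiv_dir hFc d).comp_left (g := fun t : ℝ => t ^ 2) (by simp)
  have h0 := integral_fderiv_dir (μ := μ) hG hF2c.mul_left.mul_left d
  have hder : ∀ x, fderiv ℝ (fun x => χ x * (Real.exp (l * ℓ x) * F x ^ 2)) x d =
      fderiv ℝ χ x d * (Real.exp (l * ℓ x) * F x ^ 2) +
        (l * (χ x * (Real.exp (l * ℓ x) * F x ^ 2)) +
        2 * (χ x * (Real.exp (l * ℓ x) * fderiv ℝ F x d * F x))) := by
    intro x
    have h1 := (hF.differentiable one_ne_zero x).hasFDerivAt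
    have h2 := (hχ.differentiable one_ne_zero x).hasFDerivAt
    have h3 : HasFDerivAt (fun x => l * ℓ x) (l • ℓ) x := ℓ.hasFDerivAt.const_mul l
    have h4 : HasFDerivAt (fun x => χ x * (Real.exp (l * ℓ x) * F x ^ 2)) _ x :=
      h2.mul (h3.exp.mul (h1.pow 2))
    rw [h4.fderiv]
    simp [hℓ]
    ring
  simp_rw [hder] at h0
  have i1 : Integrable (fun x => fderiv ℝ χ x d * (Real.exp (l * ℓ x) * F x ^ 2)) μ :=
    Continuous.integrable_of_hasCompactSupport (by fun_prop) hF2c.mul_left.mul_left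
  have i2 : Integrable (fun x => χ x * (Real.exp (l * ℓ x) * F x ^ 2)) μ :=
    Continuous.integrable_of_hasCompactSupport (by fun_prop) hF2c.mul_left.mul_left
  have i3 : Integrable (fun x => χ x * (Real.exp (l * ℓ x) * fderiv ℝ F x d * F x)) μ :=
    Continuous.integrable_of_hasCompactSupport (by fun_prop) hFc.mul_left.mul_left
  have i4 : Integrable (fun x => χ x * (Real.exp (l * ℓ x) * fderiv ℝ F x d ^ 2)) μ :=
    Continuous.integrable_of_hasCompactSupport (by fun_prop) hdF2c.mul_left.mul_left
  have i23 : Integrable (fun x => l * (χ x * (Real.exp (l * ℓ x) * F x ^ 2)) +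
        2 * (χ x * (Real.exp (l * ℓ x) * fderiv ℝ F x d * F x))) μ :=
    (i2.const_mul l).add (i3.const_mul 2)
  rw [integral_add i1 i23, integral_add (i2.const_mul l) (i3.const_mul 2), integral_const_mul,
    integral_const_mul] at h0
  have hpos : 0 ≤ ∫ x, fderiv ℝ χ x d * (Real.exp (l * ℓ x) * F x ^ 2) ∂μ :=
    integral_nonneg fun x => mul_nonneg (hχd x) (by positivity)
  have hpt : ∫ x, -(2 * l * (χ x * (Real.exp (l * ℓ x) * fderiv ℝ F x d * F x))) ∂μ ≤
      ∫ x, (l ^ 2 / 2 * (χ x * (Real.exp (l * ℓ x) * F x ^ 2)) +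
        2 * (χ x * (Real.exp (l * ℓ x) * fderiv ℝ F x d ^ 2))) ∂μ := by
    refine integral_mono (i3.const_mul _).neg ((i2.const_mul _).add (i4.const_mul _)) fun x => ?_
    have := mul_nonneg (mul_nonneg (hχ0 x) (Real.exp_pos (l * ℓ x)).le)
      (sq_nonneg (l * F x + 2 * fderiv ℝ F x d))
    simp only
    nlinarith
  rw [integral_neg, integral_const_mul, integral_add (i2.const_mul _) (i4.const_mul _),
    integral_const_mul, integral_const_mul] at hpt
  have h1 := mul_nonneg hl.le hpos
  have h2 : l * ((∫ x, fderiv ℝ χ x d * (Real.exp (l * ℓ x) * F x ^ 2) ∂μ) +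
    (l * (∫ x, χ x * (Real.exp (l * ℓ x) * F x ^ 2) ∂μ) +
      2 * ∫ x, χ x * (Real.exp (l * ℓ x) * fderiv ℝ F x d * F x) ∂μ)) = 0 := by
    rw [h0, mul_zero]
  nlinarith

/-- The weighted Poincaré inequality for a weakly differentiable function on a supergraph which
is invariant in the direction `d`. -/
theorem weak_poincare (hM : 0 ≤ M) (hρ : ∀ x y, |ρ x - ρ y| ≤ M * ‖x - y‖) {d : E}
    (hρd : ∀ x, ∀ t : ℝ, 0 ≤ t → ρ x ≤ ρ (x + t • d)) {ℓ : E →L[ℝ] ℝ} (hℓ : ℓ d = 1)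
    {l : ℝ} (hl : 0 < l) {f g : E → ℝ} (hf : MemLp f 2 μ) (hfc : HasCompactSupport f)
    (hg : MemLp g 2 μ) (hw : HasWeakDeriv μ {x | 0 < ρ x} d f g) :
    ENNReal.ofReal (l ^ 2) * ∫⁻ x in {x | 0 < ρ x}, ENNReal.ofReal (Real.exp (l * ℓ x) * f x ^ 2) ∂μ ≤
      8 * ∫⁻ x, ENNReal.ofReal (Real.exp (l * ℓ x) * g x ^ 2) ∂μ := by
  have hfl : LocallyIntegrable f μ := hf.locallyIntegrable (by norm_num)
  have hρc := continuous_of_abs_sub_le hρ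
  have hSm : MeasurableSet {x | 0 < ρ x} := (isOpen_lt continuous_const hρc).measurableSet
  set F : ℕ → E → ℝ := fun m => mollify μ (shrinkingBump E m) f with hF
  have hFs : ∀ m, ContDiff ℝ ∞ (F m) := fun m => contDiff_mollify hfl
  have hFc : ∀ m, HasCompactSupport (F m) := fun m => hasCompactSupport_mollify hfc
  -- These weights vanish where the minorant is not positive, do not decrease along `d`, and tend to
  -- 1 at every point of `{ρ > 0}`, because `m` times a positive limit is eventually at least 1.
  set χ : ℕ → E → ℝ := fun m x => Real.smoothTransition (m * smoothMinorant μ M ρ m x) with hχ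
  have hχs : ∀ m, ContDiff ℝ 1 (χ m) := fun m =>
    (Real.smoothTransition.contDiff (n := 1)).comp
      (contDiff_const.mul ((contDiff_smoothMinorant hρ m).of_le (by simp)))
  have hχ0 : ∀ m x, 0 ≤ χ m x := fun m x => Real.smoothTransition.nonneg _
  have hχ1 : ∀ m x, χ m x ≤ 1 := fun m x => Real.smoothTransition.le_one _
  have hχd : ∀ m x, 0 ≤ fderiv ℝ (χ m) x d := by
    intro m x
    have h1 := ((contDiff_smoothMinorant (μ := μ) hρ m).differentiable (by simp) x).hasFDerivAt
    have h2 := ((Real.smoothTransition.contDiff (n := 1)).differentiable one_ne_zero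
      (m * smoothMinorant μ M ρ m x)).hasDerivAt.comp_hasFDerivAt x (h1.const_mul (m : ℝ))
    have h3 : fderiv ℝ (χ m) x = _ := h2.fderiv
    rw [h3, fderiv_smoothMinorant]
    simp only [_root_.smul_apply, smul_eq_mul]
    exact mul_nonneg (deriv_smoothTransition_nonneg _)
      (mul_nonneg (Nat.cast_nonneg _) (fderiv_mollify_nonneg hρc hρd x))
  have hexpc : Continuous fun x => Real.exp (l * ℓ x) := by fun_prop
  have hstep : ∀ m, ENNReal.ofReal (l ^ 2) *
      ∫⁻ x, ENNReal.ofReal (χ m x * (Real.exp (l * ℓ x) * F m x ^ 2)) ∂μ ≤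
      4 * (ENNReal.ofReal (Real.exp (l * (‖ℓ‖ * (shrinkingBump E m).rOut))) *
        ∫⁻ x, ENNReal.ofReal (Real.exp (l * ℓ x) * g x ^ 2) ∂μ) := by
    intro m
    have cF := (hFs m).continuous
    have cχ := (hχs m).continuous
    have cdF := (contDiff_fderiv_dir (hFs m) d).continuous
    have hF2c : HasCompactSupport fun x => F m x ^ 2 :=
      (hFc m).comp_left (g := fun t : ℝ => t ^ 2) (by simp)
    have hdF2c : HasCompactSupport fun x => fderiv ℝ (F m) x d ^ 2 :=
      (hasCompactSupport_fderiv_dir (hFc m) d).comp_left (g := fun t : ℝ => t ^ 2) (by simp)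
    have hsp := smooth_poincare (μ := μ) ((hFs m).of_le (by simp)) (hFc m) (hχs m) (hχ0 m) (hχd m)
      hℓ hl
    have e1 : ∫⁻ x, ENNReal.ofReal (χ m x * (Real.exp (l * ℓ x) * F m x ^ 2)) ∂μ =
        ENNReal.ofReal (∫ x, χ m x * (Real.exp (l * ℓ x) * F m x ^ 2) ∂μ) :=
      lintegral_ofReal_eq (by fun_prop) hF2c.mul_left.mul_left
        fun x => mul_nonneg (hχ0 m x) (by positivity)
    have e2 : ∫⁻ x, ENNReal.ofReal (χ m x * (Real.exp (l * ℓ x) * fderiv ℝ (F m) x d ^ 2)) ∂μ =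
        ENNReal.ofReal (∫ x, χ m x * (Real.exp (l * ℓ x) * fderiv ℝ (F m) x d ^ 2) ∂μ) :=
      lintegral_ofReal_eq (by fun_prop) hdF2c.mul_left.mul_left
        fun x => mul_nonneg (hχ0 m x) (by positivity)
    rw [e1, ← ENNReal.ofReal_mul (by positivity)]
    refine (ENNReal.ofReal_le_ofReal hsp).trans ?_
    rw [ENNReal.ofReal_mul (by norm_num), ← e2, ENNReal.ofReal_ofNat]
    refine mul_le_mul_right ?_ _
    have hJ := lintegral_mul_sq_mollify_le (φ := shrinkingBump E m) hg
      (wt := fun x => ENNReal.ofReal (Real.exp (l * ℓ x)))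
      (ENNReal.continuous_ofReal.comp hexpc).measurable
      (Λ := ENNReal.ofReal (Real.exp (l * (‖ℓ‖ * (shrinkingBump E m).rOut)))) (by
        intro x y hxy
        rw [← ENNReal.ofReal_mul (Real.exp_pos _).le, ← Real.exp_add]
        refine ENNReal.ofReal_le_ofReal (Real.exp_le_exp.2 ?_)
        have h1 : ℓ x - ℓ y ≤ ‖ℓ‖ * (shrinkingBump E m).rOut := by
          rw [← map_sub]
          exact (le_abs_self _).trans ((ℓ.le_opNorm _).trans
            (mul_le_mul_of_nonneg_left hxy (norm_nonneg _)))
        nlinarith)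
    simp_rw [← ENNReal.ofReal_mul (Real.exp_pos _).le] at hJ
    refine le_trans (lintegral_mono fun x => ENNReal.ofReal_le_ofReal ?_) hJ
    rcases le_or_gt (smoothMinorant μ M ρ m x) 0 with h | h
    · have : χ m x = 0 := Real.smoothTransition.zero_of_nonpos
        (mul_nonpos_of_nonneg_of_nonpos (Nat.cast_nonneg _) h)
      rw [this, zero_mul]
      positivity
    · have h5 : fderiv ℝ (F m) x d = mollify μ (shrinkingBump E m) g x :=
        fderiv_mollify hfl hw (closedBall_subset_of_smoothMinorant_pos hM hρ h)
      rw [h5]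
      exact mul_le_of_le_one_left (by positivity) (hχ1 m x)
  rw [← lintegral_const_mul' _ _ ENNReal.ofReal_ne_top]
  refine setLIntegral_le_of_tendsto
    (a := fun m x => ENNReal.ofReal (l ^ 2) *
      ENNReal.ofReal (χ m x * (Real.exp (l * ℓ x) * F m x ^ 2))) hSm (fun m => ?_) ?_ ?_
  · have cF := (hFs m).continuous
    have cχ := (hχs m).continuous
    exact ((ENNReal.continuous_ofReal.comp (by fun_prop)).measurable).const_mul _
  · filter_upwards [ae_tendsto_mollify hfl] with x hx hxS
    refine ENNReal.Tendsto.const_mul ?_ (Or.inr ENNReal.ofReal_ne_top)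
    refine (ENNReal.continuous_ofReal.tendsto _).comp ?_
    have hχt : Filter.Tendsto (fun m => χ m x) Filter.atTop (nhds 1) := by
      refine tendsto_const_nhds.congr' ?_
      have h1 : Filter.Tendsto (fun m : ℕ => (m : ℝ) * smoothMinorant μ M ρ m x) Filter.atTop
          Filter.atTop :=
        tendsto_natCast_atTop_atTop.atTop_mul_pos hxS (tendsto_smoothMinorant hM hρ x)
      filter_upwards [h1.eventually_ge_atTop 1] with m hm
      exact (Real.smoothTransition.one_of_one_le hm).symm
    simpa using hχt.mul ((hx.pow 2).const_mul (Real.exp (l * ℓ x)))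
  -- Mollification distorts the exponential weight by a factor tending to 1. Bounding it by 2 turns
  -- the constant 4 into 8 and keeps it independent of `l`.
  · have h1 : Filter.Tendsto (fun m => Real.exp (l * (‖ℓ‖ * (shrinkingBump E m).rOut)))
        Filter.atTop (nhds 1) := by
      have := (((tendsto_rOut_shrinkingBump (E := E)).const_mul ‖ℓ‖).const_mul l).rexp
      simpa using this
    filter_upwards [h1.eventually_le_const (show (1 : ℝ) < 2 by norm_num)] with m hm
    rw [lintegral_const_mul' _ _ ENNReal.ofReal_ne_top]
    refine (hstep m).trans ?_
    rw [← mul_assoc]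
    refine mul_le_mul_left ?_ _
    calc 4 * ENNReal.ofReal (Real.exp (l * (‖ℓ‖ * (shrinkingBump E m).rOut)))
        ≤ 4 * ENNReal.ofReal 2 := by gcongr
      _ = 8 := by rw [ENNReal.ofReal_ofNat]; norm_num

end WeakInequalities

/-- Korn's inequality for weakly differentiable fields with compact support, on a supergraph. -/
theorem exists_weak_korn_constant (n : ℕ) [NeZero n] {M : ℝ} (hM : 1 ≤ M) :
    ∃ K : ENNReal, K ≠ ⊤ ∧ ∀ (ρ : EuclideanSpace ℝ (Fin n) → ℝ) (ν : EuclideanSpace ℝ (Fin n))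
      (f : Fin n → EuclideanSpace ℝ (Fin n) → ℝ)
      (g : Fin n → Fin n → EuclideanSpace ℝ (Fin n) → ℝ),
      (∀ x y, |ρ x - ρ y| ≤ M * ‖x - y‖) → ‖ν‖ ≤ 1 → (∀ x, ∀ t : ℝ, ρ (x + t • ν) = ρ x + t) →
      (∀ j, MemLp (f j) 2) → (∀ j, HasCompactSupport (f j)) → (∀ i j, MemLp (g i j) 2) →
      (∀ i j, HasWeakDeriv volume {x | 0 < ρ x} (EuclideanSpace.single i 1) (f j) (g i j)) →
      ∫⁻ x in {x | 0 < ρ x}, ENNReal.ofReal (∑ i, ∑ j, g i j x ^ 2) ≤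
        K * ∫⁻ x, ENNReal.ofReal (∑ i, ∑ j, ((g i j x + g j i x) / 2) ^ 2) := by
  obtain ⟨K, hK, hkorn⟩ := exists_korn_constant n hM
  have hM0 : 0 ≤ M := by linarith
  refine ⟨K, hK, fun ρ ν f g hρ hν hρν hf hfc hg hw => ?_⟩
  have hρc := continuous_of_abs_sub_le hρ
  have hSm : MeasurableSet {x | 0 < ρ x} := (isOpen_lt continuous_const hρc).measurableSet
  have hfl : ∀ j, LocallyIntegrable (f j) := fun j => (hf j).locallyIntegrable (by norm_num)
  have hgl : ∀ i j, LocallyIntegrable (g i j) := fun i j => (hg i j).locallyIntegrable (by norm_num)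
  set b := fun m => shrinkingBump (EuclideanSpace ℝ (Fin n)) m
  set S : ℕ → Set (EuclideanSpace ℝ (Fin n)) := fun m => {x | 0 < smoothMinorant volume M ρ m x}
  have hSmm : ∀ m, MeasurableSet (S m) := fun m =>
    (isOpen_lt continuous_const (contDiff_smoothMinorant hρ m).continuous).measurableSet
  have hd : ∀ m, ∀ x ∈ S m, ∀ i j, partialD i (mollify volume (b m) (f j)) x =
      mollify volume (b m) (g i j) x := fun m x hx i j =>
    fderiv_mollify (hfl j) (hw i j) (closedBall_subset_of_smoothMinorant_pos hM0 hρ hx)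
  have hgm : ∀ m i j, ContDiff ℝ ∞ (mollify volume (b m) (g i j)) := fun m i j =>
    contDiff_mollify (hgl i j)
  have hstep : ∀ m, ∫⁻ x, (S m).indicator
      (fun x => ENNReal.ofReal (∑ i, ∑ j, mollify volume (b m) (g i j) x ^ 2)) x ≤
      K * ∫⁻ x, ENNReal.ofReal (∑ i, ∑ j, ((g i j x + g j i x) / 2) ^ 2) := by
    intro m
    have h1 := hkorn (fun j => mollify volume (b m) (f j)) (smoothMinorant volume M ρ m) ν
      (fun j => contDiff_mollify (hfl j)) (fun j => hasCompactSupport_mollify (hfc j))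
      (contDiff_smoothMinorant hρ m)
      (fun x => by rw [fderiv_smoothMinorant]; exact norm_fderiv_mollify_le hM0 hρ x) hν
      (fun x => by rw [fderiv_smoothMinorant]; exact fderiv_mollify_eq_one hρc hρν x)
    rw [lintegral_indicator (hSmm m)]
    have e1 : ∫⁻ x in S m, ENNReal.ofReal (∑ i, ∑ j, mollify volume (b m) (g i j) x ^ 2) =
        ∫⁻ x in S m, ENNReal.ofReal (∑ i, ∑ j, partialD i (mollify volume (b m) (f j)) x ^ 2) :=
      setLIntegral_congr_fun (hSmm m) fun x hx => by simp only [hd m x hx]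
    rw [e1]
    -- On `S m` the symmetrised gradient of the mollified field is the mollified symmetrised `g`.
    -- The latter is defined everywhere, so Jensen's inequality on the whole space applies; this is
    -- why the right-hand side is an integral over the whole space.
    refine h1.trans (mul_le_mul_right ?_ _)
    have hsum : ∀ a : Fin n → Fin n → ℝ, ENNReal.ofReal (∑ i, ∑ j, a i j ^ 2) =
        ∑ i, ∑ j, ENNReal.ofReal (a i j ^ 2) := by
      intro a
      rw [ENNReal.ofReal_sum_of_nonneg fun i _ => Finset.sum_nonneg fun j _ => sq_nonneg _]
      refine Finset.sum_congr rfl fun i _ => ?_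
      rw [ENNReal.ofReal_sum_of_nonneg fun j _ => sq_nonneg _]
    have hsl : ∀ i j, MemLp (fun x => (g i j x + g j i x) / 2) 2 := fun i j => by
      simpa [div_eq_mul_inv, mul_comm] using ((hg i j).add (hg j i)).const_mul 2⁻¹
    have hsm : ∀ i j, AEMeasurable fun x => ENNReal.ofReal (((g i j x + g j i x) / 2) ^ 2) :=
      fun i j => ((hsl i j).aestronglyMeasurable.aemeasurable.pow_const 2).ennreal_ofReal
    have hmm : ∀ i j, Measurable fun x =>
        ENNReal.ofReal (mollify volume (b m) (fun x => (g i j x + g j i x) / 2) x ^ 2) := fun i j =>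
      (ENNReal.continuous_ofReal.comp ((contDiff_mollify
        ((hsl i j).locallyIntegrable (by norm_num))).continuous.pow 2)).measurable
    calc ∫⁻ x in S m, ENNReal.ofReal
          (∑ i, ∑ j, symGrad (fun j => mollify volume (b m) (f j)) i j x ^ 2)
        = ∫⁻ x in S m, ENNReal.ofReal
          (∑ i, ∑ j, mollify volume (b m) (fun x => (g i j x + g j i x) / 2) x ^ 2) := by
          refine setLIntegral_congr_fun (hSmm m) fun x hx => ?_
          congr 1
          refine Finset.sum_congr rfl fun i _ => Finset.sum_congr rfl fun j _ => ?_
          rw [symGrad, hd m x hx, hd m x hx]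
          unfold mollify
          rw [← integral_add (integrable_normed_mul (hgl i j) x)
            (integrable_normed_mul (hgl j i) x), ← integral_div]
          congr 2
          ext y
          ring
      _ ≤ ∫⁻ x, ENNReal.ofReal
          (∑ i, ∑ j, mollify volume (b m) (fun x => (g i j x + g j i x) / 2) x ^ 2) :=
          setLIntegral_le_lintegral _ _
      _ = ∑ i, ∑ j, ∫⁻ x,
          ENNReal.ofReal (mollify volume (b m) (fun x => (g i j x + g j i x) / 2) x ^ 2) := by
          simp_rw [hsum]
          rw [lintegral_finsetSum _ fun i _ => Finset.measurable_fun_sum _ fun j _ => hmm i j]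
          simp_rw [lintegral_finsetSum Finset.univ fun j _ => hmm _ j]
      _ ≤ ∑ i, ∑ j, ∫⁻ x, ENNReal.ofReal (((g i j x + g j i x) / 2) ^ 2) :=
          Finset.sum_le_sum fun i _ => Finset.sum_le_sum fun j _ =>
            lintegral_sq_mollify_le (hsl i j)
      _ = _ := by
          simp_rw [hsum]
          rw [lintegral_finsetSum' _ fun i _ =>
            Finset.aemeasurable_fun_sum _ fun j _ => hsm i j]
          refine Finset.sum_congr rfl fun i _ => ?_
          rw [lintegral_finsetSum' _ fun j _ => hsm i j]
  refine setLIntegral_le_of_tendsto hSm (fun m => ?_) ?_ (Filter.Eventually.of_forall hstep)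
  · refine Measurable.indicator ?_ (hSmm m)
    refine (ENNReal.continuous_ofReal.comp ?_).measurable
    exact continuous_finsetSum _ fun i _ => continuous_finsetSum _ fun j _ =>
      (hgm m i j).continuous.pow 2
  · have hae : ∀ᵐ x, ∀ i j, Filter.Tendsto (fun m => mollify volume (b m) (g i j) x) Filter.atTop
        (nhds (g i j x)) := by
      rw [ae_all_iff]; intro i
      rw [ae_all_iff]; intro j
      exact ae_tendsto_mollify (hgl i j)
    filter_upwards [hae] with x hx hxS
    have h1 : Filter.Tendsto
        (fun m => ENNReal.ofReal (∑ i, ∑ j, mollify volume (b m) (g i j) x ^ 2)) Filter.atTop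
        (nhds (ENNReal.ofReal (∑ i, ∑ j, g i j x ^ 2))) :=
      (ENNReal.continuous_ofReal.tendsto _).comp
        (tendsto_finsetSum _ fun i _ => tendsto_finsetSum _ fun j _ => (hx i j).pow 2)
    refine h1.congr' ?_
    filter_upwards [(tendsto_smoothMinorant (μ := volume) hM0 hρ x).eventually_const_lt hxS]
      with m hm
    rw [Set.indicator_of_mem (by exact hm)]

/-! ### Rules for weak derivatives -/

section WeakDeriv

variable {E : Type*} [NormedAddCommGroup E] [NormedSpace ℝ E] [FiniteDimensional ℝ E]
  [MeasurableSpace E] [BorelSpace E] {μ : Measure E} [μ.IsAddHaarMeasure]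

lemma integrable_mul_of_hasCompactSupport {f η : E → ℝ} (hf : LocallyIntegrable f μ)
    (hη : Continuous η) (hηc : HasCompactSupport η) : Integrable (fun x => f x * η x) μ := by
  simpa [mul_comm] using hf.integrable_smul_left_of_hasCompactSupport hη hηc

/-- The product rule for weak derivatives. -/
lemma HasWeakDeriv.mul {O H : Set E} {v : E} {f g m : E → ℝ} (h : HasWeakDeriv μ O v f g)
    (hf : LocallyIntegrable f μ) (hg : LocallyIntegrable g μ) (hm : ContDiff ℝ ∞ m)
    (hO : tsupport m ∩ H ⊆ O) :
    HasWeakDeriv μ H v (fun x => m x * f x) (fun x => m x * g x + fderiv ℝ m x v * f x) := by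
  intro η hη hηc hηH
  have cm := hm.continuous
  have cη := hη.continuous
  have cdm := (contDiff_fderiv_dir hm v).continuous
  have cdη := (contDiff_fderiv_dir hη v).continuous
  have key := h (fun x => m x * η x) (hm.mul hη) hηc.mul_left (by
    intro x hx
    exact hO ⟨tsupport_mul_subset_left hx, hηH (tsupport_mul_subset_right hx)⟩)
  have hd : ∀ x, fderiv ℝ (fun x => m x * η x) x v = m x * fderiv ℝ η x v + fderiv ℝ m x v * η x := by
    intro x
    have h1 := ((hm.differentiable (by simp) x).hasFDerivAt.mul
      (hη.differentiable (by simp) x).hasFDerivAt).fderiv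
    have h2 : fderiv ℝ (fun x => m x * η x) x = _ := h1
    rw [h2]
    simp
    ring
  have i1 : Integrable (fun x => f x * (m x * fderiv ℝ η x v)) μ :=
    integrable_mul_of_hasCompactSupport hf (cm.mul cdη)
      (hasCompactSupport_fderiv_dir hηc v).mul_left
  have i2 : Integrable (fun x => f x * (fderiv ℝ m x v * η x)) μ :=
    integrable_mul_of_hasCompactSupport hf (cdm.mul cη) hηc.mul_left
  have i3 : Integrable (fun x => g x * (m x * η x)) μ :=
    integrable_mul_of_hasCompactSupport hg (cm.mul cη) hηc.mul_left
  simp_rw [hd, mul_add] at key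
  rw [integral_add i1 i2] at key
  have e1 : ∫ x, m x * f x * fderiv ℝ η x v ∂μ = ∫ x, f x * (m x * fderiv ℝ η x v) ∂μ := by
    congr 1; ext x; ring
  have e2 : ∫ x, (m x * g x + fderiv ℝ m x v * f x) * η x ∂μ =
      (∫ x, g x * (m x * η x) ∂μ) + ∫ x, f x * (fderiv ℝ m x v * η x) ∂μ := by
    rw [← integral_add i3 i2]
    congr 1; ext x; ring
  rw [e1, e2]
  linarith

/-- Directional weak derivatives of a component of a field. -/
lemma HasWeakDeriv.sum {n : ℕ} {O : Set (EuclideanSpace ℝ (Fin n))}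
    {f : Fin n → EuclideanSpace ℝ (Fin n) → ℝ} {g : Fin n → Fin n → EuclideanSpace ℝ (Fin n) → ℝ}
    (hf : ∀ j, LocallyIntegrable (f j)) (hg : ∀ i j, LocallyIntegrable (g i j))
    (h : ∀ i j, HasWeakDeriv volume O (EuclideanSpace.single i 1) (f j) (g i j))
    (d c : EuclideanSpace ℝ (Fin n)) :
    HasWeakDeriv volume O d (fun x => ∑ j, c j * f j x) (fun x => ∑ i, ∑ j, d i * c j * g i j x) := by
  intro η hη hηc hηO
  have cη := hη.continuous
  have cd : ∀ i, Continuous (partialD i η) := fun i => (contDiff_partialD hη i).continuous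
  have i1 : ∀ i j, Integrable fun x => d i * c j * (f j x * partialD i η x) := fun i j =>
    (integrable_mul_of_hasCompactSupport (hf j) (cd i)
      (hasCompactSupport_partialD hηc i)).const_mul _
  have i2 : ∀ i j, Integrable fun x => d i * c j * (g i j x * η x) := fun i j =>
    (integrable_mul_of_hasCompactSupport (hg i j) cη hηc).const_mul _
  have e1 : ∀ x, (∑ j, c j * f j x) * fderiv ℝ η x d =
      ∑ i, ∑ j, d i * c j * (f j x * partialD i η x) := by
    intro x
    rw [fderiv_eq_sum_partialD, Finset.sum_mul_sum, Finset.sum_comm]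
    exact Finset.sum_congr rfl fun i _ => Finset.sum_congr rfl fun j _ => by ring
  have e2 : ∀ x, (∑ i, ∑ j, d i * c j * g i j x) * η x =
      ∑ i, ∑ j, d i * c j * (g i j x * η x) := by
    intro x
    rw [Finset.sum_mul]
    refine Finset.sum_congr rfl fun i _ => ?_
    rw [Finset.sum_mul]
    exact Finset.sum_congr rfl fun j _ => by ring
  simp_rw [e1, e2]
  rw [integral_finsetSum _ fun i _ => integrable_finsetSum _ fun j _ => i1 i j,
    integral_finsetSum _ fun i _ => integrable_finsetSum _ fun j _ => i2 i j,
    ← Finset.sum_neg_distrib]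
  refine Finset.sum_congr rfl fun i _ => ?_
  rw [integral_finsetSum _ fun j _ => i1 i j, integral_finsetSum _ fun j _ => i2 i j,
    ← Finset.sum_neg_distrib]
  refine Finset.sum_congr rfl fun j _ => ?_
  rw [integral_const_mul, integral_const_mul, ← mul_neg, ← h i j η hη hηc hηO]
  rfl

end WeakDeriv

/-! ### Boundary charts and the projection to the plane -/

section Charts

/-- Near each point of its closure, a plane open set with Lipschitz boundary is a supergraph. -/
lemma HasLipschitzBoundary.exists_chart {D : Set E2} (hD : IsOpen D) (hlip : HasLipschitzBoundary D)
    {p : E2} (hp : p ∈ closure D) : ∃ (δ M : ℝ) (ρ : E2 → ℝ) (ν : E2), 0 < δ ∧ 1 ≤ M ∧ ‖ν‖ ≤ 1 ∧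
      (∀ x y, |ρ x - ρ y| ≤ M * ‖x - y‖) ∧ (∀ x, ∀ t : ℝ, ρ (x + t • ν) = ρ x + t) ∧
      ∀ y ∈ Metric.ball p δ, y ∈ D ↔ 0 < ρ y := by
  by_cases hpD : p ∈ D
  -- At an interior point any affine function of unit slope that is positive on the ball will do.
  · obtain ⟨δ, hδ, hball⟩ := Metric.isOpen_iff.1 hD p hpD
    refine ⟨δ, 1, fun y => y 1 - p 1 + δ, EuclideanSpace.single 1 1, hδ, le_rfl, by simp,
      fun x y => ?_, fun x t => ?_, fun y hy => ⟨fun _ => ?_, fun _ => hball hy⟩⟩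
    · have := PiLp.norm_apply_le (x - y) 1
      simpa [Real.norm_eq_abs] using this
    · simp; ring
    · have h1 := PiLp.norm_apply_le (y - p) 1
      rw [PiLp.sub_apply, Real.norm_eq_abs] at h1
      rw [Metric.mem_ball, dist_eq_norm] at hy
      have := (abs_le.1 h1).1
      linarith
  · have hfr : p ∈ frontier D := by
      rw [frontier, hD.interior_eq]; exact ⟨hp, hpD⟩
    obtain ⟨L, K, g, δ, hg, hδ, hy⟩ := hlip p hfr
    -- Here `ρ` is the height above the graph, measured along the vertical axis `ν` of the chart:
    -- exactly of unit speed along `ν`, and `(1 + K)`-Lipschitz.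
    refine ⟨δ, 1 + K, fun y => L (y - p) 1 - g (L (y - p) 0), L.symm (EuclideanSpace.single 1 1), hδ,
      by simp, by simp, fun x y => ?_, fun x t => ?_, fun y hyb => by rw [hy y hyb, sub_pos]⟩
    · have h0 : L (x - p) - L (y - p) = L (x - y) := by rw [← map_sub, sub_sub_sub_cancel_right]
      have h1 : ∀ i, |L (x - p) i - L (y - p) i| ≤ ‖x - y‖ := by
        intro i
        have := PiLp.norm_apply_le (L (x - y)) i
        rwa [L.norm_map, ← h0, PiLp.sub_apply, Real.norm_eq_abs] at this
      have h2 := hg.dist_le_mul (L (x - p) 0) (L (y - p) 0)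
      rw [Real.dist_eq, Real.dist_eq] at h2
      have h3 := h2.trans (mul_le_mul_of_nonneg_left (h1 0) K.2)
      have h4 := h1 1
      change |L (x - p) 1 - g (L (x - p) 0) - (L (y - p) 1 - g (L (y - p) 0))| ≤
        (1 + (K : ℝ)) * ‖x - y‖
      have h5 := abs_le.1 h3
      have h6 := abs_le.1 h4
      rw [abs_le]
      constructor <;> linarith [h5.1, h5.2, h6.1, h6.2]
    · have : L (x + t • L.symm (EuclideanSpace.single 1 1) - p) =
          L (x - p) + t • EuclideanSpace.single 1 1 := by
        rw [add_sub_right_comm, map_add, map_smul, L.apply_symm_apply]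
      simp only [this]
      simp
      ring

/-- The projection `(x¹, x², ξ) ↦ (x¹, x²)` as a linear map. -/
noncomputable def projL : E3 →L[ℝ] E2 :=
  LinearMap.toContinuousLinearMap
    { toFun := proj
      map_add' := fun x y => by ext i; fin_cases i <;> simp [proj]
      map_smul' := fun c x => by ext i; fin_cases i <;> simp [proj] }

lemma projL_apply (x : E3) : projL x = proj x := rfl

lemma norm_proj_le (x : E3) : ‖proj x‖ ≤ ‖x‖ := by
  rw [← sq_le_sq₀ (norm_nonneg _) (norm_nonneg _), EuclideanSpace.norm_sq_eq,
    EuclideanSpace.norm_sq_eq, Fin.sum_univ_two, Fin.sum_univ_three]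
  simp only [proj, Real.norm_eq_abs, sq_abs]
  simp
  positivity

lemma norm_le_norm_proj_add (x : E3) : ‖x‖ ≤ ‖proj x‖ + |x 2| := by
  rw [← sq_le_sq₀ (norm_nonneg _) (by positivity), add_sq, EuclideanSpace.norm_sq_eq x,
    EuclideanSpace.norm_sq_eq (proj x), Fin.sum_univ_two, Fin.sum_univ_three]
  simp only [proj, Real.norm_eq_abs, sq_abs]
  simp
  positivity

/-- The vector with plane part `a` and `ξ`-component `s`. -/
noncomputable def liftVec (a : E2) (s : ℝ) : E3 := !₂[a 0, a 1, s]

lemma proj_liftVec (a : E2) (s : ℝ) : proj (liftVec a s) = a := by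
  ext i; fin_cases i <;> simp [proj, liftVec]

lemma liftVec_two (a : E2) (s : ℝ) : liftVec a s 2 = s := by simp [liftVec]

lemma proj_add_smul (x d : E3) (t : ℝ) : proj (x + t • d) = proj x + t • proj d := by
  simp only [← projL_apply, map_add, map_smul]

end Charts

/-! ### Fields extended by zero; the Poincaré inequality in one direction -/

section Extended

/-- A field on the whole space which vanishes outside the channel over `D`, with its weak
derivatives; it has them across the faces `ξ = ±1` too. -/
structure IsExtendedField (D : Set E2) (u : Fin 3 → E3 → ℝ) (G : Fin 3 → Fin 3 → E3 → ℝ) : Prop where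
  memLp : ∀ j, MemLp (u j) 2
  memLp_deriv : ∀ i j, MemLp (G i j) 2
  zero : ∀ j, ∀ x ∉ channel D, u j x = 0
  zero_deriv : ∀ i j, ∀ x ∉ channel D, G i j x = 0
  weak : ∀ i j, HasWeakDeriv volume ({x | proj x ∈ D} ∪ {x | 1 < |x 2|})
    (EuclideanSpace.single i 1) (u j) (G i j)

/-- The sum of the squares of the symmetrised derivatives. -/
noncomputable def symSq (G : Fin 3 → Fin 3 → E3 → ℝ) (x : E3) : ℝ :=
  ∑ i, ∑ j, ((G i j x + G j i x) / 2) ^ 2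

lemma symSq_nonneg (G : Fin 3 → Fin 3 → E3 → ℝ) (x : E3) : 0 ≤ symSq G x :=
  Finset.sum_nonneg fun _ _ => Finset.sum_nonneg fun _ _ => sq_nonneg _

lemma isOpen_channel {D : Set E2} (hD : IsOpen D) : IsOpen (channel D) := by
  have hp : Continuous proj := projL.continuous
  have h2 : Continuous fun x : E3 => x 2 := by fun_prop
  exact (hD.preimage hp).inter ((isOpen_lt continuous_const h2).inter (isOpen_lt h2 continuous_const))

lemma exists_norm_le_of_mem_channel {D : Set E2} (hD : Bornology.IsBounded D) :
    ∃ R, ∀ x ∈ channel D, ‖x‖ ≤ R := by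
  obtain ⟨R, hR⟩ := hD.exists_norm_le
  refine ⟨R + 1, fun x hx => (norm_le_norm_proj_add x).trans (add_le_add (hR _ hx.1) ?_)⟩
  exact abs_le.2 ⟨hx.2.1.le, hx.2.2.le⟩

/-- The antisymmetric part of the gradient drops out of `dᵀGd`, which is the derivative of `d·u`
along `d`. This makes a Poincaré inequality in terms of `e(u)` alone possible. -/
lemma quadratic_form_eq_sym (d : E3) (G : Fin 3 → Fin 3 → E3 → ℝ) (x : E3) :
    ∑ i, ∑ j, d i * d j * G i j x = ∑ i, ∑ j, d i * d j * ((G i j x + G j i x) / 2) := by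
  simp only [Fin.sum_univ_three]
  ring

lemma sq_quadratic_form_le (d : E3) (G : Fin 3 → Fin 3 → E3 → ℝ) (x : E3) :
    (∑ i, ∑ j, d i * d j * G i j x) ^ 2 ≤ (∑ i, ∑ j, (d i * d j) ^ 2) * symSq G x := by
  rw [quadratic_form_eq_sym, symSq, ← Finset.sum_product', ← Finset.sum_product',
    ← Finset.sum_product']
  exact Finset.sum_mul_sq_le_sq_mul_sq _ _ _

variable {D : Set E2} {u : Fin 3 → E3 → ℝ} {G : Fin 3 → Fin 3 → E3 → ℝ}

lemma memLp_of_abs_le {f g : E3 → ℝ} {C : ℝ} (hg : MemLp g 2) (hf : AEStronglyMeasurable f)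
    (h : ∀ x, |f x| ≤ C * |g x|) : MemLp f 2 :=
  hg.of_le_mul hf (Filter.Eventually.of_forall h)

/-- The weighted Poincaré inequality near a point, in one direction. -/
lemma local_poincare_dir (hbd : Bornology.IsBounded D) {p : E2} {δ M : ℝ} {ρ : E2 → ℝ} (hδ : 0 < δ)
    (hM : 1 ≤ M) (hρ : ∀ x y, |ρ x - ρ y| ≤ M * ‖x - y‖)
    (hchart : ∀ y ∈ Metric.ball p δ, y ∈ D ↔ 0 < ρ y) {a : E2} (ha : ‖a‖ ≤ 2)
    (hρa : ∀ x, ∀ t : ℝ, 0 ≤ t → ρ x ≤ ρ (x + t • a)) (hu : IsExtendedField D u G) {l : ℝ}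
    (hl : 0 < l) :
    ENNReal.ofReal (l ^ 2) * ∫⁻ x in proj ⁻¹' Metric.ball p (δ / 8),
      ENNReal.ofReal (Real.exp (l * x 2) * (∑ j, liftVec ((δ / 32) • a) 1 j * u j x) ^ 2) ≤
    8 * (ENNReal.ofReal (∑ i, ∑ j, (liftVec ((δ / 32) • a) 1 i * liftVec ((δ / 32) • a) 1 j) ^ 2) *
      ∫⁻ x, ENNReal.ofReal (Real.exp (l * x 2) * symSq G x)) := by
  -- The plane part is so small that between `ξ = -1` and `ξ = 1` a line in direction `d` drifts by
  -- at most `δ/8`, less than the gaps between the radii `δ/8`, `δ/2` and `δ` allow.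
  set d : E3 := liftVec ((δ / 32) • a) 1 with hd
  have hdp : proj d = (δ / 32) • a := proj_liftVec _ _
  have hd2 : d 2 = 1 := liftVec_two _ _
  let χ : ContDiffBump p := ⟨δ / 4, δ / 2, by positivity, by linarith⟩
  -- The plane part of the point where the line through `x` in direction `d` meets `ξ = -1`. A
  -- cutoff composed with `s` is constant along `d`, so localisation leaves no zeroth order term;
  -- such a term would carry over to the right-hand side of the inequality.
  set s : E3 → E2 := fun x => proj x - ((δ / 32) * (x 2 + 1)) • a with hs
  have hss : ContDiff ℝ ∞ s := by
    have : ContDiff ℝ ∞ proj := projL.contDiff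
    have h2 : ContDiff ℝ ∞ fun x : E3 => x 2 := by fun_prop
    fun_prop
  set m : E3 → ℝ := fun x => χ (s x) with hm
  have hms : ContDiff ℝ ∞ m := χ.contDiff.comp hss
  have hm1 : ∀ x, |m x| ≤ 1 := fun x => by rw [abs_of_nonneg χ.nonneg]; exact χ.le_one
  have hshift : ∀ x : E3, |x 2| ≤ 1 → ‖proj x - s x‖ ≤ δ / 8 := by
    intro x hx
    have h1 : 0 ≤ x 2 + 1 := by linarith [(abs_le.1 hx).1]
    have h2 : x 2 + 1 ≤ 2 := by linarith [(abs_le.1 hx).2]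
    rw [hs, sub_sub_cancel, norm_smul, Real.norm_eq_abs, abs_of_nonneg (by positivity)]
    calc δ / 32 * (x 2 + 1) * ‖a‖ ≤ δ / 32 * 2 * 2 := by gcongr
      _ = δ / 8 := by ring
  have hmd : ∀ x, fderiv ℝ m x d = 0 := by
    intro x
    have hinv : ∀ t : ℝ, m (x + t • d) = m x := by
      intro t
      have : s (x + t • d) = s x := by
        simp only [hs, proj_add_smul, hdp, PiLp.add_apply, PiLp.smul_apply, hd2, smul_eq_mul]
        module
      simp only [hm, this]
    have h1 : HasDerivAt (fun t : ℝ => m (x + t • d)) (fderiv ℝ m x d) 0 :=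
      (hms.differentiable (by simp) x).hasFDerivAt.hasLineDerivAt d
    simp_rw [hinv] at h1
    exact h1.unique (hasDerivAt_const _ _)
  have hul : ∀ j, LocallyIntegrable (u j) := fun j => (hu.memLp j).locallyIntegrable (by norm_num)
  have hGl : ∀ i j, LocallyIntegrable (G i j) := fun i j =>
    (hu.memLp_deriv i j).locallyIntegrable (by norm_num)
  have hf0 : MemLp (fun x => ∑ j, d j * u j x) 2 :=
    memLp_finsetSum _ fun j _ => (hu.memLp j).const_mul (d j)
  have hg0 : MemLp (fun x => ∑ i, ∑ j, d i * d j * G i j x) 2 :=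
    memLp_finsetSum _ fun i _ => memLp_finsetSum _ fun j _ =>
      (hu.memLp_deriv i j).const_mul (d i * d j)
  have hmp : ∀ {f : E3 → ℝ}, MemLp f 2 → MemLp (fun x => m x * f x) 2 := fun {f} hf =>
    memLp_of_abs_le (C := 1) hf (hms.continuous.aestronglyMeasurable.mul hf.1) fun x => by
      rw [abs_mul]; exact mul_le_mul_of_nonneg_right (hm1 x) (abs_nonneg _)
  -- For `|ξ| > 1` the extension is zero and nothing is required of the base point. For `|ξ| ≤ 1`
  -- the drift bound keeps the base point within the chart, where `ρ > 0` means that it lies in `D`.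
  have hw0 := (HasWeakDeriv.sum hul hGl hu.weak d d).mul (H := {x | 0 < ρ (proj x)}) (m := m)
    (hf0.locallyIntegrable (by norm_num)) (hg0.locallyIntegrable (by norm_num)) hms (by
      rintro x ⟨hx1, hx2⟩
      rcases lt_or_ge 1 |x 2| with h | h
      · exact Or.inr h
      · refine Or.inl ((hchart _ ?_).2 hx2)
        have h3 : s x ∈ Metric.closedBall p (δ / 2) := by
          have := tsupport_comp_subset_preimage (f := s) χ hss.continuous hx1
          rw [Set.mem_preimage, χ.tsupport_eq] at this
          exact this
        rw [Metric.mem_closedBall, dist_eq_norm] at h3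
        rw [Metric.mem_ball, dist_eq_norm]
        have h4 := norm_add_le (proj x - s x) (s x - p)
        rw [sub_add_sub_cancel] at h4
        linarith [hshift x h])
  simp_rw [hmd, zero_mul, add_zero] at hw0
  obtain ⟨R, hR⟩ := exists_norm_le_of_mem_channel hbd
  have hfc : HasCompactSupport fun x => m x * ∑ j, d j * u j x := by
    refine hasCompactSupport_of_forall_norm (R := R) fun x hx => ?_
    have : x ∉ channel D := fun h => absurd (hR x h) (not_le.2 hx)
    simp [hu.zero _ x this]
  have hℓ : (EuclideanSpace.proj (2 : Fin 3) : E3 →L[ℝ] ℝ) d = 1 := hd2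
  have key := weak_poincare (μ := (volume : Measure E3)) (ρ := fun x => ρ (proj x)) (M := M)
    (by linarith)
    (fun x y => (hρ _ _).trans (mul_le_mul_of_nonneg_left (by
      rw [← projL_apply, ← projL_apply, ← map_sub]; exact norm_proj_le _) (by linarith)))
    (fun x t ht => by
      rw [proj_add_smul, hdp, smul_smul]
      exact hρa _ _ (by positivity)) hℓ hl (hmp hf0) hfc (hmp hg0) hw0
  have hpr : ∀ x : E3, (EuclideanSpace.proj (2 : Fin 3) : E3 →L[ℝ] ℝ) x = x 2 := fun _ => rfl
  simp only [hpr] at key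
  have hpm : MeasurableSet (proj ⁻¹' Metric.ball p (δ / 8)) :=
    (Metric.isOpen_ball.preimage projL.continuous).measurableSet
  have hρm : MeasurableSet {x : E3 | 0 < ρ (proj x)} :=
    (isOpen_lt continuous_const ((continuous_of_abs_sub_le hρ).comp projL.continuous)).measurableSet
  refine le_trans (mul_le_mul_right ?_ _) (key.trans (mul_le_mul_right ?_ _))
  · rw [← lintegral_indicator hpm, ← lintegral_indicator hρm]
    refine lintegral_mono fun x => ?_
    by_cases hx : x ∈ proj ⁻¹' Metric.ball p (δ / 8)
    swap
    · rw [Set.indicator_of_notMem hx]; exact zero_le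
    rw [Set.indicator_of_mem hx]
    by_cases hxc : x ∈ channel D
    swap
    · simp [hu.zero _ x hxc]
    have hxb : ‖proj x - p‖ < δ / 8 := by simpa [dist_eq_norm] using hx
    have hx1 : 0 < ρ (proj x) := (hchart _ (by
      rw [Metric.mem_ball, dist_eq_norm]; linarith)).1 hxc.1
    have hmx : m x = 1 := by
      refine χ.one_of_mem_closedBall ?_
      rw [Metric.mem_closedBall, dist_eq_norm]
      have h4 := norm_sub_le (proj x - p) (proj x - s x)
      rw [sub_sub_sub_cancel_left] at h4
      have h5 := hshift x (abs_le.2 ⟨hxc.2.1.le, hxc.2.2.le⟩)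
      change ‖s x - p‖ ≤ δ / 4
      linarith
    rw [Set.indicator_of_mem (by exact hx1), hmx, one_mul]
  · rw [← lintegral_const_mul' _ _ ENNReal.ofReal_ne_top]
    refine lintegral_mono fun x => ?_
    rw [← ENNReal.ofReal_mul (Finset.sum_nonneg fun _ _ => Finset.sum_nonneg fun _ _ => sq_nonneg _)]
    refine ENNReal.ofReal_le_ofReal ?_
    have h1 := sq_quadratic_form_le d G x
    have h2 : (m x * ∑ i, ∑ j, d i * d j * G i j x) ^ 2 ≤ (∑ i, ∑ j, d i * d j * G i j x) ^ 2 := by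
      rw [mul_pow]
      refine mul_le_of_le_one_left (sq_nonneg _) ?_
      rw [← sq_abs]
      exact pow_le_one₀ (abs_nonneg _) (hm1 x)
    have h3 := mul_le_mul_of_nonneg_left (h2.trans h1) (Real.exp_pos (l * x 2)).le
    linarith

end Extended

/-! ### From local to global inequalities -/

section Global

/-- Local bounds of integrals over cylinders add up to a bound over the cylinder on a compact set. -/
lemma exists_const_of_locally {ι : Type*} {K : Set E2} (hK : IsCompact K) (F : ι → E3 → ENNReal)
    (R : ι → ENNReal)
    (h : ∀ p ∈ K, ∃ t ∈ nhds p, ∃ C : ENNReal, C ≠ ⊤ ∧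
      ∀ i, ∫⁻ x in proj ⁻¹' t, F i x ≤ C * R i) :
    ∃ C : ENNReal, C ≠ ⊤ ∧ ∀ i, ∫⁻ x in proj ⁻¹' K, F i x ≤ C * R i := by
  refine hK.induction_on (p := fun t => ∃ C : ENNReal, C ≠ ⊤ ∧
      ∀ i, ∫⁻ x in proj ⁻¹' t, F i x ≤ C * R i) ⟨0, by simp, by simp⟩ ?_ ?_ ?_
  · rintro s t hst ⟨C, hC, ht⟩
    exact ⟨C, hC, fun i => (lintegral_mono_set (Set.preimage_mono hst)).trans (ht i)⟩
  · rintro s t ⟨C, hC, hs⟩ ⟨C', hC', ht⟩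
    refine ⟨C + C', ENNReal.add_ne_top.2 ⟨hC, hC'⟩, fun i => ?_⟩
    rw [Set.preimage_union, add_mul]
    exact (lintegral_union_le _ _ _).trans (add_le_add (hs i) (ht i))
  · intro p hp
    obtain ⟨t, ht, hC⟩ := h p hp
    exact ⟨t, mem_nhdsWithin_of_mem_nhds ht, hC⟩

variable {D : Set E2} {u : Fin 3 → E3 → ℝ} {G : Fin 3 → Fin 3 → E3 → ℝ}

/-- The four plane directions used to recover all components of a field. -/
noncomputable def chartDir (M : ℝ) (ν : E2) : Fin 4 → E2 :=
  ![0, ν, ν + M⁻¹ • EuclideanSpace.single 0 1, ν + M⁻¹ • EuclideanSpace.single 1 1]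

lemma norm_chartDir_le {M : ℝ} {ν : E2} (hM : 1 ≤ M) (hν : ‖ν‖ ≤ 1) (k : Fin 4) :
    ‖chartDir M ν k‖ ≤ 2 := by
  have h1 : ∀ i : Fin 2, ‖ν + M⁻¹ • EuclideanSpace.single i (1 : ℝ)‖ ≤ 2 := by
    intro i
    refine (norm_add_le _ _).trans ?_
    rw [norm_smul, PiLp.norm_single, Real.norm_eq_abs, abs_of_nonneg (by positivity)]
    have : M⁻¹ ≤ 1 := inv_le_one_of_one_le₀ hM
    simp
    linarith
  fin_cases k
  · simp [chartDir]
  · exact hν.trans (by norm_num)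
  · exact h1 0
  · exact h1 1

/-- Moving by `tν` raises `ρ` by exactly `t`, and the additional step of length `t/M` along a
coordinate axis lowers it by at most `M · t/M = t`. -/
lemma le_add_smul_chartDir {M : ℝ} {ν : E2} {ρ : E2 → ℝ} (hM : 1 ≤ M)
    (hρ : ∀ x y, |ρ x - ρ y| ≤ M * ‖x - y‖) (hρν : ∀ x, ∀ t : ℝ, ρ (x + t • ν) = ρ x + t)
    (k : Fin 4) (x : E2) (t : ℝ) (ht : 0 ≤ t) : ρ x ≤ ρ (x + t • chartDir M ν k) := by
  have h1 : ∀ i : Fin 2, ρ x ≤ ρ (x + t • (ν + M⁻¹ • EuclideanSpace.single i (1 : ℝ))) := by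
    intro i
    have h2 := hρ (x + t • M⁻¹ • EuclideanSpace.single i (1 : ℝ)) x
    have hM0 : 0 < M := by linarith
    rw [add_sub_cancel_left, smul_smul, norm_smul, PiLp.norm_single, Real.norm_eq_abs,
      abs_of_nonneg (by positivity : 0 ≤ t * M⁻¹)] at h2
    have h3 : M * (t * M⁻¹ * ‖(1 : ℝ)‖) = t := by
      rw [norm_one]; field_simp
    rw [h3] at h2
    have h4 := hρν (x + (t * M⁻¹) • EuclideanSpace.single i (1 : ℝ)) t
    have h5 : x + (t * M⁻¹) • EuclideanSpace.single i (1 : ℝ) + t • ν =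
        x + t • (ν + M⁻¹ • EuclideanSpace.single i (1 : ℝ)) := by module
    rw [h5] at h4
    rw [h4]
    linarith [(abs_le.1 h2).1]
  fin_cases k
  · simp [chartDir]
  · change ρ x ≤ ρ (x + t • ν)
    rw [hρν]; linarith
  · exact h1 0
  · exact h1 1

/-- The direction over `0` gives the third component. Subtracting the direction over `ν` from the
last two isolates `κ/M` times the first and second components. -/
lemma sum_sq_le_sum_chartDir {M κ : ℝ} (ν : E2) (hM : 1 ≤ M) (hκ : 0 < κ) (v : Fin 3 → ℝ) :
    ∑ j, v j ^ 2 ≤ (1 + 4 * (M / κ) ^ 2) *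
      ∑ k, (∑ j, liftVec (κ • chartDir M ν k) 1 j * v j) ^ 2 := by
  have hM0 : M ≠ 0 := by positivity
  set S : Fin 4 → ℝ := fun k => ∑ j, liftVec (κ • chartDir M ν k) 1 j * v j with hS
  have h0 : S 0 = v 2 := by
    simp [hS, Fin.sum_univ_three, liftVec, chartDir]
  have h1 : (M / κ) * (S 2 - S 1) = v 0 := by
    simp [hS, Fin.sum_univ_three, liftVec, chartDir]
    field_simp
    ring
  have h2 : (M / κ) * (S 3 - S 1) = v 1 := by
    simp [hS, Fin.sum_univ_three, liftVec, chartDir]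
    field_simp
    ring
  change _ ≤ (1 + 4 * (M / κ) ^ 2) * ∑ k, S k ^ 2
  rw [Fin.sum_univ_three, Fin.sum_univ_four, ← h0, ← h1, ← h2]
  have hq : 0 ≤ (M / κ) ^ 2 := sq_nonneg _
  nlinarith [mul_nonneg hq (sq_nonneg (S 2 + S 1)), mul_nonneg hq (sq_nonneg (S 3 + S 1)),
    mul_nonneg hq (sq_nonneg (S 0)), mul_nonneg hq (sq_nonneg (S 2)),
    mul_nonneg hq (sq_nonneg (S 3)), sq_nonneg (S 1), sq_nonneg (S 2), sq_nonneg (S 3)]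

lemma IsExtendedField.aemeasurable_symSq (hu : IsExtendedField D u G) :
    AEMeasurable fun x => ENNReal.ofReal (symSq G x) :=
  (Finset.aemeasurable_fun_sum _ fun i _ => Finset.aemeasurable_fun_sum _ fun j _ =>
    (((hu.memLp_deriv i j).1.aemeasurable.add
      (hu.memLp_deriv j i).1.aemeasurable).div_const 2).pow_const 2).ennreal_ofReal

/-- The weighted Poincaré inequality: `l²∫e^{lξ}|u|² ≤ C∫e^{lξ}|e(u)|²`, with `C` independent of
`l`. -/
theorem exists_poincare_constant (hD : IsOpen D) (hbd : Bornology.IsBounded D)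
    (hlip : HasLipschitzBoundary D) : ∃ C : ENNReal, C ≠ ⊤ ∧
      ∀ u G, IsExtendedField D u G → ∀ l : ℝ, 0 < l →
        ENNReal.ofReal (l ^ 2) * ∫⁻ x, ENNReal.ofReal (Real.exp (l * x 2) * ∑ j, u j x ^ 2) ≤
        C * ∫⁻ x, ENNReal.ofReal (Real.exp (l * x 2) * symSq G x) := by
  have hK : IsCompact (closure D) := hbd.isCompact_closure
  -- The field and `l` are part of the index, so that the finite covering yields one constant for
  -- all of them.
  let ι := {q : (Fin 3 → E3 → ℝ) × (Fin 3 → Fin 3 → E3 → ℝ) × ℝ //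
    IsExtendedField D q.1 q.2.1 ∧ 0 < q.2.2}
  obtain ⟨C, hC, h⟩ := exists_const_of_locally hK (ι := ι)
    (fun q x => ENNReal.ofReal (q.1.2.2 ^ 2) *
      ENNReal.ofReal (Real.exp (q.1.2.2 * x 2) * ∑ j, q.1.1 j x ^ 2))
    (fun q => ∫⁻ x, ENNReal.ofReal (Real.exp (q.1.2.2 * x 2) * symSq q.1.2.1 x)) (by
      intro p hp
      obtain ⟨δ, M, ρ, ν, hδ, hM, hν, hρ, hρν, hchart⟩ := hlip.exists_chart hD hp
      set d : Fin 4 → E3 := fun k => liftVec ((δ / 32) • chartDir M ν k) 1 with hd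
      refine ⟨Metric.ball p (δ / 8), Metric.ball_mem_nhds _ (by positivity),
        ENNReal.ofReal (1 + 4 * (M / (δ / 32)) ^ 2) *
          ∑ k, 8 * ENNReal.ofReal (∑ i, ∑ j, (d k i * d k j) ^ 2),
        ENNReal.mul_ne_top ENNReal.ofReal_ne_top (ENNReal.sum_ne_top.2 fun k _ =>
          ENNReal.mul_ne_top (by simp) ENNReal.ofReal_ne_top), ?_⟩
      rintro ⟨⟨u, G, l⟩, hu, hl⟩
      change IsExtendedField D u G at hu
      change 0 < l at hl
      change ∫⁻ x in _, ENNReal.ofReal (l ^ 2) *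
        ENNReal.ofReal (Real.exp (l * x 2) * ∑ j, u j x ^ 2) ≤
        _ * ∫⁻ x, ENNReal.ofReal (Real.exp (l * x 2) * symSq G x)
      rw [lintegral_const_mul' _ _ ENNReal.ofReal_ne_top]
      have hpt : ∀ x : E3, ENNReal.ofReal (Real.exp (l * x 2) * ∑ j, u j x ^ 2) ≤
          ENNReal.ofReal (1 + 4 * (M / (δ / 32)) ^ 2) * ∑ k : Fin 4, ENNReal.ofReal
            (Real.exp (l * x 2) * (∑ j, d k j * u j x) ^ 2) := by
        intro x
        have h1 := sum_sq_le_sum_chartDir (κ := δ / 32) ν hM (by positivity) (fun j => u j x)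
        rw [← ENNReal.ofReal_sum_of_nonneg fun k _ => by positivity,
          ← ENNReal.ofReal_mul (by positivity)]
        refine ENNReal.ofReal_le_ofReal ?_
        rw [← Finset.mul_sum]
        have h2 := mul_le_mul_of_nonneg_left h1 (Real.exp_pos (l * x 2)).le
        refine h2.trans (le_of_eq ?_)
        simp only [hd]
        ring
      have hcexp : Continuous fun x : E3 => Real.exp (l * x 2) := by fun_prop
      have hmeas : ∀ k : Fin 4, AEMeasurable (fun x : E3 => ENNReal.ofReal
          (Real.exp (l * x 2) * (∑ j, d k j * u j x) ^ 2))
          (volume.restrict (proj ⁻¹' Metric.ball p (δ / 8))) := fun k =>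
        (hcexp.measurable.aemeasurable.mul ((Finset.aemeasurable_fun_sum _ fun j _ =>
          (hu.memLp j).1.aemeasurable.const_mul (d k j)).pow_const 2)).ennreal_ofReal.restrict
      calc ENNReal.ofReal (l ^ 2) * ∫⁻ x in proj ⁻¹' Metric.ball p (δ / 8),
            ENNReal.ofReal (Real.exp (l * x 2) * ∑ j, u j x ^ 2)
          ≤ ENNReal.ofReal (l ^ 2) * ∫⁻ x in proj ⁻¹' Metric.ball p (δ / 8),
            ENNReal.ofReal (1 + 4 * (M / (δ / 32)) ^ 2) * ∑ k : Fin 4, ENNReal.ofReal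
            (Real.exp (l * x 2) * (∑ j, d k j * u j x) ^ 2) :=
            mul_le_mul_right (lintegral_mono hpt) _
        _ = ENNReal.ofReal (1 + 4 * (M / (δ / 32)) ^ 2) * ∑ k : Fin 4, ENNReal.ofReal (l ^ 2) *
            ∫⁻ x in proj ⁻¹' Metric.ball p (δ / 8), ENNReal.ofReal
            (Real.exp (l * x 2) * (∑ j, d k j * u j x) ^ 2) := by
            rw [lintegral_const_mul' _ _ ENNReal.ofReal_ne_top,
              lintegral_finsetSum' _ fun k _ => hmeas k, Finset.mul_sum, Finset.mul_sum,
              Finset.mul_sum]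
            exact Finset.sum_congr rfl fun k _ => by ring
        _ ≤ _ := by
            rw [mul_assoc, Finset.sum_mul]
            refine mul_le_mul_right (Finset.sum_le_sum fun k _ => ?_) _
            rw [mul_assoc]
            exact local_poincare_dir hbd hδ hM hρ hchart (norm_chartDir_le hM hν k)
              (le_add_smul_chartDir hM hρ hρν k) hu hl)
  refine ⟨C, hC, fun u G hu l hl => le_trans ?_ (h ⟨(u, G, l), hu, hl⟩)⟩
  have hm : MeasurableSet (proj ⁻¹' closure D) :=
    (isClosed_closure.preimage projL.continuous).measurableSet
  rw [← lintegral_const_mul' _ _ ENNReal.ofReal_ne_top, ← lintegral_indicator hm]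
  refine lintegral_mono fun x => ?_
  by_cases hx : x ∈ channel D
  · rw [Set.indicator_of_mem (by exact subset_closure hx.1)]
  · simp [hu.zero _ x hx]

/-- Korn's inequality near a point. -/
lemma exists_local_korn_constant (hD : IsOpen D) (hbd : Bornology.IsBounded D)
    (hlip : HasLipschitzBoundary D) {p : E2} (hp : p ∈ closure D) :
    ∃ t ∈ nhds p, ∃ C : ENNReal, C ≠ ⊤ ∧ ∀ u G, IsExtendedField D u G →
      ∫⁻ x in proj ⁻¹' t, ENNReal.ofReal (∑ i, ∑ j, G i j x ^ 2) ≤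
        C * ((∫⁻ x, ENNReal.ofReal (symSq G x)) + ∫⁻ x, ENNReal.ofReal (∑ j, u j x ^ 2)) := by
  obtain ⟨δ, M, ρ, ν, hδ, hM, hν, hρ, hρν, hchart⟩ := hlip.exists_chart hD hp
  obtain ⟨K, hK, hkorn⟩ := exists_weak_korn_constant 3 hM
  let χ : ContDiffBump p := ⟨δ / 4, δ / 2, by positivity, by linarith⟩
  -- A cutoff in the plane variables suffices, since the extended field already vanishes for `|ξ| >
  -- 1`. Its derivative produces the term `∫|u|²` on the right-hand side.
  set m : E3 → ℝ := fun x => χ (proj x) with hm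
  have hps : ContDiff ℝ ∞ proj := projL.contDiff
  have hms : ContDiff ℝ ∞ m := χ.contDiff.comp hps
  have hm1 : ∀ x, |m x| ≤ 1 := fun x => by rw [abs_of_nonneg χ.nonneg]; exact χ.le_one
  obtain ⟨B, hB⟩ : ∃ B : ℝ, ∀ y, ‖fderiv ℝ χ y‖ ≤ B :=
    (χ.hasCompactSupport.fderiv ℝ).exists_bound_of_continuous
      ((χ.contDiff (n := 1)).continuous_fderiv (by simp))
  have hB0 : 0 ≤ B := (norm_nonneg _).trans (hB 0)
  have hdm : ∀ x i, |partialD i m x| ≤ B := by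
    intro x i
    have h1 : fderiv ℝ m x = (fderiv ℝ χ (proj x)).comp projL :=
      (((χ.contDiff (n := 1)).differentiable (by simp) (proj x)).hasFDerivAt.comp x
        projL.hasFDerivAt).fderiv
    rw [partialD, h1, ContinuousLinearMap.comp_apply, ← Real.norm_eq_abs]
    refine ((fderiv ℝ χ (proj x)).le_opNorm _).trans ?_
    have h2 := norm_proj_le (EuclideanSpace.single i 1)
    rw [PiLp.norm_single, norm_one] at h2
    calc _ ≤ B * 1 := mul_le_mul (hB _) h2 (norm_nonneg _) hB0
      _ = B := mul_one B
  have hm_one : ∀ x, proj x ∈ Metric.ball p (δ / 4) → m x = 1 ∧ ∀ i, partialD i m x = 0 := by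
    intro x hx
    have hev : m =ᶠ[nhds x] fun _ => 1 := by
      have : proj ⁻¹' Metric.ball p (δ / 4) ∈ nhds x :=
        (Metric.isOpen_ball.preimage projL.continuous).mem_nhds hx
      filter_upwards [this] with y hy
      exact χ.one_of_mem_closedBall (Metric.ball_subset_closedBall hy)
    refine ⟨hev.eq_of_nhds, fun i => ?_⟩
    rw [partialD, hev.fderiv_eq]
    simp
  refine ⟨Metric.ball p (δ / 4), Metric.ball_mem_nhds _ (by positivity),
    K * ENNReal.ofReal (2 + 6 * B ^ 2), ENNReal.mul_ne_top hK ENNReal.ofReal_ne_top,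
    fun u G hu => ?_⟩
  obtain ⟨R, hR⟩ := exists_norm_le_of_mem_channel hbd
  have hcd : ∀ i, Continuous (partialD i m) := fun i => (contDiff_partialD hms i).continuous
  have hul : ∀ j, LocallyIntegrable (u j) := fun j => (hu.memLp j).locallyIntegrable (by norm_num)
  have hGl : ∀ i j, LocallyIntegrable (G i j) := fun i j =>
    (hu.memLp_deriv i j).locallyIntegrable (by norm_num)
  have key := hkorn (fun x => ρ (proj x)) (liftVec ν 0) (fun j x => m x * u j x)
    (fun i j x => m x * G i j x + partialD i m x * u j x)
    (fun x y => (hρ _ _).trans (mul_le_mul_of_nonneg_left (by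
      rw [← projL_apply, ← projL_apply, ← map_sub]; exact norm_proj_le _) (by linarith)))
    (by
      refine (norm_le_norm_proj_add _).trans ?_
      rw [proj_liftVec, liftVec_two]; simpa using hν)
    (fun x t => by rw [proj_add_smul, proj_liftVec, hρν])
    (fun j => memLp_of_abs_le (C := 1) (hu.memLp j)
      (hms.continuous.aestronglyMeasurable.mul (hu.memLp j).1) fun x => by
        rw [abs_mul]; exact mul_le_mul_of_nonneg_right (hm1 x) (abs_nonneg _))
    (fun j => hasCompactSupport_of_forall_norm (R := R) fun x hx => by
      have : x ∉ channel D := fun h => absurd (hR x h) (not_le.2 hx)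
      simp [hu.zero _ x this])
    (fun i j => (memLp_of_abs_le (f := fun x => m x * G i j x) (C := 1) (hu.memLp_deriv i j)
      (hms.continuous.aestronglyMeasurable.mul (hu.memLp_deriv i j).1) fun x => by
        rw [abs_mul]; exact mul_le_mul_of_nonneg_right (hm1 x) (abs_nonneg _)).add
      (memLp_of_abs_le (f := fun x => partialD i m x * u j x) (C := B) (hu.memLp j)
      ((hcd i).aestronglyMeasurable.mul (hu.memLp j).1) fun x => by
        rw [abs_mul]; exact mul_le_mul_of_nonneg_right (hdm x i) (abs_nonneg _)))
    (fun i j => (hu.weak i j).mul (hul j) (hGl i j) hms (by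
      rintro x ⟨hx1, hx2⟩
      refine Or.inl ((hchart _ ?_).2 hx2)
      have h3 : proj x ∈ Metric.closedBall p (δ / 2) := by
        have := tsupport_comp_subset_preimage (f := proj) χ hps.continuous hx1
        rw [Set.mem_preimage, χ.tsupport_eq] at this
        exact this
      exact Metric.closedBall_subset_ball (by linarith) h3))
  have hpm : MeasurableSet (proj ⁻¹' Metric.ball p (δ / 4)) :=
    (Metric.isOpen_ball.preimage projL.continuous).measurableSet
  have hρm : MeasurableSet {x : E3 | 0 < ρ (proj x)} :=
    (isOpen_lt continuous_const ((continuous_of_abs_sub_le hρ).comp projL.continuous)).measurableSet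
  rw [mul_assoc]
  refine le_trans ?_ (key.trans (mul_le_mul_right ?_ _))
  · rw [← lintegral_indicator hpm, ← lintegral_indicator hρm]
    refine lintegral_mono fun x => ?_
    by_cases hx : x ∈ proj ⁻¹' Metric.ball p (δ / 4)
    swap
    · rw [Set.indicator_of_notMem hx]; exact zero_le
    rw [Set.indicator_of_mem hx]
    by_cases hxc : x ∈ channel D
    swap
    · simp [hu.zero_deriv _ _ x hxc]
    have hx1 : 0 < ρ (proj x) :=
      (hchart _ (Metric.ball_subset_ball (by linarith) hx)).1 hxc.1
    rw [Set.indicator_of_mem (by exact hx1), (hm_one x hx).1]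
    simp [(hm_one x hx).2]
  · rw [← lintegral_add_left' hu.aemeasurable_symSq, ← lintegral_const_mul' _ _ ENNReal.ofReal_ne_top]
    refine lintegral_mono fun x => ?_
    have hnn : 0 ≤ ∑ j, u j x ^ 2 := Finset.sum_nonneg fun _ _ => sq_nonneg _
    have hsn := symSq_nonneg G x
    rw [← ENNReal.ofReal_add hsn hnn, ← ENNReal.ofReal_mul (by positivity)]
    refine ENNReal.ofReal_le_ofReal ?_
    -- Summed over the nine pairs, the terms `B²(u_i² + u_j²)` give `6B²|u|²`, whence the constant
    -- `2 + 6B²`.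
    have hterm : ∀ i j, ((m x * G i j x + partialD i m x * u j x +
        (m x * G j i x + partialD j m x * u i x)) / 2) ^ 2 ≤
        2 * ((G i j x + G j i x) / 2) ^ 2 + B ^ 2 * (u i x ^ 2 + u j x ^ 2) := by
      intro i j
      have h1 : (m x) ^ 2 ≤ 1 := by rw [← sq_abs]; exact pow_le_one₀ (abs_nonneg _) (hm1 x)
      have h2 : ∀ i, (partialD i m x) ^ 2 ≤ B ^ 2 := fun i => by
        rw [← sq_abs]; exact pow_le_pow_left₀ (abs_nonneg _) (hdm x i) 2
      have h3 : (m x * ((G i j x + G j i x) / 2)) ^ 2 ≤ ((G i j x + G j i x) / 2) ^ 2 := by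
        rw [mul_pow]; exact mul_le_of_le_one_left (sq_nonneg _) h1
      have h4 : (partialD i m x * u j x) ^ 2 ≤ B ^ 2 * u j x ^ 2 := by
        rw [mul_pow]; exact mul_le_mul_of_nonneg_right (h2 i) (sq_nonneg _)
      have h5 : (partialD j m x * u i x) ^ 2 ≤ B ^ 2 * u i x ^ 2 := by
        rw [mul_pow]; exact mul_le_mul_of_nonneg_right (h2 j) (sq_nonneg _)
      nlinarith [sq_nonneg (partialD i m x * u j x - partialD j m x * u i x),
        sq_nonneg (m x * ((G i j x + G j i x) / 2) -
          (partialD i m x * u j x + partialD j m x * u i x) / 2)]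
    refine (Finset.sum_le_sum fun i _ => Finset.sum_le_sum fun j _ => hterm i j).trans ?_
    have h6 : ∑ i, ∑ j, (2 * ((G i j x + G j i x) / 2) ^ 2 + B ^ 2 * (u i x ^ 2 + u j x ^ 2)) =
        2 * symSq G x + 6 * B ^ 2 * ∑ j, u j x ^ 2 := by
      simp only [symSq, Fin.sum_univ_three]
      ring
    rw [h6]
    nlinarith [mul_nonneg (sq_nonneg B) hsn]

/-- Korn's inequality `∫|∇u|² ≤ C(∫|e(u)|² + ∫|u|²)`. -/
theorem exists_global_korn_constant (hD : IsOpen D) (hbd : Bornology.IsBounded D)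
    (hlip : HasLipschitzBoundary D) : ∃ C : ENNReal, C ≠ ⊤ ∧ ∀ u G, IsExtendedField D u G →
      ∫⁻ x, ENNReal.ofReal (∑ i, ∑ j, G i j x ^ 2) ≤
        C * ((∫⁻ x, ENNReal.ofReal (symSq G x)) + ∫⁻ x, ENNReal.ofReal (∑ j, u j x ^ 2)) := by
  let ι := {q : (Fin 3 → E3 → ℝ) × (Fin 3 → Fin 3 → E3 → ℝ) // IsExtendedField D q.1 q.2}
  obtain ⟨C, hC, h⟩ := exists_const_of_locally hbd.isCompact_closure (ι := ι)
    (fun q x => ENNReal.ofReal (∑ i, ∑ j, q.1.2 i j x ^ 2))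
    (fun q => (∫⁻ x, ENNReal.ofReal (symSq q.1.2 x)) + ∫⁻ x, ENNReal.ofReal (∑ j, q.1.1 j x ^ 2))
    (fun p hp => by
      obtain ⟨t, ht, C, hC, h⟩ := exists_local_korn_constant hD hbd hlip hp
      exact ⟨t, ht, C, hC, fun q => h q.1.1 q.1.2 q.2⟩)
  refine ⟨C, hC, fun u G hu => le_trans ?_ (h ⟨(u, G), hu⟩)⟩
  have hm : MeasurableSet (proj ⁻¹' closure D) :=
    (isClosed_closure.preimage projL.continuous).measurableSet
  rw [← lintegral_indicator hm]
  refine lintegral_mono fun x => ?_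
  by_cases hx : x ∈ channel D
  · rw [Set.indicator_of_mem (by exact subset_closure hx.1)]
  · simp [hu.zero_deriv _ _ x hx]

end Global

/-! ### Absorption of lower order terms -/

section Coercive

variable {D : Set E2} {u : Fin 3 → E3 → ℝ} {G : Fin 3 → Fin 3 → E3 → ℝ}

lemma IsExtendedField.integrable_sum_sq (hu : IsExtendedField D u G) :
    Integrable fun x => ∑ j, u j x ^ 2 :=
  integrable_finsetSum _ fun j _ => (hu.memLp j).integrable_sq

lemma IsExtendedField.integrable_sum_sq_deriv (hu : IsExtendedField D u G) :
    Integrable fun x => ∑ i, ∑ j, G i j x ^ 2 :=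
  integrable_finsetSum _ fun i _ => integrable_finsetSum _ fun j _ =>
    (hu.memLp_deriv i j).integrable_sq

lemma IsExtendedField.integrable_symSq (hu : IsExtendedField D u G) :
    Integrable (symSq G) :=
  integrable_finsetSum _ fun i _ => integrable_finsetSum _ fun j _ => by
    have h : MemLp (fun x => (G i j x + G j i x) / 2) 2 := by
      exact (((hu.memLp_deriv i j).add (hu.memLp_deriv j i)).const_mul (2⁻¹ : ℝ)).ae_eq
        (Filter.Eventually.of_forall fun x => by simp only [Pi.add_apply]; ring)
    exact h.integrable_sq

lemma IsExtendedField.symSq_eq_zero (hu : IsExtendedField D u G) {x : E3} (hx : x ∉ channel D) :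
    symSq G x = 0 := by
  simp [symSq, hu.zero_deriv _ _ x hx]

lemma IsExtendedField.sum_sq_eq_zero (hu : IsExtendedField D u G) {x : E3} (hx : x ∉ channel D) :
    ∑ j, u j x ^ 2 = 0 := by
  simp [hu.zero _ x hx]

lemma exp_le_of_mem_channel {l : ℝ} (hl : 0 < l) {x : E3} (hx : x ∈ channel D) :
    Real.exp (l * x 2) ≤ Real.exp l :=
  Real.exp_le_exp.2 (by nlinarith [hx.2.2])

lemma one_le_of_mem_channel {l : ℝ} (hl : 0 < l) {x : E3} (hx : x ∈ channel D) :
    1 ≤ Real.exp l * Real.exp (l * x 2) := by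
  rw [← Real.exp_add]
  exact Real.one_le_exp (by nlinarith [hx.2.1])

lemma integrable_exp_mul {f : E3 → ℝ} (hf : Integrable f) (h0 : ∀ x ∉ channel D, f x = 0) {l : ℝ}
    (hl : 0 < l) : Integrable fun x : E3 => Real.exp (l * x 2) * f x := by
  have hc : Continuous fun x : E3 => Real.exp (l * x 2) := by fun_prop
  refine (hf.const_mul (Real.exp l)).mono (hc.aestronglyMeasurable.mul hf.1)
    (Filter.Eventually.of_forall fun x => ?_)
  by_cases hx : x ∈ channel D
  · rw [norm_mul, norm_mul, Real.norm_of_nonneg (Real.exp_pos _).le,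
      Real.norm_of_nonneg (Real.exp_pos _).le]
    exact mul_le_mul_of_nonneg_right (exp_le_of_mem_channel hl hx) (norm_nonneg _)
  · simp [h0 x hx]

/-- A field whose symmetric gradient is controlled by `q` up to lower order terms is controlled
by `q`. -/
theorem exists_coercive_constant (hD : IsOpen D) (hbd : Bornology.IsBounded D)
    (hlip : HasLipschitzBoundary D) {a b : ℝ} (ha : 0 ≤ a) (hb : 0 ≤ b) :
    ∃ C : ℝ, 0 ≤ C ∧ ∀ u G, IsExtendedField D u G → ∀ q : E3 → ℝ, Integrable q → (∀ x, 0 ≤ q x) →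
      (∀ x ∉ channel D, q x = 0) → (∀ x, symSq G x ≤ a * q x + b * ∑ j, u j x ^ 2) →
      (∫ x, ∑ j, u j x ^ 2) + ∫ x, ∑ i, ∑ j, G i j x ^ 2 ≤ C * ∫ x, q x := by
  obtain ⟨CA, hCA, hA⟩ := exists_poincare_constant hD hbd hlip
  obtain ⟨CB, hCB, hB⟩ := exists_global_korn_constant hD hbd hlip
  set A := CA.toReal with hAdef
  set B := CB.toReal with hBdef
  have hA0 : 0 ≤ A := ENNReal.toReal_nonneg
  have hB0 : 0 ≤ B := ENNReal.toReal_nonneg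
  -- With `l² = 1 + Ab` the weighted inequality `l²P ≤ A(aQ + bP)` becomes `P ≤ AaQ`. The weight
  -- lies between `e^{-l}` and `e^l` on the channel; removing it from both sides costs the two
  -- factors `e` in `U`.
  set l : ℝ := √(1 + A * b) with hldef
  have hl2 : l ^ 2 = 1 + A * b := Real.sq_sqrt (by positivity)
  have hl : 0 < l := Real.sqrt_pos.2 (by positivity)
  set e := Real.exp l with he
  have he0 : 0 < e := Real.exp_pos l
  set U := e * (A * a * e) with hU
  refine ⟨U + B * (a + b * U + U), by positivity, fun u G hu q hq hq0 hqc hsym => ?_⟩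
  have iu := hu.integrable_sum_sq
  have iG := hu.integrable_sum_sq_deriv
  have isy := hu.integrable_symSq
  have iue := integrable_exp_mul iu (fun x hx => hu.sum_sq_eq_zero hx) hl
  have ise := integrable_exp_mul isy (fun x hx => hu.symSq_eq_zero hx) hl
  have iqe := integrable_exp_mul hq hqc hl
  have nu : ∀ x, 0 ≤ ∑ j, u j x ^ 2 := fun x => Finset.sum_nonneg fun _ _ => sq_nonneg _
  have nG : ∀ x, 0 ≤ ∑ i, ∑ j, G i j x ^ 2 := fun x =>
    Finset.sum_nonneg fun _ _ => Finset.sum_nonneg fun _ _ => sq_nonneg _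
  have ns := symSq_nonneg G
  have nq : 0 ≤ ∫ x, q x := integral_nonneg hq0
  have conv : ∀ {f : E3 → ℝ}, Integrable f → (∀ x, 0 ≤ f x) →
      ∫⁻ x, ENNReal.ofReal (f x) = ENNReal.ofReal (∫ x, f x) := fun hf h0 =>
    (ofReal_integral_eq_lintegral_ofReal hf (Filter.Eventually.of_forall h0)).symm
  have hA' : l ^ 2 * ∫ x : E3, Real.exp (l * x 2) * ∑ j, u j x ^ 2 ≤
      A * ∫ x : E3, Real.exp (l * x 2) * symSq G x := by
    have h1 := hA u G hu l hl
    rw [conv iue fun x => mul_nonneg (Real.exp_pos _).le (nu x),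
      conv ise fun x => mul_nonneg (Real.exp_pos _).le (ns x), ← ENNReal.ofReal_toReal hCA,
      ← ENNReal.ofReal_mul (sq_nonneg l), ← ENNReal.ofReal_mul hA0] at h1
    exact (ENNReal.ofReal_le_ofReal_iff (mul_nonneg hA0 (integral_nonneg fun x =>
      mul_nonneg (Real.exp_pos _).le (ns x)))).1 h1
  have nsi : 0 ≤ ∫ x, symSq G x := integral_nonneg ns
  have nui : 0 ≤ ∫ x, ∑ j, u j x ^ 2 := integral_nonneg nu
  have hB' : ∫ x, ∑ i, ∑ j, G i j x ^ 2 ≤ B * ((∫ x, symSq G x) + ∫ x, ∑ j, u j x ^ 2) := by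
    have h1 := hB u G hu
    rw [conv iG nG, conv isy ns, conv iu nu, ← ENNReal.ofReal_toReal hCB,
      ← ENNReal.ofReal_add nsi nui, ← ENNReal.ofReal_mul hB0] at h1
    exact (ENNReal.ofReal_le_ofReal_iff (mul_nonneg hB0 (add_nonneg nsi nui))).1 h1
  have h1 : ∫ x : E3, Real.exp (l * x 2) * symSq G x ≤
      a * (∫ x : E3, Real.exp (l * x 2) * q x) +
        b * ∫ x : E3, Real.exp (l * x 2) * ∑ j, u j x ^ 2 := by
    rw [← integral_const_mul, ← integral_const_mul,
      ← integral_add (iqe.const_mul a) (iue.const_mul b)]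
    refine integral_mono ise ((iqe.const_mul a).add (iue.const_mul b)) fun x => ?_
    have := mul_le_mul_of_nonneg_left (hsym x) (Real.exp_pos (l * x 2)).le
    refine this.trans (le_of_eq ?_)
    ring
  have h2 : ∫ x : E3, Real.exp (l * x 2) * q x ≤ e * ∫ x, q x := by
    rw [← integral_const_mul]
    refine integral_mono iqe (hq.const_mul e) fun x => ?_
    by_cases hx : x ∈ channel D
    · exact mul_le_mul_of_nonneg_right (exp_le_of_mem_channel hl hx) (hq0 x)
    · simp [hqc x hx]
  have h3 : ∫ x, ∑ j, u j x ^ 2 ≤ e * ∫ x : E3, Real.exp (l * x 2) * ∑ j, u j x ^ 2 := by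
    rw [← integral_const_mul]
    refine integral_mono iu (iue.const_mul e) fun x => ?_
    by_cases hx : x ∈ channel D
    · have := mul_le_mul_of_nonneg_right (one_le_of_mem_channel hl hx) (nu x)
      rw [one_mul, mul_assoc] at this
      exact this
    · simp [hu.sum_sq_eq_zero hx]
  have h4 : ∫ x, symSq G x ≤ a * (∫ x, q x) + b * ∫ x, ∑ j, u j x ^ 2 := by
    rw [← integral_const_mul, ← integral_const_mul,
      ← integral_add (hq.const_mul a) (iu.const_mul b)]
    exact integral_mono isy ((hq.const_mul a).add (iu.const_mul b)) hsym
  have h5 : ∫ x : E3, Real.exp (l * x 2) * ∑ j, u j x ^ 2 ≤ A * a * e * ∫ x, q x := by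
    have h6 := mul_le_mul_of_nonneg_left h1 hA0
    have h7 := mul_le_mul_of_nonneg_left h2 (mul_nonneg hA0 ha)
    rw [hl2] at hA'
    nlinarith
  have h6 : ∫ x, ∑ j, u j x ^ 2 ≤ U * ∫ x, q x := by
    refine h3.trans ((mul_le_mul_of_nonneg_left h5 he0.le).trans (le_of_eq ?_))
    rw [hU]; ring
  have h7 : ∫ x, symSq G x ≤ (a + b * U) * ∫ x, q x := by
    have := mul_le_mul_of_nonneg_left h6 hb
    linarith
  have h8 := mul_le_mul_of_nonneg_left (add_le_add h7 h6) hB0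
  linarith

end Coercive

/-! ### Covariant components and extension by zero -/

section Extension

variable {D : Set E2}

/-- Within the open set where weak derivatives of the extension are claimed, the boundary of the
channel consists of points on the blade faces only. The trace condition on `γ₀` is therefore not
needed, and the constants are independent of `γ₀`. -/
lemma mem_solidWall_of_mem_frontier (hD : IsOpen D) (γ₀ : Set E2) {x : E3}
    (hx : x ∈ frontier (channel D)) (hxO : x ∈ {x : E3 | proj x ∈ D} ∪ {x | 1 < |x 2|}) :
    x ∈ solidWall D γ₀ := by
  rw [frontier, (isOpen_channel hD).interior_eq] at hx
  have h2 : Continuous fun x : E3 => x 2 := by fun_prop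
  have hcl : x ∈ {x : E3 | -1 ≤ x 2 ∧ x 2 ≤ 1} :=
    closure_minimal (t := {x : E3 | -1 ≤ x 2 ∧ x 2 ≤ 1}) (fun y hy => ⟨hy.2.1.le, hy.2.2.le⟩)
      ((isClosed_le continuous_const h2).inter (isClosed_le h2 continuous_const)) hx.1
  rcases hxO with h | h
  · refine Or.inr ⟨subset_closure h, ?_⟩
    by_contra hne
    rw [not_or] at hne
    exact hx.2 ⟨h, lt_of_le_of_ne hcl.1 (Ne.symm hne.2), lt_of_le_of_ne hcl.2 hne.1⟩
  · exact absurd (abs_le.2 hcl) (not_le.2 h)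

/-- A Sobolev field which vanishes on the blade faces has weak derivatives across them after
extension by zero. -/
lemma H1Field.VanishesOn.hasWeakDeriv {γ₀ : Set E2} (hD : IsOpen D) {w : H1Field (channel D)}
    (hw : w.VanishesOn (solidWall D γ₀)) (i j : Fin 3) :
    HasWeakDeriv volume ({x : E3 | proj x ∈ D} ∪ {x | 1 < |x 2|}) (EuclideanSpace.single i 1)
      ((channel D).indicator (w.val j)) ((channel D).indicator (w.deriv i j)) := by
  intro η hη hηc hηO
  have hm : MeasurableSet (channel D) := (isOpen_channel hD).measurableSet
  have h := hw i j η hη hηc fun x hx => mem_solidWall_of_mem_frontier hD γ₀ hx.2 (hηO hx.1)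
  have e : ∀ f g : E3 → ℝ, ∫ x, (channel D).indicator f x * g x = ∫ x in channel D, f x * g x := by
    intro f g
    rw [← integral_indicator hm]
    exact integral_congr_ae (Filter.Eventually.of_forall fun x =>
      (Set.indicator_mul_left (channel D) f g).symm)
  rw [e, e]
  exact h

/-- The factors which turn `(w¹, w², w³)` into the covariant components for `Θ = 0`. -/
noncomputable def lowerCoeff (ε : ℝ) (j : Fin 3) (x : E3) : ℝ :=
  if j = 2 then ε ^ 2 * x 1 ^ 2 else 1

/-- The derivatives of `lowerCoeff`. -/
noncomputable def lowerCoeffD (ε : ℝ) (i j : Fin 3) (x : E3) : ℝ :=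
  if j = 2 ∧ i = 1 then 2 * ε ^ 2 * x 1 else 0

lemma contDiff_lowerCoeff (ε : ℝ) (j : Fin 3) : ContDiff ℝ ∞ (lowerCoeff ε j) := by
  have h1 : ContDiff ℝ ∞ fun x : E3 => x 1 := by fun_prop
  unfold lowerCoeff
  by_cases hj : j = 2
  · simp only [hj, if_true]; fun_prop
  · simp only [hj, if_false]; fun_prop

lemma hasFDerivAt_coord {n : ℕ} (i : Fin n) (x : EuclideanSpace ℝ (Fin n)) :
    HasFDerivAt (fun x : EuclideanSpace ℝ (Fin n) => x i)
      (EuclideanSpace.proj i : EuclideanSpace ℝ (Fin n) →L[ℝ] ℝ) x :=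
  (EuclideanSpace.proj i : EuclideanSpace ℝ (Fin n) →L[ℝ] ℝ).hasFDerivAt

lemma partialD_lowerCoeff (ε : ℝ) (i j : Fin 3) (x : E3) :
    partialD i (lowerCoeff ε j) x = lowerCoeffD ε i j x := by
  by_cases hj : j = 2
  · subst hj
    have h := ((hasFDerivAt_coord (1 : Fin 3) x).pow 2).const_mul (ε ^ 2)
    have h1 : lowerCoeff ε 2 = fun y => ε ^ 2 * y 1 ^ 2 := by ext y; simp [lowerCoeff]
    rw [partialD, h1, h.fderiv]
    fin_cases i <;> simp [lowerCoeffD]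
    ring
  · have : lowerCoeff ε j = fun _ => 1 := by ext y; simp [lowerCoeff, hj]
    simp [partialD, this, lowerCoeffD, hj]

variable {ε r₀ R : ℝ}

lemma exists_radius_bound (hbd : Bornology.IsBounded D) : ∃ R, ∀ x ∈ D, x 1 ≤ R := by
  obtain ⟨R, hR⟩ := hbd.exists_norm_le
  exact ⟨R, fun x hx => (le_abs_self _).trans ((PiLp.norm_apply_le x 1).trans (hR x hx))⟩

lemma indicator_memLp {f : E3 → ℝ} (hD : IsOpen D) (hf : MemLp f 2 (volume.restrict (channel D))) :
    MemLp ((channel D).indicator f) 2 :=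
  (memLp_indicator_iff_restrict (isOpen_channel hD).measurableSet).2 hf

lemma memLp_mul_of_bounded {f c : E3 → ℝ} {B : ℝ} {S : Set E3} (hS : MeasurableSet S)
    (hf : MemLp f 2 (volume.restrict S)) (hc : Measurable c) (hB : ∀ x ∈ S, |c x| ≤ B) :
    MemLp (fun x => c x * f x) 2 (volume.restrict S) :=
  hf.of_le_mul (c := B) (hc.aestronglyMeasurable.mul hf.1) <|
    (ae_restrict_iff' hS).2 <| Filter.Eventually.of_forall fun x hx => by
      rw [norm_mul]; exact mul_le_mul_of_nonneg_right (hB x hx) (norm_nonneg _)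

lemma measurable_coord (i : Fin 3) : Measurable fun x : E3 => x i := by fun_prop

/-- The extension by zero of the covariant components of a field that vanishes on the blades. -/
lemma H1Field.VanishesOn.isExtendedField {γ₀ : Set E2} (hD : IsOpen D)
    (hr₀ : 0 < r₀) (hr : ∀ x ∈ D, r₀ ≤ x 1) (hR : ∀ x ∈ D, x 1 ≤ R) {w : H1Field (channel D)}
    (hw : w.VanishesOn (solidWall D γ₀)) :
    IsExtendedField D (fun j x => lowerCoeff ε j x * (channel D).indicator (w.val j) x)
      (fun i j x => lowerCoeff ε j x * (channel D).indicator (w.deriv i j) x +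
        lowerCoeffD ε i j x * (channel D).indicator (w.val j) x) := by
  have hΩ : MeasurableSet (channel D) := (isOpen_channel hD).measurableSet
  have hv : ∀ j, MemLp ((channel D).indicator (w.val j)) 2 := fun j =>
    indicator_memLp hD (w.memLp_val j)
  have hd : ∀ i j, MemLp ((channel D).indicator (w.deriv i j)) 2 := fun i j =>
    indicator_memLp hD (w.memLp_deriv i j)
  have hb : ∀ x ∈ channel D, r₀ ≤ x 1 ∧ x 1 ≤ R := fun x hx => by
    have := hr _ hx.1
    have := hR _ hx.1
    simp only [proj] at *
    exact ⟨‹_›, ‹_›⟩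
  have hc1 : ∀ j, ∀ x ∈ channel D, |lowerCoeff ε j x| ≤ 1 + ε ^ 2 * R ^ 2 := fun j x hx => by
    obtain ⟨h1, h2⟩ := hb x hx
    have h3 : x 1 ^ 2 ≤ R ^ 2 := pow_le_pow_left₀ (by linarith) h2 2
    have h4 := mul_le_mul_of_nonneg_left h3 (sq_nonneg ε)
    rw [lowerCoeff]
    split_ifs
    · rw [abs_of_nonneg (by positivity)]; linarith
    · rw [abs_one]; linarith [mul_nonneg (sq_nonneg ε) (sq_nonneg R)]
  have hc2 : ∀ i j, ∀ x ∈ channel D, |lowerCoeffD ε i j x| ≤ 2 * ε ^ 2 * R := fun i j x hx => by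
    obtain ⟨h1, h2⟩ := hb x hx
    have h4 := mul_le_mul_of_nonneg_left h2 (sq_nonneg ε)
    have h5 : 0 ≤ ε ^ 2 * x 1 := mul_nonneg (sq_nonneg ε) (by linarith)
    rw [lowerCoeffD]
    split_ifs
    · rw [abs_of_nonneg (by linarith)]; linarith
    · rw [abs_zero]; linarith
  have hm1 : ∀ j, Continuous (lowerCoeff ε j) := fun j => (contDiff_lowerCoeff ε j).continuous
  have hm2 : ∀ i j, Continuous (lowerCoeffD ε i j) := fun i j => by
    rw [show lowerCoeffD ε i j = partialD i (lowerCoeff ε j) from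
      (funext (partialD_lowerCoeff ε i j)).symm]
    exact (contDiff_partialD (contDiff_lowerCoeff ε j) i).continuous
  have hmul : ∀ {c f : E3 → ℝ} {B : ℝ}, Continuous c → (∀ x ∈ channel D, |c x| ≤ B) →
      MemLp ((channel D).indicator f) 2 → MemLp (fun x => c x * (channel D).indicator f x) 2 := by
    intro c f B hc hB hf
    refine memLp_of_abs_le (C := B) hf (hc.aestronglyMeasurable.mul hf.1) fun x => ?_
    by_cases hx : x ∈ channel D
    · rw [abs_mul]; exact mul_le_mul_of_nonneg_right (hB x hx) (abs_nonneg _)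
    · simp [hx]
  refine ⟨fun j => hmul (hm1 j) (hc1 j) (hv j),
    fun i j => (hmul (hm1 j) (hc1 j) (hd i j)).add (hmul (hm2 i j) (hc2 i j) (hv j)),
    fun j x hx => by simp [hx], fun i j x hx => by simp [hx], fun i j => ?_⟩
  have h := (hw.hasWeakDeriv hD i j).mul ((hv j).locallyIntegrable (by norm_num))
    ((hd i j).locallyIntegrable (by norm_num)) (contDiff_lowerCoeff ε j) (H := _)
    Set.inter_subset_right
  have h2 : ∀ x, fderiv ℝ (lowerCoeff ε j) x (EuclideanSpace.single i 1) = lowerCoeffD ε i j x :=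
    partialD_lowerCoeff ε i j
  simpa only [h2] using h

end Extension

/-! ### Coercivity of the norm `‖·‖_Ω` -/

section OmegaNorm

variable {D : Set E2} {ε r₀ R : ℝ}

lemma radius_mem_Icc (hr : ∀ x ∈ D, r₀ ≤ x 1) (hR : ∀ x ∈ D, x 1 ≤ R) {x : E3}
    (hx : x ∈ channel D) : x 1 ∈ Set.Icc r₀ R := by
  have h1 := hr _ hx.1
  have h2 := hR _ hx.1
  simp only [proj] at h1 h2
  exact ⟨h1, h2⟩

lemma memLp_radial_mul (hD : IsOpen D) (hr₀ : 0 < r₀) (hr : ∀ x ∈ D, r₀ ≤ x 1)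
    (hR : ∀ x ∈ D, x 1 ≤ R) {f : E3 → ℝ} (hf : MemLp f 2 (volume.restrict (channel D))) {c : ℝ → ℝ}
    (hc : Measurable c) (hcc : ContinuousOn c (Set.Ioi 0)) :
    MemLp (fun x => c (x 1) * f x) 2 (volume.restrict (channel D)) := by
  obtain ⟨B, hB⟩ := isCompact_Icc.exists_bound_of_continuousOn
    (hcc.mono fun y (hy : y ∈ Set.Icc r₀ R) => hr₀.trans_le hy.1)
  exact memLp_mul_of_bounded (isOpen_channel hD).measurableSet hf (hc.comp (measurable_coord 1))
    fun x hx => hB _ (radius_mem_Icc hr hR hx)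

variable (ε) in
/-- The components of `φ_{ij}(w)` in the orthonormal frame for `Θ = 0`. -/
noncomputable def phiFrame {Ω : Set E3} (w : H1Field Ω) (a b : Fin 3) (x : E3) : ℝ :=
  !![phiTan w 0 0 x, phiTan w 0 1 x, phiMix ε w 0 x / (x 1 * ε);
     phiTan w 1 0 x, phiTan w 1 1 x, phiMix ε w 1 x / (x 1 * ε);
     phiMix ε w 0 x / (x 1 * ε), phiMix ε w 1 x / (x 1 * ε), phiNormal ε w x / (x 1 * ε) ^ 2] a b

variable (ε) in
/-- The integrand of `‖w‖²_Ω`. -/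
noncomputable def phiDensity {Ω : Set E3} (w : H1Field Ω) (x : E3) : ℝ :=
  (∑ a, ∑ b, phiFrame ε w a b x ^ 2) * (x 1 * ε)

lemma omegaNormSq_eq {Ω : Set E3} (w : H1Field Ω) :
    omegaNormSq ε w = ∫ x in Ω, phiDensity ε w x := by
  unfold omegaNormSq
  congr 1
  ext x
  rw [phiDensity]
  congr 1
  simp only [Fin.sum_univ_three, Fin.sum_univ_two, phiFrame]
  simp
  ring

lemma memLp_phiFrame (hD : IsOpen D) (hε : 0 < ε) (hr₀ : 0 < r₀) (hr : ∀ x ∈ D, r₀ ≤ x 1)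
    (hR : ∀ x ∈ D, x 1 ≤ R) (w : H1Field (channel D)) (a b : Fin 3) :
    MemLp (phiFrame ε w a b) 2 (volume.restrict (channel D)) := by
  have ht : ∀ α β, MemLp (phiTan w α β) 2 (volume.restrict (channel D)) := fun α β =>
    ((w.memLp_deriv β.castSucc α.castSucc).add (w.memLp_deriv α.castSucc β.castSucc)).const_mul _
  have hm : ∀ α, MemLp (fun x => phiMix ε w α x / (x 1 * ε)) 2 (volume.restrict (channel D)) := by
    intro α
    have h1 := memLp_radial_mul hD hr₀ hr hR (w.memLp_deriv 2 α.castSucc)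
      (c := fun y => (2 * ε * y)⁻¹) (by fun_prop)
      (ContinuousOn.inv₀ (by fun_prop) fun y (hy : 0 < y) => by positivity)
    have h2 := memLp_radial_mul hD hr₀ hr hR (w.memLp_deriv α.castSucc 2)
      (c := fun y => ε ^ 2 * y ^ 2 * (2 * ε * y)⁻¹) (by fun_prop)
      (ContinuousOn.mul (by fun_prop)
        (ContinuousOn.inv₀ (by fun_prop) fun y (hy : 0 < y) => by positivity))
    refine (h1.add h2).ae_eq (Filter.Eventually.of_forall fun x => ?_)
    simp only [Pi.add_apply, phiMix, mul_inv]
    ring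
  have hn : MemLp (fun x => phiNormal ε w x / (x 1 * ε) ^ 2) 2 (volume.restrict (channel D)) := by
    have h1 := memLp_radial_mul hD hr₀ hr hR (w.memLp_deriv 2 2)
      (c := fun y => ε ^ 2 * y ^ 2 * ((y * ε) ^ 2)⁻¹) (by fun_prop)
      (ContinuousOn.mul (by fun_prop)
        (ContinuousOn.inv₀ (by fun_prop) fun y (hy : 0 < y) => by positivity))
    have h2 := memLp_radial_mul hD hr₀ hr hR (w.memLp_val 1)
      (c := fun y => ε ^ 2 * y ^ 2 * ((y * ε) ^ 2)⁻¹ * y⁻¹) (by fun_prop)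
      (ContinuousOn.mul (ContinuousOn.mul (by fun_prop)
        (ContinuousOn.inv₀ (by fun_prop) fun y (hy : 0 < y) => by positivity))
        (ContinuousOn.inv₀ (by fun_prop) fun y (hy : 0 < y) => by positivity))
    refine (h1.add h2).ae_eq (Filter.Eventually.of_forall fun x => ?_)
    simp only [Pi.add_apply, phiNormal]
    ring
  fin_cases a <;> fin_cases b
  exacts [ht 0 0, ht 0 1, hm 0, ht 1 0, ht 1 1, hm 1, hm 0, hm 1, hn]

lemma integrableOn_phiDensity (hD : IsOpen D) (hε : 0 < ε) (hr₀ : 0 < r₀)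
    (hr : ∀ x ∈ D, r₀ ≤ x 1) (hR : ∀ x ∈ D, x 1 ≤ R) (w : H1Field (channel D)) :
    Integrable (phiDensity ε w) (volume.restrict (channel D)) := by
  have h : Integrable (fun x => ∑ a, ∑ b, phiFrame ε w a b x ^ 2) (volume.restrict (channel D)) :=
    integrable_finsetSum _ fun a _ => integrable_finsetSum _ fun b _ =>
      (memLp_phiFrame hD hε hr₀ hr hR w a b).integrable_sq
  refine (h.norm.const_mul (R * ε)).mono' (h.1.mul (by fun_prop)) ?_
  refine (ae_restrict_iff' (isOpen_channel hD).measurableSet).2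
    (Filter.Eventually.of_forall fun x hx => ?_)
  have hx1 := radius_mem_Icc hr hR hx
  have : 0 < x 1 := hr₀.trans_le hx1.1
  rw [phiDensity, norm_mul, mul_comm, Real.norm_of_nonneg (by positivity : 0 ≤ x 1 * ε)]
  exact mul_le_mul_of_nonneg_right (mul_le_mul_of_nonneg_right hx1.2 hε.le) (norm_nonneg _)

lemma phiDensity_nonneg (hε : 0 < ε) {Ω : Set E3} (w : H1Field Ω) {x : E3} (hx : 0 ≤ x 1) :
    0 ≤ phiDensity ε w x :=
  mul_nonneg (Finset.sum_nonneg fun _ _ => Finset.sum_nonneg fun _ _ => sq_nonneg _)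
    (mul_nonneg hx hε.le)

lemma integrableOn_h1 (w : H1Field (channel D)) :
    Integrable (fun x => (∑ j, w.val j x ^ 2) + ∑ i, ∑ j, w.deriv i j x ^ 2)
      (volume.restrict (channel D)) :=
  (integrable_finsetSum _ fun j _ => (w.memLp_val j).integrable_sq).add
    (integrable_finsetSum _ fun i _ => integrable_finsetSum _ fun j _ =>
      (w.memLp_deriv i j).integrable_sq)

lemma lowerCoeff_two (ε : ℝ) (x : E3) : lowerCoeff ε 2 x = (x 1 * ε) ^ 2 := by
  rw [lowerCoeff, if_pos rfl]; ring

lemma lowerCoeff_of_ne (ε : ℝ) {j : Fin 3} (hj : j ≠ 2) (x : E3) : lowerCoeff ε j x = 1 :=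
  if_neg hj

lemma lowerCoeffD_of_ne (ε : ℝ) (i : Fin 3) {j : Fin 3} (hj : j ≠ 2) (x : E3) :
    lowerCoeffD ε i j x = 0 :=
  if_neg fun h => hj h.1

/-- In the application `s = rε`, `t` is the tangential part, `P, Q, N` are the remaining frame
components and `v` is the field. Lowering the index multiplies frame components by `s` or `s²`;
differentiating `ε²r²` adds `εsv₂`, and removing `w²/r` from `φ_{33}` subtracts `εsv₁`. The division
by `s₀` accounts for the density `rε`. -/
lemma lowered_symSq_le {s s₀ S t P Q N v₀ v₁ v₂ : ℝ} (hs₀ : 0 < s₀) (hs : s₀ ≤ s) (hS : s ≤ S)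
    (ht : 0 ≤ t) :
    t + 2 * (s * P) ^ 2 + 2 * (s * Q + ε * s * v₂) ^ 2 + (s ^ 2 * N - ε * s * v₁) ^ 2 ≤
      2 * (1 + S ^ 2 + S ^ 4) / s₀ * ((t + 2 * P ^ 2 + 2 * Q ^ 2 + N ^ 2) * s) +
      (4 * ε ^ 2 / s₀ ^ 2 + 2 * ε ^ 2 * S ^ 2) * (v₀ ^ 2 + v₁ ^ 2 + (s ^ 2 * v₂) ^ 2) := by
  have hs' : 0 < s := hs₀.trans_le hs
  have h2 : s ^ 2 ≤ S ^ 2 := pow_le_pow_left₀ hs'.le hS 2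
  have h4 : s ^ 4 ≤ S ^ 4 := pow_le_pow_left₀ hs'.le hS 4
  set W := t + 2 * P ^ 2 + 2 * Q ^ 2 + N ^ 2 with hW
  have hW0 : 0 ≤ W := by positivity
  have e1 : t + 2 * (s ^ 2 * P ^ 2) + 2 * (s ^ 2 * Q ^ 2) + s ^ 4 * N ^ 2 ≤
      (1 + S ^ 2 + S ^ 4) * W := by
    have := mul_le_mul_of_nonneg_right h2 (sq_nonneg P)
    have := mul_le_mul_of_nonneg_right h2 (sq_nonneg Q)
    have := mul_le_mul_of_nonneg_right h4 (sq_nonneg N)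
    have := mul_nonneg (sq_nonneg S) ht
    have := mul_nonneg (sq_nonneg S) (sq_nonneg N)
    have := mul_nonneg (sq_nonneg (S ^ 2)) ht
    have := mul_nonneg (sq_nonneg (S ^ 2)) (sq_nonneg P)
    have := mul_nonneg (sq_nonneg (S ^ 2)) (sq_nonneg Q)
    have := mul_nonneg (sq_nonneg (S ^ 2)) (sq_nonneg N)
    rw [hW]
    linarith [sq_nonneg P, sq_nonneg Q, sq_nonneg N]
  have e2 : (1 + S ^ 2 + S ^ 4) * W ≤ (1 + S ^ 2 + S ^ 4) / s₀ * (W * s) := by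
    rw [div_mul_eq_mul_div, le_div_iff₀ hs₀]
    have := mul_le_mul_of_nonneg_left hs (by positivity : 0 ≤ (1 + S ^ 2 + S ^ 4) * W)
    linarith
  have e3 : s ^ 2 * v₂ ^ 2 ≤ 1 / s₀ ^ 2 * (s ^ 2 * v₂) ^ 2 := by
    rw [div_mul_eq_mul_div, le_div_iff₀ (by positivity), one_mul]
    have h0 : s₀ ^ 2 ≤ s ^ 2 := pow_le_pow_left₀ hs₀.le hs 2
    have := mul_le_mul_of_nonneg_left h0 (by positivity : 0 ≤ s ^ 2 * v₂ ^ 2)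
    linarith
  have e4 := mul_le_mul_of_nonneg_left e3 (sq_nonneg ε)
  have e5 := mul_le_mul_of_nonneg_left (mul_le_mul_of_nonneg_right h2 (sq_nonneg v₁)) (sq_nonneg ε)
  have e6 : 0 ≤ 4 * ε ^ 2 / s₀ ^ 2 * (v₀ ^ 2 + v₁ ^ 2) := by positivity
  have e7 : 0 ≤ 2 * ε ^ 2 * S ^ 2 * (v₀ ^ 2 + (s ^ 2 * v₂) ^ 2) := by positivity
  have e8 : 4 * (ε ^ 2 * (s ^ 2 * v₂ ^ 2)) ≤ 4 * ε ^ 2 / s₀ ^ 2 * (s ^ 2 * v₂) ^ 2 := by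
    refine (mul_le_mul_of_nonneg_left e4 (by norm_num)).trans (le_of_eq (by ring))
  have e9 : 2 * (1 + S ^ 2 + S ^ 4) / s₀ * (W * s) = 2 * ((1 + S ^ 2 + S ^ 4) / s₀ * (W * s)) := by
    ring
  rw [e9]
  have e10 : (s * Q + ε * s * v₂) ^ 2 ≤ 2 * (s ^ 2 * Q ^ 2) + 2 * (ε ^ 2 * (s ^ 2 * v₂ ^ 2)) := by
    nlinarith [sq_nonneg (s * Q - ε * s * v₂)]
  have e11 : (s ^ 2 * N - ε * s * v₁) ^ 2 ≤ 2 * (s ^ 4 * N ^ 2) + 2 * (ε ^ 2 * (s ^ 2 * v₁ ^ 2)) := by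
    nlinarith [sq_nonneg (s ^ 2 * N + ε * s * v₁)]
  have e12 : (s * P) ^ 2 = s ^ 2 * P ^ 2 := by ring
  rw [e12]
  have e13 := mul_nonneg (sq_nonneg s) (sq_nonneg P)
  have e14 : (4 * ε ^ 2 / s₀ ^ 2 + 2 * ε ^ 2 * S ^ 2) * (v₀ ^ 2 + v₁ ^ 2 + (s ^ 2 * v₂) ^ 2) =
      4 * ε ^ 2 / s₀ ^ 2 * (v₀ ^ 2 + v₁ ^ 2) + 4 * ε ^ 2 / s₀ ^ 2 * (s ^ 2 * v₂) ^ 2 +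
      2 * ε ^ 2 * S ^ 2 * (v₀ ^ 2 + (s ^ 2 * v₂) ^ 2) + 2 * (ε ^ 2 * (S ^ 2 * v₁ ^ 2)) := by ring
  rw [e14]
  have e15 := e1.trans e2
  generalize (1 + S ^ 2 + S ^ 4) / s₀ * (W * s) = Z at *
  generalize 4 * ε ^ 2 / s₀ ^ 2 * (v₀ ^ 2 + v₁ ^ 2) = Z1 at *
  generalize 4 * ε ^ 2 / s₀ ^ 2 * (s ^ 2 * v₂) ^ 2 = Z2 at *
  generalize 2 * ε ^ 2 * S ^ 2 * (v₀ ^ 2 + (s ^ 2 * v₂) ^ 2) = Z3 at *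
  linarith

/-- Recovers a derivative `d` of `w³` from the derivative `s²d + cv` of the lowered component
`s²w³`. Here `c` is the derivative of `ε²r²`, which is 0 or `2ε²r = 2εs`. -/
lemma sq_deriv_le_lowered {s s₀ d v c : ℝ} (hs₀ : 0 < s₀) (hs : s₀ ≤ s)
    (hc : c ^ 2 ≤ 4 * ε ^ 2 * s ^ 2) :
    d ^ 2 ≤ 2 / s₀ ^ 4 * (s ^ 2 * d + c * v) ^ 2 + 8 * ε ^ 2 / s₀ ^ 6 * (s ^ 2 * v) ^ 2 := by
  have hs' : 0 < s := hs₀.trans_le hs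
  have h2 : s₀ ^ 4 ≤ s ^ 4 := pow_le_pow_left₀ hs₀.le hs 4
  have h3 : s₀ ^ 6 ≤ s ^ 6 := pow_le_pow_left₀ hs₀.le hs 6
  have e1 : 2 / s ^ 4 * (s ^ 2 * d + c * v) ^ 2 ≤ 2 / s₀ ^ 4 * (s ^ 2 * d + c * v) ^ 2 := by gcongr
  have e2 : 8 * ε ^ 2 / s ^ 6 * (s ^ 2 * v) ^ 2 ≤ 8 * ε ^ 2 / s₀ ^ 6 * (s ^ 2 * v) ^ 2 := by gcongr
  refine le_trans ?_ (add_le_add e1 e2)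
  have e3 : 8 * ε ^ 2 / s ^ 6 * (s ^ 2 * v) ^ 2 = 2 / s ^ 4 * (4 * ε ^ 2 * s ^ 2 * v ^ 2) := by
    field_simp; ring
  have e4 : d ^ 2 = 1 / s ^ 4 * (s ^ 2 * d) ^ 2 := by field_simp
  rw [e3, ← mul_add, e4, div_mul_eq_mul_div, div_mul_eq_mul_div]
  refine div_le_div_of_nonneg_right ?_ (by positivity)
  have := mul_le_mul_of_nonneg_right hc (sq_nonneg v)
  nlinarith [sq_nonneg (s ^ 2 * d + 2 * c * v)]

/-- Coercivity of `‖·‖_Ω`. -/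
theorem exists_h1NormSq_le (hD : IsOpen D) (hbd : Bornology.IsBounded D)
    (hlip : HasLipschitzBoundary D) (hr₀ : 0 < r₀) (hr : ∀ x ∈ D, r₀ ≤ x 1) (hε : 0 < ε) :
    ∃ C : ℝ, 0 < C ∧ ∀ (γ₀ : Set E2) (w : H1Field (channel D)), w.VanishesOn (solidWall D γ₀) →
      w.h1NormSq ≤ C * omegaNormSq ε w := by
  obtain ⟨R, hR⟩ := exists_radius_bound hbd
  set s₀ := r₀ * ε with hs₀
  set S := R * ε with hS
  have hs₀p : 0 < s₀ := mul_pos hr₀ hε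
  obtain ⟨C, hC, h⟩ := exists_coercive_constant hD hbd hlip
    (a := 2 * (1 + S ^ 2 + S ^ 4) / s₀) (b := 4 * ε ^ 2 / s₀ ^ 2 + 2 * ε ^ 2 * S ^ 2)
    (by positivity) (by positivity)
  -- The cost of returning from the covariant components to `w`: 1 for `w¹, w²` and their
  -- derivatives, `1/s₀⁴` for `w³`, and the rest for the three derivatives of `w³`, with `24 = 3 ·
  -- 8`.
  set c : ℝ := 1 + 1 / s₀ ^ 4 + 2 / s₀ ^ 4 + 24 * ε ^ 2 / s₀ ^ 6 with hc
  have hc0 : 0 < c := by positivity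
  refine ⟨c * C + 1, by positivity, fun γ₀ w hw => ?_⟩
  have hΩ : MeasurableSet (channel D) := (isOpen_channel hD).measurableSet
  have hu := hw.isExtendedField (ε := ε) hD hr₀ hr hR
  have hqi := integrableOn_phiDensity hD hε hr₀ hr hR w
  have hpos : ∀ x ∈ channel D, 0 < x 1 := fun x hx =>
    hr₀.trans_le (radius_mem_Icc hr hR hx).1
  have key := h _ _ hu ((channel D).indicator (phiDensity ε w)) ((integrable_indicator_iff hΩ).2 hqi)
    (fun x => Set.indicator_nonneg (fun y hy => phiDensity_nonneg hε w (hpos y hy).le) x)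
    (fun x hx => by simp [hx]) (by
      intro x
      by_cases hx : x ∈ channel D
      swap
      · simp [symSq, hx]
      have hx1 := radius_mem_Icc hr hR hx
      have hxp := hpos x hx
      have h1 := lowered_symSq_le (ε := ε) (s := x 1 * ε) (s₀ := s₀) (S := S)
        (t := ∑ α, ∑ β, phiTan w α β x ^ 2) (P := phiMix ε w 0 x / (x 1 * ε))
        (Q := phiMix ε w 1 x / (x 1 * ε)) (N := phiNormal ε w x / (x 1 * ε) ^ 2)
        (v₀ := w.val 0 x) (v₁ := w.val 1 x) (v₂ := w.val 2 x) hs₀p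
        (mul_le_mul_of_nonneg_right hx1.1 hε.le) (mul_le_mul_of_nonneg_right hx1.2 hε.le)
        (Finset.sum_nonneg fun _ _ => Finset.sum_nonneg fun _ _ => sq_nonneg _)
      rw [mul_div_cancel₀ _ (by positivity), mul_div_cancel₀ _ (by positivity),
        mul_div_cancel₀ _ (by positivity)] at h1
      convert h1 using 1
      · simp only [symSq, Fin.sum_univ_three, Fin.sum_univ_two, phiTan, phiMix, phiNormal,
          lowerCoeff, lowerCoeffD]
        simp [hx]
        field_simp
        ring
      · rw [Set.indicator_of_mem hx, phiDensity]
        congr 2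
        · refine congrArg (· * (x 1 * ε)) ?_
          simp only [phiFrame, Fin.sum_univ_three, Fin.sum_univ_two]
          simp
          ring
        · simp only [Fin.sum_univ_three, lowerCoeff_of_ne ε (by decide : (0 : Fin 3) ≠ 2),
            lowerCoeff_of_ne ε (by decide : (1 : Fin 3) ≠ 2), lowerCoeff_two,
            Set.indicator_of_mem hx]
          ring)
  rw [integral_indicator hΩ, ← omegaNormSq_eq] at key
  have hω : 0 ≤ omegaNormSq ε w := by
    rw [omegaNormSq_eq]
    exact setIntegral_nonneg hΩ fun x hx => phiDensity_nonneg hε w (hpos x hx).le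
  have h2 : w.h1NormSq ≤ c * ((∫ x, ∑ j, (lowerCoeff ε j x * (channel D).indicator (w.val j) x) ^ 2) +
      ∫ x, ∑ i, ∑ j, (lowerCoeff ε j x * (channel D).indicator (w.deriv i j) x +
        lowerCoeffD ε i j x * (channel D).indicator (w.val j) x) ^ 2) := by
    have i1 := hu.integrable_sum_sq
    have i2 := hu.integrable_sum_sq_deriv
    rw [H1Field.h1NormSq, ← integral_add i1 i2, ← integral_const_mul, ← integral_indicator hΩ]
    refine integral_mono ((integrable_indicator_iff hΩ).2 (integrableOn_h1 w)) ((i1.add i2).const_mul c)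
      fun x => ?_
    by_cases hx : x ∈ channel D
    swap
    · simp [hx]
    have hx1 := radius_mem_Icc hr hR hx
    have hs : s₀ ≤ x 1 * ε := mul_le_mul_of_nonneg_right hx1.1 hε.le
    set s := x 1 * ε with hsdef
    have hd : ∀ i, w.deriv i 2 x ^ 2 ≤
        2 / s₀ ^ 4 * (s ^ 2 * w.deriv i 2 x + lowerCoeffD ε i 2 x * w.val 2 x) ^ 2 +
          8 * ε ^ 2 / s₀ ^ 6 * (s ^ 2 * w.val 2 x) ^ 2 := fun i => by
      refine sq_deriv_le_lowered hs₀p hs ?_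
      rw [lowerCoeffD]
      split_ifs
      · exact le_of_eq (by rw [hsdef]; ring)
      · rw [zero_pow two_ne_zero]; positivity
    have hv : w.val 2 x ^ 2 ≤ 1 / s₀ ^ 4 * (s ^ 2 * w.val 2 x) ^ 2 := by
      have h2 : s₀ ^ 4 ≤ s ^ 4 := pow_le_pow_left₀ hs₀p.le hs 4
      rw [div_mul_eq_mul_div, le_div_iff₀ (by positivity), one_mul]
      have := mul_le_mul_of_nonneg_left h2 (sq_nonneg (w.val 2 x))
      linarith
    rw [Set.indicator_of_mem hx]
    have h02 : (0 : Fin 3) ≠ 2 := by decide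
    have h12 : (1 : Fin 3) ≠ 2 := by decide
    simp only [Set.indicator_of_mem hx, Fin.sum_univ_three, lowerCoeff_of_ne ε h02,
      lowerCoeff_of_ne ε h12, lowerCoeff_two, lowerCoeffD_of_ne ε _ h02, lowerCoeffD_of_ne ε _ h12,
      zero_mul, add_zero, one_mul]
    have g0 := hd 0
    have g1 := hd 1
    have g2 := hd 2
    rw [← hsdef]
    have hX : ∀ i, 0 ≤ (s ^ 2 * w.deriv i 2 x + lowerCoeffD ε i 2 x * w.val 2 x) ^ 2 := fun i =>
      sq_nonneg _
    have hX0 := hX 0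
    have hX1 := hX 1
    have hX2 := hX 2
    have hY : 0 ≤ (s ^ 2 * w.val 2 x) ^ 2 := sq_nonneg _
    generalize (s ^ 2 * w.deriv 0 2 x + lowerCoeffD ε 0 2 x * w.val 2 x) ^ 2 = X0 at *
    generalize (s ^ 2 * w.deriv 1 2 x + lowerCoeffD ε 1 2 x * w.val 2 x) ^ 2 = X1 at *
    generalize (s ^ 2 * w.deriv 2 2 x + lowerCoeffD ε 2 2 x * w.val 2 x) ^ 2 = X2 at *
    generalize (s ^ 2 * w.val 2 x) ^ 2 = Y at *
    set Z := w.val 0 x ^ 2 + w.val 1 x ^ 2 + (w.deriv 0 0 x ^ 2 + w.deriv 0 1 x ^ 2 +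
      w.deriv 1 0 x ^ 2 + w.deriv 1 1 x ^ 2 + w.deriv 2 0 x ^ 2 + w.deriv 2 1 x ^ 2) with hZ
    have hZ0 : 0 ≤ Z := by positivity
    have q1 : 1 / s₀ ^ 4 * Y ≤ 1 / s₀ ^ 4 * (Z + Y + X0 + X1 + X2) :=
      mul_le_mul_of_nonneg_left (by linarith) (by positivity)
    have q2 : 2 / s₀ ^ 4 * (X0 + X1 + X2) ≤ 2 / s₀ ^ 4 * (Z + Y + X0 + X1 + X2) :=
      mul_le_mul_of_nonneg_left (by linarith) (by positivity)
    have q3 : 24 * ε ^ 2 / s₀ ^ 6 * Y ≤ 24 * ε ^ 2 / s₀ ^ 6 * (Z + Y + X0 + X1 + X2) :=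
      mul_le_mul_of_nonneg_left (by linarith) (by positivity)
    have q4 : 24 * ε ^ 2 / s₀ ^ 6 * Y = 3 * (8 * ε ^ 2 / s₀ ^ 6 * Y) := by ring
    calc _ = Z + w.val 2 x ^ 2 + w.deriv 0 2 x ^ 2 + w.deriv 1 2 x ^ 2 + w.deriv 2 2 x ^ 2 := by
          rw [hZ]; ring
      _ ≤ c * (Z + Y + X0 + X1 + X2) := by
          rw [hc, add_mul, add_mul, add_mul, one_mul]
          linarith
      _ = _ := by rw [hZ]; ring
  have h3 := mul_le_mul_of_nonneg_left key hc0.le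
  linarith

end OmegaNorm

/-! ### The strain rate in an orthonormal frame -/

section Frame

variable {ε : ℝ} {Θ : E2 → ℝ}

/-- The covector `εr dξ + rΘ_α dx^α`, that is `r dθ`. -/
noncomputable def coframe (ε : ℝ) (Θ : E2 → ℝ) (i : Fin 3) (y : E3) : ℝ :=
  ![y 1 * partialD 0 Θ (proj y), y 1 * partialD 1 Θ (proj y), ε * y 1] i

/-- The derivatives `∂_k` of `coframe`. -/
noncomputable def coframeD (ε : ℝ) (Θ : E2 → ℝ) (k i : Fin 3) (x : E3) : ℝ :=
  !![x 1 * partialD 0 (partialD 0 Θ) (proj x), x 1 * partialD 0 (partialD 1 Θ) (proj x), 0;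
     partialD 0 Θ (proj x) + x 1 * partialD 1 (partialD 0 Θ) (proj x),
     partialD 1 Θ (proj x) + x 1 * partialD 1 (partialD 1 Θ) (proj x), ε;
     0, 0, 0] k i

/-- The form `(dx¹)² + (dx²)²`. -/
def planeForm (i j : Fin 3) : ℝ := if i = j ∧ i ≠ 2 then 1 else 0

/-- An orthonormal frame of the metric. -/
noncomputable def frame (ε : ℝ) (Θ : E2 → ℝ) (x : E3) : Matrix (Fin 3) (Fin 3) ℝ :=
  !![1, 0, -(partialD 0 Θ (proj x) / ε);
     0, 1, -(partialD 1 Θ (proj x) / ε);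
     0, 0, (x 1 * ε)⁻¹]

/-- The metric is `(dx¹)² + (dx²)² + (r dθ)²`, so its derivatives reduce to those of a single
covector. -/
lemma metric_eq (x : E3) (i j : Fin 3) :
    metric ε Θ x i j = planeForm i j + coframe ε Θ i x * coframe ε Θ j x := by
  fin_cases i <;> fin_cases j <;> simp [metric, planeForm, coframe] <;> ring

lemma metric_comm (x : E3) (i j : Fin 3) : metric ε Θ x i j = metric ε Θ x j i := by
  fin_cases i <;> fin_cases j <;> simp [metric] <;> ring

lemma metricD_comm (k i j : Fin 3) (x : E3) : metricD ε Θ k i j x = metricD ε Θ k j i x := by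
  simp only [metricD, metric_comm _ i j]

lemma metric_mul_frame {x : E3} (hε : ε ≠ 0) (hx : x 1 ≠ 0) :
    metric ε Θ x * ((frame ε Θ x).transpose * frame ε Θ x) = 1 := by
  ext i j
  fin_cases i <;> fin_cases j <;>
    simp [metric, frame, Matrix.mul_apply, Fin.sum_univ_three] <;> field_simp <;> ring

lemma metricInv_eq {x : E3} (hε : ε ≠ 0) (hx : x 1 ≠ 0) :
    metricInv ε Θ x = (frame ε Θ x).transpose * frame ε Θ x :=
  Matrix.inv_eq_right_inv (metric_mul_frame hε hx)

lemma metric_mul_metricInv {x : E3} (hε : ε ≠ 0) (hx : x 1 ≠ 0) :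
    metric ε Θ x * metricInv ε Θ x = 1 := by
  rw [metricInv_eq hε hx, metric_mul_frame hε hx]

lemma volDensity_eq {x : E3} (hε : 0 ≤ ε) (hx : 0 ≤ x 1) : volDensity ε Θ x = x 1 * ε := by
  have : (metric ε Θ x).det = (x 1 * ε) ^ 2 := by
    simp [metric, Matrix.det_fin_three]; ring
  rw [volDensity, this, Real.sqrt_sq (mul_nonneg hx hε)]

/-- Lowering the upper index cancels the inverse metric in the definition, so the strain can be
computed from derivatives of the metric alone. -/
lemma metric_christoffel {x : E3} (hε : ε ≠ 0) (hx : x 1 ≠ 0) (i j m : Fin 3) :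
    ∑ k, metric ε Θ x j k * christoffel ε Θ k i m x =
      1 / 2 * (metricD ε Θ i m j x + metricD ε Θ m i j x - metricD ε Θ j i m x) := by
  have h := Matrix.mulVec_mulVec (fun l => metricD ε Θ i m l x + metricD ε Θ m i l x -
    metricD ε Θ l i m x) (metric ε Θ x) (metricInv ε Θ x)
  rw [metric_mul_metricInv hε hx, Matrix.one_mulVec] at h
  have h1 := congrFun h j
  simp only [Matrix.mulVec, dotProduct] at h1
  rw [← h1, Finset.mul_sum]
  exact Finset.sum_congr rfl fun k _ => by rw [christoffel]; ring

/-- The strain rate tensor is half the Lie derivative of the metric. -/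
lemma strain_eq_lie {Ω : Set E3} (w : H1Field Ω) {x : E3} (hε : ε ≠ 0) (hx : x 1 ≠ 0)
    (i j : Fin 3) : strain ε Θ w i j x = 1 / 2 * ((∑ k, metric ε Θ x j k * w.deriv i k x) +
      (∑ k, metric ε Θ x i k * w.deriv j k x) + ∑ m, metricD ε Θ m i j x * w.val m x) := by
  have h : ∀ i j, ∑ k, metric ε Θ x j k * covD ε Θ w i k x =
      (∑ k, metric ε Θ x j k * w.deriv i k x) + ∑ m, 1 / 2 * (metricD ε Θ i m j x +
        metricD ε Θ m i j x - metricD ε Θ j i m x) * w.val m x := by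
    intro i j
    simp_rw [← metric_christoffel hε hx, covD, mul_add, Finset.sum_add_distrib, Finset.mul_sum,
      Finset.sum_mul]
    rw [Finset.sum_comm]
    simp only [mul_assoc]
  rw [strain, h, h]
  simp only [Fin.sum_univ_three, metricD_comm j _ i, metricD_comm i _ j, metricD_comm _ j i]
  ring

lemma proj_single_castSucc (k : Fin 2) :
    proj (EuclideanSpace.single k.castSucc 1) = EuclideanSpace.single k 1 := by
  ext i; fin_cases k <;> fin_cases i <;> simp [proj]

lemma proj_single_two : proj (EuclideanSpace.single 2 1) = 0 := by
  ext i; fin_cases i <;> simp [proj]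

lemma differentiableAt_partialD {D : Set E2} (hD : IsOpen D) (hΘ : ContDiffOn ℝ 2 Θ D) {p : E2}
    (hp : p ∈ D) (α : Fin 2) : DifferentiableAt ℝ (partialD α Θ) p := by
  have h1 : ContDiffAt ℝ 2 Θ p := hΘ.contDiffAt (hD.mem_nhds hp)
  have h2 : ContDiffAt ℝ 1 (fderiv ℝ Θ) p := h1.fderiv_right (by norm_num)
  exact (h2.differentiableAt (by simp)).clm_apply (differentiableAt_const _)

lemma partialD_coframe {D : Set E2} (hD : IsOpen D) (hΘ : ContDiffOn ℝ 2 Θ D) {x : E3}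
    (hx : proj x ∈ D) (k i : Fin 3) : DifferentiableAt ℝ (coframe ε Θ i) x ∧
      partialD k (coframe ε Θ i) x = coframeD ε Θ k i x := by
  have hr := hasFDerivAt_coord (1 : Fin 3) x
  have hT : ∀ α : Fin 2, HasFDerivAt (fun y : E3 => y 1 * partialD α Θ (proj y)) _ x := fun α =>
    hr.mul ((differentiableAt_partialD hD hΘ hx α).hasFDerivAt.comp x projL.hasFDerivAt)
  have hk : ∀ α : Fin 2, DifferentiableAt ℝ (fun y : E3 => y 1 * partialD α Θ (proj y)) x ∧
      partialD k (fun y : E3 => y 1 * partialD α Θ (proj y)) x = coframeD ε Θ k α.castSucc x := by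
    intro α
    refine ⟨(hT α).differentiableAt, ?_⟩
    rw [partialD, (hT α).fderiv]
    have e0 := proj_single_castSucc 0
    have e1 := proj_single_castSucc 1
    have e2 := proj_single_two
    fin_cases k <;> fin_cases α <;>
      simp_all [coframeD, projL_apply, partialD] <;> ring
  fin_cases i
  · exact hk 0
  · exact hk 1
  · have h := hr.const_mul ε
    refine ⟨h.differentiableAt, ?_⟩
    change partialD k (fun y : E3 => ε * y 1) x = _
    rw [partialD, h.fderiv]
    fin_cases k <;> simp [coframeD]

lemma metricD_eq {D : Set E2} (hD : IsOpen D) (hΘ : ContDiffOn ℝ 2 Θ D) {x : E3}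
    (hx : proj x ∈ D) (k i j : Fin 3) : metricD ε Θ k i j x =
      coframeD ε Θ k i x * coframe ε Θ j x + coframe ε Θ i x * coframeD ε Θ k j x := by
  obtain ⟨hi, hki⟩ := partialD_coframe (ε := ε) hD hΘ hx k i
  obtain ⟨hj, hkj⟩ := partialD_coframe (ε := ε) hD hΘ hx k j
  have h := (hi.hasFDerivAt.mul hj.hasFDerivAt).const_add (planeForm i j)
  have e : (fun y => metric ε Θ y i j) = fun y => planeForm i j + coframe ε Θ i y * coframe ε Θ j y :=
    funext fun y => metric_eq y i j
  rw [metricD, partialD, e]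
  have h2 : fderiv ℝ (fun y => planeForm i j + coframe ε Θ i y * coframe ε Θ j y) x = _ := h.fderiv
  rw [h2, ← hki, ← hkj]
  simp only [partialD, _root_.add_apply, _root_.smul_apply, smul_eq_mul]
  ring

/-- The difference between the strain rate in the orthonormal frame and its value for `Θ = 0`. -/
noncomputable def strainError (ε : ℝ) (Θ : E2 → ℝ) {Ω : Set E3} (w : H1Field Ω) (a b : Fin 3)
    (x : E3) : ℝ :=
  let T := fun α => partialD α Θ (proj x)
  let S := T 0 * w.deriv 2 0 x + T 1 * w.deriv 2 1 x
  let P := fun α β : Fin 2 => -(2 * ε)⁻¹ *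
    (T α * w.deriv 2 β.castSucc x + T β * w.deriv 2 α.castSucc x)
  let Q := fun α : Fin 2 => 1 / 2 * x 1 * (w.val 0 x * partialD 0 (partialD α Θ) (proj x) +
    w.val 1 x * partialD 1 (partialD α Θ) (proj x) + T 0 * w.deriv α.castSucc 0 x +
    T 1 * w.deriv α.castSucc 1 x - T α * w.deriv 2 2 x - T α / ε * S)
  !![P 0 0, P 0 1, Q 0; P 1 0, P 1 1, Q 1; Q 0, Q 1, S / ε] a b

/-- The first two frame vectors are `∂_α - (Θ_α/ε)∂_ξ`, which `r dθ` annihilates, and the third is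
`(rε)⁻¹∂_ξ`. The Lie derivative formula evaluated on them leaves the components for `Θ = 0` and
terms that each contain a derivative of `Θ`. -/
lemma strain_frame {D : Set E2} (hD : IsOpen D) (hΘ : ContDiffOn ℝ 2 Θ D) {Ω : Set E3}
    (w : H1Field Ω) {x : E3} (hx : proj x ∈ D) (hε : ε ≠ 0) (hr : x 1 ≠ 0) (a b : Fin 3) :
    ∑ i, ∑ j, frame ε Θ x a i * frame ε Θ x b j * strain ε Θ w i j x =
      phiFrame ε w a b x + strainError ε Θ w a b x := by
  simp only [strain_eq_lie w hε hr, metricD_eq hD hΘ hx, metric_eq, Fin.sum_univ_three]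
  fin_cases a <;> fin_cases b <;>
  · simp [frame, phiFrame, strainError, planeForm, coframe, coframeD, phiTan, phiMix, phiNormal]
    field_simp
    ring

lemma strain_comm {Ω : Set E3} (w : H1Field Ω) (i j : Fin 3) (x : E3) :
    strain ε Θ w i j x = strain ε Θ w j i x := by
  rw [strain, strain, add_comm]

/-- With `g = EᵀE` the contraction is the squared Euclidean norm of `E e Eᵀ`. The two terms of the
viscosity tensor agree on symmetric `e`, whence the factor 2. -/
lemma sum_viscosity {μ : ℝ} (g E e : Matrix (Fin 3) (Fin 3) ℝ) (hg : g = E.transpose * E)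
    (he : ∀ i j, e i j = e j i) :
    ∑ i, ∑ j, ∑ k, ∑ m, μ * (g i k * g j m + g i m * g j k) * e i j * e k m =
      2 * μ * ∑ a, ∑ b, (∑ i, ∑ j, E a i * E b j * e i j) ^ 2 := by
  set S : Fin 3 → Fin 3 → ℝ := fun a b => ∑ i, ∑ j, E a i * E b j * e i j with hS
  have h1 : ∀ i j, ∑ k, ∑ m, g i k * g j m * e k m = ∑ a, ∑ b, E a i * E b j * S a b := by
    intro i j
    simp only [hg, hS, Matrix.mul_apply, Matrix.transpose_apply, Fin.sum_univ_three]
    ring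
  have h2 : ∀ T : Fin 3 → Fin 3 → ℝ, ∑ i, ∑ j, (∑ a, ∑ b, E a i * E b j * T a b) * e i j =
      ∑ a, ∑ b, T a b * S a b := by
    intro T
    simp only [hS, Fin.sum_univ_three]
    ring
  have h3 : ∀ i j, ∑ k, ∑ m, μ * (g i k * g j m + g i m * g j k) * e i j * e k m =
      2 * μ * ((∑ a, ∑ b, E a i * E b j * S a b) * e i j) := by
    intro i j
    rw [← h1]
    simp only [Fin.sum_univ_three, he 1 0, he 2 0, he 2 1]
    ring
  simp_rw [h3, ← Finset.mul_sum, h2, sq]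
  rfl

lemma viscousForm_integrand {D : Set E2} (hD : IsOpen D) (hΘ : ContDiffOn ℝ 2 Θ D) {Ω : Set E3}
    (w : H1Field Ω) {x : E3} (hx : proj x ∈ D) (hε : 0 < ε) (hr : 0 < x 1) (μ : ℝ) :
    (∑ i, ∑ j, ∑ k, ∑ m, viscosity ε Θ μ i j k m x * strain ε Θ w i j x * strain ε Θ w k m x) *
        volDensity ε Θ x =
      2 * μ * (∑ a, ∑ b, (phiFrame ε w a b x + strainError ε Θ w a b x) ^ 2) * (x 1 * ε) := by
  rw [volDensity_eq hε.le hr.le]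
  have h := sum_viscosity (μ := μ) (metricInv ε Θ x) (frame ε Θ x) (fun i j => strain ε Θ w i j x)
    (metricInv_eq hε.ne' hr.ne') (fun i j => strain_comm w i j x)
  simp only [strain_frame hD hΘ w hx hε.ne' hr.ne'] at h
  simp only [viscosity]
  rw [h]

end Frame

/-! ### The perturbation estimate -/

section Lower

variable {D : Set E2} {ε r₀ R : ℝ} {Θ : E2 → ℝ}

lemma measurable_partialD {n : ℕ} (i : Fin n) (f : EuclideanSpace ℝ (Fin n) → ℝ) :
    Measurable (partialD i f) :=
  measurable_fderiv_apply_const ℝ f _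

/-- The sum of the absolute values of the components and of the derivatives of a field. -/
noncomputable def absSum {Ω : Set E3} (w : H1Field Ω) (x : E3) : ℝ :=
  (∑ j, |w.val j x|) + ∑ i, ∑ j, |w.deriv i j x|

lemma absSum_nonneg {Ω : Set E3} (w : H1Field Ω) (x : E3) : 0 ≤ absSum w x := by
  unfold absSum; positivity

lemma memLp_absSum {Ω : Set E3} (w : H1Field Ω) : MemLp (absSum w) 2 (volume.restrict Ω) :=
  (memLp_finsetSum _ fun j _ => (w.memLp_val j).abs).add
    (memLp_finsetSum _ fun i _ => memLp_finsetSum _ fun j _ => (w.memLp_deriv i j).abs)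

lemma absSum_sq_le {Ω : Set E3} (w : H1Field Ω) (x : E3) :
    absSum w x ^ 2 ≤ 12 * ((∑ j, w.val j x ^ 2) + ∑ i, ∑ j, w.deriv i j x ^ 2) := by
  have h := sq_sum_le_card_mul_sum_sq (s := (Finset.univ : Finset (Fin 3 ⊕ Fin 3 × Fin 3)))
    (f := Sum.elim (fun j => |w.val j x|) fun p => |w.deriv p.1 p.2 x|)
  simpa [Fintype.sum_sum_type, Fintype.sum_prod_type, absSum] using h

lemma aestronglyMeasurable_strainError (w : H1Field (channel D)) (a b : Fin 3) :
    AEStronglyMeasurable (strainError ε Θ w a b) (volume.restrict (channel D)) := by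
  have hp : Measurable proj := projL.continuous.measurable
  have hT : ∀ α, AEMeasurable (fun x : E3 => partialD α Θ (proj x))
      (volume.restrict (channel D)) := fun α => ((measurable_partialD α Θ).comp hp).aemeasurable
  have hH : ∀ α β, AEMeasurable (fun x : E3 => partialD α (partialD β Θ) (proj x))
      (volume.restrict (channel D)) := fun α β =>
    ((measurable_partialD α (partialD β Θ)).comp hp).aemeasurable
  have hv := fun j => (w.memLp_val j).1.aemeasurable
  have hd := fun i j => (w.memLp_deriv i j).1.aemeasurable
  have hx : AEMeasurable (fun x : E3 => x 1) (volume.restrict (channel D)) :=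
    (measurable_coord 1).aemeasurable
  refine AEMeasurable.aestronglyMeasurable ?_
  have hS := ((hT 0).mul (hd 2 0)).add ((hT 1).mul (hd 2 1))
  have hP : ∀ α β : Fin 2, AEMeasurable (fun x => -(2 * ε)⁻¹ *
      (partialD α Θ (proj x) * w.deriv 2 β.castSucc x +
        partialD β Θ (proj x) * w.deriv 2 α.castSucc x)) (volume.restrict (channel D)) := fun α β =>
    (((hT α).mul (hd _ _)).add ((hT β).mul (hd _ _))).const_mul _
  have hQ := fun α : Fin 2 => (hx.const_mul (1 / 2)).mul (((((((hv 0).mul (hH 0 α)).add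
    ((hv 1).mul (hH 1 α))).add ((hT 0).mul (hd α.castSucc 0))).add
    ((hT 1).mul (hd α.castSucc 1))).sub ((hT α).mul (hd 2 2))).sub
    (((hT α).div_const ε).mul hS))
  fin_cases a <;> fin_cases b
  exacts [hP 0 0, hP 0 1, hQ 0, hP 1 0, hP 1 1, hQ 1, hQ 0, hQ 1, hS.div_const ε]

/-- All terms are linear in the derivatives of `Θ`, apart from a quadratic one in the mixed
components; `K ≤ 1` reduces that one to a linear bound. -/
lemma abs_strainError_le (hε : 0 < ε) {K : ℝ} (hK0 : 0 ≤ K) (hK1 : K ≤ 1) {Ω : Set E3}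
    (w : H1Field Ω) {x : E3} (hx0 : 0 ≤ x 1) (hxR : x 1 ≤ R)
    (hT : ∀ α, |partialD α Θ (proj x)| ≤ K)
    (hH : ∀ α β, |partialD α (partialD β Θ) (proj x)| ≤ K) (a b : Fin 3) :
    |strainError ε Θ w a b x| ≤ (1 / ε + R + R / ε) * K * absSum w x := by
  have hR0 : 0 ≤ R := hx0.trans hxR
  have hm : ∀ {c y : ℝ}, |c| ≤ K → |c * y| ≤ K * |y| := fun hc => by
    rw [abs_mul]; exact mul_le_mul_of_nonneg_right hc (abs_nonneg _)
  have hm' : ∀ {c y : ℝ}, |c| ≤ K → |y * c| ≤ K * |y| := fun hc => by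
    rw [mul_comm]; exact hm hc
  have hN := absSum_nonneg w x
  have nv := fun j => abs_nonneg (w.val j x)
  have nd := fun i j => abs_nonneg (w.deriv i j x)
  have hNe : absSum w x = |w.val 0 x| + |w.val 1 x| + |w.val 2 x| +
      (|w.deriv 0 0 x| + |w.deriv 0 1 x| + |w.deriv 0 2 x| +
      (|w.deriv 1 0 x| + |w.deriv 1 1 x| + |w.deriv 1 2 x|) +
      (|w.deriv 2 0 x| + |w.deriv 2 1 x| + |w.deriv 2 2 x|)) := by
    simp [absSum, Fin.sum_univ_three]
  have hd : ∀ i j, |w.deriv i j x| ≤ absSum w x := fun i j => by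
    rw [hNe]
    fin_cases i <;> fin_cases j <;> simp only [Fin.zero_eta, Fin.mk_one, Fin.reduceFinMk] <;>
      linarith [nv 0, nv 1, nv 2, nd 0 0, nd 0 1, nd 0 2, nd 1 0, nd 1 1, nd 1 2, nd 2 0, nd 2 1, nd 2 2]
  set N := absSum w x with hNdef
  have hKN : 0 ≤ K * N := mul_nonneg hK0 hN
  have hfac : 1 / ε * (K * N) ≤ (1 / ε + R + R / ε) * K * N := by
    have : 0 ≤ (R + R / ε) * (K * N) := by positivity
    linarith
  have hS : |partialD 0 Θ (proj x) * w.deriv 2 0 x + partialD 1 Θ (proj x) * w.deriv 2 1 x| ≤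
      K * N := by
    refine (abs_add_le _ _).trans ?_
    have h0 := hm (y := w.deriv 2 0 x) (hT 0)
    have h1 := hm (y := w.deriv 2 1 x) (hT 1)
    have : |w.deriv 2 0 x| + |w.deriv 2 1 x| ≤ N := by
      rw [hNe]
      linarith [nv 0, nv 1, nv 2, nd 0 0, nd 0 1, nd 0 2, nd 1 0, nd 1 1, nd 1 2, nd 2 2]
    have := mul_le_mul_of_nonneg_left this hK0
    linarith
  have hP : ∀ α β : Fin 2, |-(2 * ε)⁻¹ * (partialD α Θ (proj x) * w.deriv 2 β.castSucc x +
        partialD β Θ (proj x) * w.deriv 2 α.castSucc x)| ≤ (1 / ε + R + R / ε) * K * N := by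
    intro α β
    refine le_trans ?_ hfac
    rw [abs_mul, abs_neg, abs_of_pos (by positivity : 0 < (2 * ε)⁻¹)]
    have h0 := hm (y := w.deriv 2 β.castSucc x) (hT α)
    have h1 := hm (y := w.deriv 2 α.castSucc x) (hT β)
    have h2 := mul_le_mul_of_nonneg_left (hd 2 β.castSucc) hK0
    have h3 := mul_le_mul_of_nonneg_left (hd 2 α.castSucc) hK0
    have h4 := (abs_add_le (partialD α Θ (proj x) * w.deriv 2 β.castSucc x)
        (partialD β Θ (proj x) * w.deriv 2 α.castSucc x)).trans
        (by linarith : _ ≤ 2 * (K * N))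
    refine (mul_le_mul_of_nonneg_left h4 (by positivity : 0 ≤ (2 * ε)⁻¹)).trans (le_of_eq ?_)
    field_simp
  have hQ : ∀ α : Fin 2, |1 / 2 * x 1 * (w.val 0 x * partialD 0 (partialD α Θ) (proj x) +
      w.val 1 x * partialD 1 (partialD α Θ) (proj x) + partialD 0 Θ (proj x) * w.deriv α.castSucc 0 x +
      partialD 1 Θ (proj x) * w.deriv α.castSucc 1 x - partialD α Θ (proj x) * w.deriv 2 2 x -
      partialD α Θ (proj x) / ε * (partialD 0 Θ (proj x) * w.deriv 2 0 x +
        partialD 1 Θ (proj x) * w.deriv 2 1 x))| ≤ (1 / ε + R + R / ε) * K * N := by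
    intro α
    have h0 := hm' (y := w.val 0 x) (hH 0 α)
    have h1 := hm' (y := w.val 1 x) (hH 1 α)
    have h2 := hm (y := w.deriv α.castSucc 0 x) (hT 0)
    have h3 := hm (y := w.deriv α.castSucc 1 x) (hT 1)
    have h4 := hm (y := w.deriv 2 2 x) (hT α)
    have h5 : |partialD α Θ (proj x) / ε * (partialD 0 Θ (proj x) * w.deriv 2 0 x +
        partialD 1 Θ (proj x) * w.deriv 2 1 x)| ≤ 1 / ε * (K * N) := by
      rw [abs_mul, abs_div, abs_of_pos hε]
      exact mul_le_mul (div_le_div_of_nonneg_right ((hT α).trans hK1) hε.le) hS (abs_nonneg _)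
        (by positivity)
    have h6 : |w.val 0 x| + |w.val 1 x| + |w.deriv α.castSucc 0 x| + |w.deriv α.castSucc 1 x| +
        |w.deriv 2 2 x| ≤ N := by
      rw [hNe]
      fin_cases α <;> simp only [Fin.zero_eta, Fin.mk_one, Fin.castSucc_zero, Fin.castSucc_one] <;>
      linarith [nv 0, nv 1, nv 2, nd 0 0, nd 0 1, nd 0 2, nd 1 0, nd 1 1, nd 1 2, nd 2 0, nd 2 1, nd 2 2]
    have h7 := mul_le_mul_of_nonneg_left h6 hK0
    have h8 : |w.val 0 x * partialD 0 (partialD α Θ) (proj x) +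
      w.val 1 x * partialD 1 (partialD α Θ) (proj x) + partialD 0 Θ (proj x) * w.deriv α.castSucc 0 x +
      partialD 1 Θ (proj x) * w.deriv α.castSucc 1 x - partialD α Θ (proj x) * w.deriv 2 2 x -
      partialD α Θ (proj x) / ε * (partialD 0 Θ (proj x) * w.deriv 2 0 x +
        partialD 1 Θ (proj x) * w.deriv 2 1 x)| ≤ (1 + 1 / ε) * (K * N) := by
      refine (abs_sub _ _).trans ((add_le_add ((abs_sub _ _).trans (add_le_add ((abs_add_le _ _).trans
        (add_le_add ((abs_add_le _ _).trans (add_le_add ((abs_add_le _ _).trans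
        (add_le_add h0 h1)) h2)) h3)) h4)) h5).trans ?_)
      linarith
    rw [abs_mul, abs_of_nonneg (by positivity : 0 ≤ 1 / 2 * x 1)]
    have h9 : 1 / 2 * x 1 ≤ R := by linarith
    refine (mul_le_mul h9 h8 (abs_nonneg _) hR0).trans ?_
    have : R * ((1 + 1 / ε) * (K * N)) = (R + R / ε) * (K * N) := by ring
    rw [this]
    have : 0 ≤ 1 / ε * (K * N) := by positivity
    linarith
  have hS' : |(partialD 0 Θ (proj x) * w.deriv 2 0 x + partialD 1 Θ (proj x) * w.deriv 2 1 x) / ε| ≤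
      (1 / ε + R + R / ε) * K * N := by
    refine le_trans ?_ hfac
    rw [abs_div, abs_of_pos hε, div_eq_inv_mul, one_div]
    exact mul_le_mul_of_nonneg_left hS (by positivity)
  fin_cases a <;> fin_cases b
  exacts [hP 0 0, hP 0 1, hQ 0, hP 1 0, hP 1 1, hQ 1, hQ 0, hQ 1, hS']

/-- `a(w, w) ≥ μ‖w‖²_Ω - O(K²)‖w‖²_{1,Ω}` when the derivatives of `Θ` are bounded by `K ≤ 1`. -/
theorem viscousForm_ge (hD : IsOpen D) (hr₀ : 0 < r₀) (hr : ∀ x ∈ D, r₀ ≤ x 1)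
    (hR : ∀ x ∈ D, x 1 ≤ R) (hε : 0 < ε) {K : ℝ} (hK0 : 0 ≤ K) (hK1 : K ≤ 1)
    (hΘ : IsBlade D K Θ) {μ : ℝ} (hμ : 0 < μ) (w : H1Field (channel D)) :
    μ * omegaNormSq ε w - μ * (216 * (1 / ε + R + R / ε) ^ 2 * (R * ε)) * K ^ 2 * w.h1NormSq ≤
      viscousForm ε Θ μ w w := by
  have hΩ : MeasurableSet (channel D) := (isOpen_channel hD).measurableSet
  set c := 1 / ε + R + R / ε with hc
  set h1 : E3 → ℝ := fun x => (∑ j, w.val j x ^ 2) + ∑ i, ∑ j, w.deriv i j x ^ 2 with hh1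
  have hb : ∀ x ∈ channel D, ∀ a b, |strainError ε Θ w a b x| ≤ c * K * absSum w x :=
    fun x hx a b => by
      have hx1 := radius_mem_Icc hr hR hx
      exact abs_strainError_le hε hK0 hK1 w (hr₀.le.trans hx1.1) hx1.2
        (hΘ.2.1 _ hx.1) (fun α β => hΘ.2.2 _ hx.1 α β) a b
  have hE : ∀ a b, MemLp (strainError ε Θ w a b) 2 (volume.restrict (channel D)) := fun a b =>
    (memLp_absSum w).of_le_mul (c := c * K) (aestronglyMeasurable_strainError w a b) <|
      (ae_restrict_iff' hΩ).2 <| Filter.Eventually.of_forall fun x hx => by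
        rw [Real.norm_eq_abs, Real.norm_of_nonneg (absSum_nonneg w x)]
        exact hb x hx a b
  have hF : viscousForm ε Θ μ w w = ∫ x in channel D,
      2 * μ * (∑ a, ∑ b, (phiFrame ε w a b x + strainError ε Θ w a b x) ^ 2) * (x 1 * ε) := by
    rw [viscousForm]
    exact setIntegral_congr_fun hΩ fun x hx => viscousForm_integrand hD hΘ.1 w hx.1 hε
      (hr₀.trans_le (radius_mem_Icc hr hR hx).1) μ
  have hFi : Integrable (fun x => 2 * μ *
      (∑ a, ∑ b, (phiFrame ε w a b x + strainError ε Θ w a b x) ^ 2) * (x 1 * ε))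
      (volume.restrict (channel D)) := by
    have h : Integrable (fun x => 2 * μ *
        ∑ a, ∑ b, (phiFrame ε w a b x + strainError ε Θ w a b x) ^ 2)
        (volume.restrict (channel D)) :=
      (integrable_finsetSum _ fun a _ => integrable_finsetSum _ fun b _ =>
        ((memLp_phiFrame hD hε hr₀ hr hR w a b).add (hE a b)).integrable_sq).const_mul _
    refine (h.norm.const_mul (R * ε)).mono' (h.1.mul (by fun_prop)) ?_
    refine (ae_restrict_iff' hΩ).2 (Filter.Eventually.of_forall fun x hx => ?_)
    have hx1 := radius_mem_Icc hr hR hx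
    have : 0 < x 1 := hr₀.trans_le hx1.1
    rw [norm_mul, mul_comm, Real.norm_of_nonneg (by positivity : 0 ≤ x 1 * ε)]
    exact mul_le_mul_of_nonneg_right (mul_le_mul_of_nonneg_right hx1.2 hε.le) (norm_nonneg _)
  have hqi := integrableOn_phiDensity hD hε hr₀ hr hR w
  have hhi := integrableOn_h1 w
  rw [hF, omegaNormSq_eq, H1Field.h1NormSq, ← integral_const_mul, ← integral_const_mul,
    ← integral_sub (hqi.const_mul _) (hhi.const_mul _)]
  refine setIntegral_mono_on ((hqi.const_mul _).sub (hhi.const_mul _)) hFi hΩ fun x hx => ?_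
  have hx1 := radius_mem_Icc hr hR hx
  have hxp : 0 < x 1 := hr₀.trans_le hx1.1
  have hs : x 1 * ε ≤ R * ε := mul_le_mul_of_nonneg_right hx1.2 hε.le
  have hsp : 0 < x 1 * ε := by positivity
  have hE2 : ∀ a b, strainError ε Θ w a b x ^ 2 ≤ 12 * (c ^ 2 * K ^ 2) * h1 x := fun a b => by
    have h2 := pow_le_pow_left₀ (abs_nonneg _) (hb x hx a b) 2
    rw [sq_abs, mul_pow, mul_pow] at h2
    have h3 := mul_le_mul_of_nonneg_left (absSum_sq_le w x) (by positivity : 0 ≤ c ^ 2 * K ^ 2)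
    refine h2.trans (h3.trans (le_of_eq (by ring)))
  have hsum : (∑ a, ∑ b, phiFrame ε w a b x ^ 2) - 216 * (c ^ 2 * K ^ 2) * h1 x ≤
      2 * ∑ a, ∑ b, (phiFrame ε w a b x + strainError ε Θ w a b x) ^ 2 := by
    -- This is `φ² - 2E² ≤ 2(φ + E)²` with `E² ≤ 12c²K²h1`, the 12 coming from Cauchy-Schwarz over
    -- the twelve values and derivatives. Nine components give `9 · 24 = 216`.
    have h4 : ∀ a b, phiFrame ε w a b x ^ 2 - 24 * (c ^ 2 * K ^ 2) * h1 x ≤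
        2 * (phiFrame ε w a b x + strainError ε Θ w a b x) ^ 2 := fun a b => by
      nlinarith [hE2 a b, sq_nonneg (phiFrame ε w a b x + 2 * strainError ε Θ w a b x)]
    have h5 := Finset.sum_le_sum fun a (_ : a ∈ Finset.univ) =>
      Finset.sum_le_sum fun b (_ : b ∈ Finset.univ) => h4 a b
    simp only [Finset.sum_sub_distrib, ← Finset.mul_sum, Finset.sum_const, Finset.card_univ,
      Fintype.card_fin, nsmul_eq_mul] at h5
    refine le_trans (le_of_eq ?_) h5
    push_cast
    ring
  have hh0 : 0 ≤ h1 x := by rw [hh1]; positivity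
  have h6 := mul_le_mul_of_nonneg_left (mul_le_mul_of_nonneg_right hsum hsp.le) hμ.le
  have h7 := mul_le_mul_of_nonneg_left hs
    (by positivity : 0 ≤ μ * (216 * (c ^ 2 * K ^ 2) * h1 x))
  rw [phiDensity]
  change _ - _ * h1 x ≤ _
  linarith

end Lower

end Impeller

/-! ### Choice of the constants -/

theorem lemma9 (D : Set Impeller.E2) (hD_open : IsOpen D) (hD_conn : IsConnected D)
    (hD_bdd : Bornology.IsBounded D) (hD_lip : Impeller.HasLipschitzBoundary D)
    (r₀ : ℝ) (hr₀ : 0 < r₀) (hD_r : ∀ x ∈ D, r₀ ≤ x 1) (ε : ℝ) (hε : 0 < ε) :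
    ∃ β₀ : ℝ, 0 < β₀ ∧ ∃ C₁ : ℝ, 0 < C₁ ∧
      ∀ γ₀ γ₁ : Set Impeller.E2, IsClosed γ₀ → IsClosed γ₁ → γ₀ ∪ γ₁ = frontier D →
        (γ₀ ∩ γ₁).Finite →
      ∀ K₀ : ℝ, K₀ ≤ 1 / √(2 * β₀) →
      ∀ Θ : Impeller.E2 → ℝ, Impeller.IsBlade D K₀ Θ →
      ∀ μ : ℝ, 0 < μ →
      ∀ w : Impeller.H1Field (Impeller.channel D),
        w.VanishesOn (Impeller.solidWall D γ₀) →
        Impeller.viscousForm ε Θ μ w w ≥ μ / 4 * Impeller.omegaNormSq ε w ∧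
        μ / 4 * Impeller.omegaNormSq ε w ≥ μ / 4 * C₁ * w.h1NormSq := by
  obtain ⟨C, hC, hcoer⟩ := Impeller.exists_h1NormSq_le hD_open hD_bdd hD_lip hr₀ hD_r hε
  obtain ⟨R, hR⟩ := Impeller.exists_radius_bound hD_bdd
  obtain ⟨p, hp⟩ := hD_conn.nonempty
  have hR0 : 0 < R := hr₀.trans_le ((hD_r p hp).trans (hR p hp))
  set c : ℝ := 216 * (1 / ε + R + R / ε) ^ 2 * (R * ε) with hc
  have hc0 : 0 ≤ c := by positivity
  have hβ : 0 < 1 + c * C := by positivity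
  -- The smallness condition reads `2K₀²(1 + cC) ≤ 1`. The summand 1 ensures `K₀ ≤ 1`, and `cC`
  -- ensures `cCK₀² ≤ 1/2`, so that the error term is at most half of `μ‖w‖²_Ω`.
  refine ⟨1 + c * C, hβ, 1 / C, by positivity, ?_⟩
  intro γ₀ γ₁ _ _ _ _ K₀ hK Θ hΘ μ hμ w hw
  -- The upper bound on `K₀` can be squared only after its sign is known; a point of `D` provides
  -- it.
  have hK0 : 0 ≤ K₀ := (abs_nonneg _).trans (hΘ.2.1 p hp 0)
  have hK2 : K₀ ^ 2 * (2 * (1 + c * C)) ≤ 1 := by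
    have h1 := pow_le_pow_left₀ hK0 hK 2
    rw [div_pow, one_pow, Real.sq_sqrt (by positivity), le_div_iff₀ (by positivity)] at h1
    exact h1
  have hcC : 0 ≤ c * C := by positivity
  have hK1 : K₀ ≤ 1 := by
    rw [← sq_le_one_iff₀ hK0]
    nlinarith [mul_nonneg (sq_nonneg K₀) hcC, sq_nonneg K₀]
  have hcw := hcoer γ₀ w hw
  have hh0 : 0 ≤ w.h1NormSq := MeasureTheory.integral_nonneg fun x => by positivity
  have hω : 0 ≤ Impeller.omegaNormSq ε w := by
    by_contra hneg
    have := mul_neg_of_pos_of_neg hC (not_le.1 hneg)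
    linarith
  constructor
  · have h := Impeller.viscousForm_ge hD_open hr₀ hD_r hR hε hK0 hK1 hΘ hμ w
    rw [← hc] at h
    have h1 : c * K₀ ^ 2 * w.h1NormSq ≤ 1 / 2 * Impeller.omegaNormSq ε w := by
      have h2 : c * K₀ ^ 2 * w.h1NormSq ≤ c * K₀ ^ 2 * (C * Impeller.omegaNormSq ε w) :=
        mul_le_mul_of_nonneg_left hcw (by positivity)
      have h3 : K₀ ^ 2 * (c * C) ≤ 1 / 2 := by nlinarith [sq_nonneg K₀]
      have h4 := mul_le_mul_of_nonneg_right h3 hω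
      linarith
    have h5 := mul_le_mul_of_nonneg_left h1 hμ.le
    have h6 := mul_nonneg hμ.le hω
    linarith
  · rw [ge_iff_le, mul_assoc]
    refine mul_le_mul_of_nonneg_left ?_ (by positivity)
    rw [one_div, inv_mul_le_iff₀ hC]
    exact hcw
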